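/- Let $n\ge 2$ and let $\mathbb H^n$ be the hyperbolic space of constant sectional curvature $-1$, with Riemannian volume $dv$. For a bounded domain (bounded connected open set) $\Omega\subset\mathbb H^n$ with $C^1$ boundary let $H^2(\Omega)$ be the completion of the space of smooth functions on $\Omega$ of finite norm with respect to $\|f\|^2=\int_\Omega(|D^2f|^2+|\nabla f|^2+f^2)\,dv$, and let $\mu_1\le\mu_2\le\dots\to+\infty$ be the eigenvalues, repeated according to multiplicity, of the Neumann problem for the biharmonic operator on $\Omega$ in its weak form: find $0\ne u\in H^2(\Omega)$ and $\mu\in\mathbb R$ such that $$\int_\Omega \langle D^2u,D^2\phi\rangle+\mathrm{Ric}(\nabla u,\nabla\phi)\,dv=\mu\int_\Omega u\,\phi\,dv\qquad\text{for all }\phi\in H^2(\Omega).$$ Theorem. For every positive integer $N$ and every real $M>0$ there exists a bounded domain $\Omega\subset\mathbb H^n$ with $C^1$ boundary and with volume $|\Omega|=1$ (for which the eigenvalues are thus defined, with corresponding eigenfunctions forming a Hilbert basis of $L^2(\Omega)$) such that $\mu_j\le -M$ for all $1\le j\le N$. -/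

import Mathlib

open MeasureTheory Filter Topology
open scoped ContDiff Matrix

noncomputable section

namespace BiharmonicNeumann

/-! ### Riemannian geometry in a global chart

Points are coordinate vectors `x : Fin n → ℝ`; a Riemannian metric on an open set of `ℝⁿ` is given
by its Gram matrix `g x = (g_ij(x))`. -/

/-- The coordinate derivative `∂_i f`. -/
def pd {n : ℕ} (i : Fin n) (f : (Fin n → ℝ) → ℝ) (x : Fin n → ℝ) : ℝ :=
  fderiv ℝ f x (Pi.single i 1)

/-- Christoffel symbols
`Γ^k_ij = (1/2) ∑_l g^{kl} (∂_i g_jl + ∂_j g_il - ∂_l g_ij)` of the Levi-Civita connection. -/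
def christoffel {n : ℕ} (g : (Fin n → ℝ) → Matrix (Fin n) (Fin n) ℝ) (k i j : Fin n)
    (x : Fin n → ℝ) : ℝ :=
  (1 / 2) * ∑ l, (g x)⁻¹ k l *
    (pd i (fun y => g y j l) x + pd j (fun y => g y i l) x - pd l (fun y => g y i j) x)

/-- The Ricci tensor
`Ric_ij = ∑_k (∂_k Γ^k_ij - ∂_j Γ^k_ik) + ∑_{k,l} (Γ^k_kl Γ^l_ij - Γ^k_jl Γ^l_ik)`. -/
def ricci {n : ℕ} (g : (Fin n → ℝ) → Matrix (Fin n) (Fin n) ℝ) (x : Fin n → ℝ) :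
    Matrix (Fin n) (Fin n) ℝ :=
  Matrix.of fun i j =>
    ∑ k, (pd k (christoffel g k i j) x - pd j (christoffel g k i k) x) +
      ∑ k, ∑ l, (christoffel g k k l x * christoffel g l i j x -
        christoffel g k j l x * christoffel g l i k x)

/-- The differential `df = (∂_i f)_i`, a covector field. -/
def differential {n : ℕ} (f : (Fin n → ℝ) → ℝ) (x : Fin n → ℝ) : Fin n → ℝ :=
  fun i => pd i f x

/-- The Riemannian Hessian `(D²f)_ij = ∂_i ∂_j f - ∑_k Γ^k_ij ∂_k f`. -/
def hessian {n : ℕ} (g : (Fin n → ℝ) → Matrix (Fin n) (Fin n) ℝ) (f : (Fin n → ℝ) → ℝ)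
    (x : Fin n → ℝ) : Matrix (Fin n) (Fin n) ℝ :=
  Matrix.of fun i j => pd i (pd j f) x - ∑ k, christoffel g k i j x * pd k f x

/-- Inner product of two covectors at a point with Gram matrix `G`: `∑ G^{ij} p_i q_j`.
For `p = df`, `q = dφ` this is `⟨∇f, ∇φ⟩`. -/
def covInner {n : ℕ} (G : Matrix (Fin n) (Fin n) ℝ) (p q : Fin n → ℝ) : ℝ :=
  p ⬝ᵥ (G⁻¹ *ᵥ q)

/-- Inner product of two covariant 2-tensors at a point with Gram matrix `G`:
`∑ G^{ia} G^{jb} H_ij K_ab`. -/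
def tensorInner {n : ℕ} (G H K : Matrix (Fin n) (Fin n) ℝ) : ℝ :=
  ∑ i, ∑ j, ∑ a, ∑ b, G⁻¹ i a * G⁻¹ j b * H i j * K a b

/-- `R(p♯, q♯)` for a covariant 2-tensor `R` and covectors `p`, `q`, where `p♯ = G⁻¹ p`.
For `R = Ric`, `p = df`, `q = dφ` this is `Ric(∇f, ∇φ)`. -/
def evalSharp {n : ℕ} (G R : Matrix (Fin n) (Fin n) ℝ) (p q : Fin n → ℝ) : ℝ :=
  (G⁻¹ *ᵥ p) ⬝ᵥ (R *ᵥ (G⁻¹ *ᵥ q))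

/-- The Riemannian volume `dv = √(det g) dx`. -/
def riemVolume {n : ℕ} (g : (Fin n → ℝ) → Matrix (Fin n) (Fin n) ℝ) : Measure (Fin n → ℝ) :=
  volume.withDensity fun x => ENNReal.ofReal (Real.sqrt (g x).det)

/-- The Riemannian distance on `U` with the metric `g`: the infimum of the lengths of the `C¹` curves
in `U` from `x` to `y`. -/
def riemDist {n : ℕ} (U : Set (Fin n → ℝ)) (g : (Fin n → ℝ) → Matrix (Fin n) (Fin n) ℝ)
    (x y : Fin n → ℝ) : ENNReal :=
  ⨅ (γ : ℝ → Fin n → ℝ) (_ : ContDiff ℝ 1 γ ∧ γ 0 = x ∧ γ 1 = y ∧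
      ∀ t ∈ Set.Icc (0 : ℝ) 1, γ t ∈ U),
    ∫⁻ t in Set.Icc (0 : ℝ) 1, ENNReal.ofReal (Real.sqrt (deriv γ t ⬝ᵥ (g (γ t) *ᵥ deriv γ t)))

/-- `Ω` is a bounded domain of `(U, g)`: a connected open subset of `U` that is bounded for the
Riemannian distance. -/
structure IsBoundedDomain {n : ℕ} (U : Set (Fin n → ℝ))
    (g : (Fin n → ℝ) → Matrix (Fin n) (Fin n) ℝ) (Ω : Set (Fin n → ℝ)) : Prop where
  isOpen : IsOpen Ω
  isConnected : IsConnected Ω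
  subset : Ω ⊆ U
  bounded : ∃ R : NNReal, ∀ x ∈ Ω, ∀ y ∈ Ω, riemDist U g x y ≤ R

/-- `Ω` has boundary of class `C¹`: near each boundary point it is a sublevel set `{F < 0}` of a
`C¹` function with non-vanishing differential. -/
def HasC1Boundary {n : ℕ} (Ω : Set (Fin n → ℝ)) : Prop :=
  ∀ p ∈ frontier Ω, ∃ V : Set (Fin n → ℝ), IsOpen V ∧ p ∈ V ∧ ∃ F : (Fin n → ℝ) → ℝ,
    ContDiffOn ℝ 1 F V ∧ fderiv ℝ F p ≠ 0 ∧ Ω ∩ V = {x ∈ V | F x < 0}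

/-! ### The Sobolev space `H²(Ω)` and the Neumann problem -/

/-- `∫_Ω (|h|² + |p|² + u²) dv` for a function `u`, a covector field `p` and a 2-tensor field `h`. -/
def h2Energy {n : ℕ} (g : (Fin n → ℝ) → Matrix (Fin n) (Fin n) ℝ) (Ω : Set (Fin n → ℝ))
    (u : (Fin n → ℝ) → ℝ) (p : (Fin n → ℝ) → Fin n → ℝ)
    (h : (Fin n → ℝ) → Matrix (Fin n) (Fin n) ℝ) : ENNReal :=
  ∫⁻ x in Ω, ENNReal.ofReal
    (tensorInner (g x) (h x) (h x) + covInner (g x) (p x) (p x) + u x ^ 2) ∂(riemVolume g)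

/-- `u ∈ H²(Ω)` with differential `p` and Hessian `h`. Here `H²(Ω)` is the completion of the smooth
functions on `Ω` with finite norm `(∫_Ω |D²f|² + |∇f|² + f²)^{1/2}`: the triple `(u, p, h)` is the
limit of `(f_k, df_k, D²f_k)` in that norm for a sequence of such functions `f_k`. -/
def MemH2 {n : ℕ} (g : (Fin n → ℝ) → Matrix (Fin n) (Fin n) ℝ) (Ω : Set (Fin n → ℝ))
    (u : (Fin n → ℝ) → ℝ) (p : (Fin n → ℝ) → Fin n → ℝ)
    (h : (Fin n → ℝ) → Matrix (Fin n) (Fin n) ℝ) : Prop :=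
  AEStronglyMeasurable u ((riemVolume g).restrict Ω) ∧
  AEStronglyMeasurable p ((riemVolume g).restrict Ω) ∧
  AEStronglyMeasurable h ((riemVolume g).restrict Ω) ∧
  ∃ f : ℕ → (Fin n → ℝ) → ℝ,
    (∀ k, ContDiffOn ℝ ∞ (f k) Ω ∧
      h2Energy g Ω (f k) (differential (f k)) (hessian g (f k)) < ⊤) ∧
    Tendsto (fun k => h2Energy g Ω (fun x => u x - f k x)
      (fun x => p x - differential (f k) x) (fun x => h x - hessian g (f k) x)) atTop (𝓝 0)

/-- `u ∈ H²(Ω)` solves the weak Neumann problem for the biharmonic operator with parameter `mu`: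
`∫_Ω ⟨D²u, D²φ⟩ + Ric(∇u, ∇φ) dv = mu ∫_Ω u φ dv` for all `φ ∈ H²(Ω)`. -/
def IsNeumannSolution {n : ℕ} (g : (Fin n → ℝ) → Matrix (Fin n) (Fin n) ℝ)
    (Ω : Set (Fin n → ℝ)) (mu : ℝ) (u : (Fin n → ℝ) → ℝ) : Prop :=
  ∃ (p : (Fin n → ℝ) → Fin n → ℝ) (h : (Fin n → ℝ) → Matrix (Fin n) (Fin n) ℝ),
    MemH2 g Ω u p h ∧
    ∀ (φ : (Fin n → ℝ) → ℝ) (q : (Fin n → ℝ) → Fin n → ℝ)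
      (k : (Fin n → ℝ) → Matrix (Fin n) (Fin n) ℝ), MemH2 g Ω φ q k →
      ∫ x in Ω, (tensorInner (g x) (h x) (k x) + evalSharp (g x) (ricci g x) (p x) (q x))
          ∂(riemVolume g)
        = mu * ∫ x in Ω, u x * φ x ∂(riemVolume g)

/-- `mu 0 ≤ mu 1 ≤ ⋯ → +∞` is the sequence of the Neumann eigenvalues of the biharmonic operator on
`Ω`, each repeated according to its multiplicity: there is a Hilbert basis of `L²(Ω)` whose `j`-th
member is an eigenfunction for `mu j`. (As eigenfunctions for different eigenvalues are orthogonal,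
for every real `c` the basis members with `mu j = c` then form a basis of the space of all solutions
with parameter `c`, so that `mu` is determined by `Ω`.) -/
def IsNeumannSpectrum {n : ℕ} (g : (Fin n → ℝ) → Matrix (Fin n) (Fin n) ℝ)
    (Ω : Set (Fin n → ℝ)) (mu : ℕ → ℝ) : Prop :=
  Monotone mu ∧ Tendsto mu atTop atTop ∧
    ∃ b : HilbertBasis ℕ ℝ (Lp ℝ 2 ((riemVolume g).restrict Ω)),
      ∀ j, IsNeumannSolution g Ω (mu j) (b j : (Fin n → ℝ) → ℝ)

/-! ### Hyperbolic space -/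

/-- The upper half-space `{x | x₀ > 0}`. -/
def halfSpace (n : ℕ) [NeZero n] : Set (Fin n → ℝ) := {x | 0 < x 0}

/-- The metric `g = x₀⁻² (dx₀² + ⋯ + dx_{n-1}²)` of constant curvature `-1` on the upper half-space;
`(halfSpace n, hyperbolicMetric n)` is hyperbolic space `ℍⁿ`. -/
def hyperbolicMetric (n : ℕ) [NeZero n] (x : Fin n → ℝ) : Matrix (Fin n) (Fin n) ℝ :=
  ((x 0) ^ 2)⁻¹ • (1 : Matrix (Fin n) (Fin n) ℝ)

end BiharmonicNeumann

end

/-! On hyperbolic space `Ric = -(n-1) g`, so the form is `Q(u) = ∫ |D²u|² - (n-1)|∇u|²`. By the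
variational characterisation of eigenvalues it suffices to find, on one domain of volume 1, an
`N`-dimensional space of functions with `Q(u) ≤ -M ∫ u²`. What is needed are functions that are
small, with small Hessian, but with gradient of size one.

In the half-space model with `k ≠ 0` let `f = x_k / x_0`, the hyperbolic sine of the signed distance
to the totally geodesic hyperplane `x_k = 0`. Then `D²f = f g` and `|∇f|² = 1 + f²`. In a
neighbourhood of the vertical geodesic on which `|f| ≤ d`, both `∫ |D²f|²` and `∫ f²` are at most a
multiple of `d²` times the volume, while `∫ |∇f|²` is at least the volume. Since `n ≥ 2`, a
neighbourhood of volume one around a geodesic segment of length about `L` has width `d → 0` as `L →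
∞`. To obtain many functions, `f` is multiplied by cutoffs `χ((log x_0 - s_j)/l)` in the arclength
`log x_0` of the geodesic; these have disjoint supports, and cutting off costs only `O(1/l²)` in the
density. An exact computation (`neumannDensity_trial`, `trialDensity_le`) bounds the density of
`Q(u) + M ∫ u²` by `O(d² + 1/l²) - χ²`, and the negative term wins for small `d` and large `l`. The
domain (`slimDomain`) is given by a polynomial inequality, which makes it convex with smooth
boundary and gives its volume by slicing (`exists_width`).

It must also be shown that the spectrum exists. `H²(Ω)` is realised as the closure of the jets of
smooth functions in a product of `L²` spaces (`sobolevH2`). Convexity of `Ω` gives Poincaré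
inequalities on the cells of a grid, hence compactness of `u` and of `∇u` in `L²` relative to the
`H²` norm (`isCompactOperator_jetProj_of`). Ehrling's inequality then yields Gårding's inequality
(`exists_coercive`), and `exists_spectrum_of_form` diagonalises the form by inverting a shift of it.
`eigenvalue_le_of_testSpace` turns the trial functions into eigenvalue bounds. -/

noncomputable section

namespace BiharmonicNeumann

/-! ### Spectral theory of coercive forms with compact embedding -/

section Spectral

variable {H : Type*} [NormedAddCommGroup H] [InnerProductSpace ℝ H]

/-- The norm of a nonzero compact positive operator is an eigenvalue. -/
theorem exists_unit_eigenvector_norm [CompleteSpace H] {T : H →L[ℝ] H} (hc : IsCompactOperator T)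
    (hs : T.IsSymmetric) (hpos : ∀ x, 0 ≤ inner ℝ (T x) x) (h0 : T ≠ 0) :
    0 < ‖T‖ ∧ ∃ x, ‖x‖ = 1 ∧ T x = ‖T‖ • x := by
  have hnt : Nontrivial H := by
    by_contra h
    rw [not_nontrivial_iff_subsingleton] at h
    exact h0 (by ext x; exact Subsingleton.elim _ _)
  have hT0 : 0 < ‖T‖ := norm_pos_iff.2 h0
  -- Otherwise the Rayleigh quotients would stay below `‖T‖ - ε`, whereas the supremum of their
  -- absolute values is `‖T‖`; positivity removes the absolute values.
  have hspec : algebraMap ℝ ℝ ‖T‖ ∈ spectrum ℝ T := by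
    by_contra h
    have h' : algebraMap ℝ ℝ ‖T‖ ∈ resolventSet ℝ T := by
      by_contra h2
      exact h h2
    obtain ⟨ε, hε, hq⟩ := T.rayleighQuotient_le_of_norm_mem_resolventSet h'
    have h1 : ∀ x, |T.rayleighQuotient x| ≤ ‖T‖ - ε := by
      intro x
      rw [abs_of_nonneg]
      · exact hq x
      · exact div_nonneg (hpos x) (by positivity)
    have := T.norm_eq_iSup_rayleighQuotient hs
    have h3 : ‖T‖ ≤ ‖T‖ - ε := by
      conv_lhs => rw [this]
      exact ciSup_le h1
    linarith
  have := (hc.hasEigenvalue_iff_mem_spectrum (μ := ‖T‖) hT0.ne').2 hspec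
  obtain ⟨v, hv⟩ := this.exists_hasEigenvector
  have hv0 : ‖v‖ ≠ 0 := norm_ne_zero_iff.2 hv.2
  refine ⟨hT0, ‖v‖⁻¹ • v, by rw [norm_smul]; simp [hv0], ?_⟩
  have h1 := hv.apply_eq_smul
  have h2 : T v = ‖T‖ • v := h1
  rw [map_smul, h2, smul_comm]

/-- On the orthogonal complement of an invariant finite-dimensional subspace, a positive compact
operator attains its maximal Rayleigh quotient at an eigenvector. -/
theorem exists_eigenvector_orthogonal [CompleteSpace H] {T : H →L[ℝ] H} (hc : IsCompactOperator T)
    (hs : T.IsSymmetric) (hpos : ∀ x, x ≠ 0 → 0 < inner ℝ (T x) x)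
    (hinf : ¬ FiniteDimensional ℝ H) (U : Submodule ℝ H) [FiniteDimensional ℝ U]
    (hU : ∀ x ∈ U, T x ∈ U) :
    ∃ (x : H) (t : ℝ), ‖x‖ = 1 ∧ x ∈ Uᗮ ∧ 0 < t ∧ T x = t • x ∧
      ∀ y ∈ Uᗮ, inner ℝ (T y) y ≤ t * ‖y‖ ^ 2 := by
  have hinv : ∀ x ∈ Uᗮ, T x ∈ Uᗮ := by
    intro x hx u hu
    have h1 : inner ℝ (T u) x = inner ℝ u (T x) := hs u x
    rw [← h1]
    exact hx _ (hU u hu)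
  let S : Uᗮ →L[ℝ] Uᗮ := T.restrict hinv
  have hSc : IsCompactOperator S := hc.restrict' hinv
  have hSs : S.IsSymmetric := hs.restrict_invariant hinv
  have hSi : ∀ x : Uᗮ, inner ℝ (S x) x = inner ℝ (T x) (x : H) := fun x => rfl
  have hne : Uᗮ ≠ ⊥ := by
    intro h
    apply hinf
    have : U = ⊤ := (Submodule.orthogonal_eq_bot_iff).1 h
    subst this
    exact Module.Finite.equiv (Submodule.topEquiv (R := ℝ) (M := H))
  obtain ⟨z, hz, hz0⟩ := Submodule.exists_mem_ne_zero_of_ne_bot hne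
  have hS0 : S ≠ 0 := by
    intro h
    have h1 := hpos z hz0
    have h2 := hSi ⟨z, hz⟩
    rw [h] at h2
    simp at h2
    linarith
  obtain ⟨hSn, x, hx1, hx⟩ := exists_unit_eigenvector_norm hSc hSs (fun x => by
    rw [hSi]
    by_cases h : (x : H) = 0
    · rw [h]; simp
    · exact (hpos _ h).le) hS0
  refine ⟨x, ‖S‖, hx1, x.2, hSn, congrArg Subtype.val hx, fun y hy => ?_⟩
  calc inner ℝ (T y) y = inner ℝ (S ⟨y, hy⟩) (⟨y, hy⟩ : Uᗮ) := rfl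
    _ ≤ ‖S ⟨y, hy⟩‖ * ‖(⟨y, hy⟩ : Uᗮ)‖ := real_inner_le_norm _ _
    _ ≤ (‖S‖ * ‖(⟨y, hy⟩ : Uᗮ)‖) * ‖(⟨y, hy⟩ : Uᗮ)‖ := by gcongr; exact S.le_opNorm _
    _ = ‖S‖ * ‖y‖ ^ 2 := by rw [Submodule.coe_norm]; ring

/-- A positive definite compact operator on an infinite-dimensional Hilbert space has a Hilbert
basis of eigenvectors ordered by decreasing eigenvalue, with the max-min property. -/
theorem exists_hilbertBasis_eigenvectors [CompleteSpace H] {T : H →L[ℝ] H} (hc : IsCompactOperator T)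
    (hs : T.IsSymmetric) (hpos : ∀ x, x ≠ 0 → 0 < inner ℝ (T x) x)
    (hinf : ¬ FiniteDimensional ℝ H) :
    ∃ (t : ℕ → ℝ) (b : HilbertBasis ℕ ℝ H), (∀ j, 0 < t j) ∧ Antitone t ∧
      Tendsto t atTop (𝓝 0) ∧ (∀ j, T (b j) = t j • b j) ∧
      ∀ j y, (∀ i < j, inner ℝ (b i) y = 0) → inner ℝ (T y) y ≤ t j * ‖y‖ ^ 2 := by
  -- Eigenvectors are built by recursion over finite-dimensional invariant subspaces: each stage
  -- adjoins a maximiser of the Rayleigh quotient on the orthogonal complement.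
  let X := {U : Submodule ℝ H // FiniteDimensional ℝ U ∧ ∀ x ∈ U, T x ∈ U}
  have step : ∀ U : X, ∃ (x : H) (t : ℝ), ‖x‖ = 1 ∧ x ∈ U.1ᗮ ∧ 0 < t ∧ T x = t • x ∧
      ∀ y ∈ U.1ᗮ, inner ℝ (T y) y ≤ t * ‖y‖ ^ 2 := fun U => by
    have := U.2.1
    exact exists_eigenvector_orthogonal hc hs hpos hinf U.1 U.2.2
  choose ξ τ hξ1 hξU hτ hTξ hmax using step
  let next : X → X := fun U => ⟨U.1 ⊔ Submodule.span ℝ {ξ U}, by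
    have := U.2.1
    exact inferInstance, by
    have h1 : U.1 ⊔ Submodule.span ℝ {ξ U} ≤ (U.1 ⊔ Submodule.span ℝ {ξ U}).comap T.toLinearMap := by
      refine sup_le ?_ ?_
      · intro x hx
        exact Submodule.mem_sup_left (U.2.2 x hx)
      · rw [Submodule.span_singleton_le_iff_mem, Submodule.mem_comap]
        change T (ξ U) ∈ _
        rw [hTξ]
        exact Submodule.smul_mem _ _
          (Submodule.mem_sup_right (Submodule.mem_span_singleton_self _))
    exact fun x hx => h1 hx⟩
  let U : ℕ → X := fun k => Nat.rec ⟨⊥, inferInstance, by simp⟩ (fun _ W => next W) k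
  have hU0 : (U 0).1 = ⊥ := rfl
  have hUs : ∀ k, (U (k + 1)).1 = (U k).1 ⊔ Submodule.span ℝ {ξ (U k)} := fun k => rfl
  have hUmono : Monotone fun k => (U k).1 :=
    monotone_nat_of_le_succ fun k => by rw [hUs]; exact le_sup_left
  have hmem : ∀ i k, i < k → ξ (U i) ∈ (U k).1 := fun i k hik =>
    hUmono (Nat.succ_le_of_lt hik) (by
      change ξ (U i) ∈ (U (i + 1)).1
      rw [hUs]
      exact Submodule.mem_sup_right (Submodule.mem_span_singleton_self _))
  have horth : ∀ k y, (∀ i < k, inner ℝ (ξ (U i)) y = 0) → y ∈ (U k).1ᗮ := by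
    intro k y
    induction k with
    | zero => intro _; rw [hU0]; simp
    | succ k ih =>
      intro h
      rw [hUs, ← Submodule.inf_orthogonal]
      refine ⟨ih fun i hi => h i (by omega), ?_⟩
      rw [SetLike.mem_coe, Submodule.mem_orthogonal_singleton_iff_inner_right]
      exact h k (by omega)
  let b : ℕ → H := fun k => ξ (U k)
  let t : ℕ → ℝ := fun k => τ (U k)
  have hon : Orthonormal ℝ b := by
    refine ⟨fun k => hξ1 _, ?_⟩
    have hlt : ∀ i k, i < k → inner ℝ (b i) (b k) = 0 := fun i k hik =>
      hξU (U k) _ (hmem i k hik)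
    intro i k hik
    rcases lt_or_gt_of_ne hik with h | h
    · exact hlt i k h
    · rw [real_inner_comm]; exact hlt k i h
  have hTb : ∀ k, T (b k) = t k • b k := fun k => hTξ _
  have hmx : ∀ k y, (∀ i < k, inner ℝ (b i) y = 0) → inner ℝ (T y) y ≤ t k * ‖y‖ ^ 2 :=
    fun k y h => hmax _ y (horth k y h)
  have hanti : Antitone t := by
    intro i k hik
    have h1 := hmx i (b k) (fun j hj => hon.2 (by omega))
    rw [hTb, inner_smul_left, real_inner_self_eq_norm_sq, hon.1] at h1
    simpa using h1
  -- If `t` stayed above `c > 0`, the vectors `T (b k)` would be mutually at distance more than `c`,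
  -- and no subsequence could converge in a compact set.
  have hlim : Tendsto t atTop (𝓝 0) := by
    by_contra hnl
    have hbd : ∃ c > 0, ∀ k, c ≤ t k := by
      by_contra hcon
      push Not at hcon
      apply hnl
      rw [Metric.tendsto_atTop]
      intro ε hε
      obtain ⟨k, hk⟩ := hcon ε hε
      refine ⟨k, fun j hj => ?_⟩
      rw [Real.dist_eq, sub_zero, abs_of_pos (hτ _)]
      exact (hanti hj).trans_lt hk
    obtain ⟨c, hc0, hck⟩ := hbd
    obtain ⟨Z, hZ, hsub⟩ := hc.image_closedBall_subset_compact (f := T.toLinearMap) 1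
    have hin : ∀ k, T (b k) ∈ Z := fun k => hsub ⟨b k, by simp [hon.1], rfl⟩
    obtain ⟨a, -, φ, hφ, hconv⟩ := hZ.tendsto_subseq hin
    have hcau := hconv.cauchySeq
    rw [Metric.cauchySeq_iff'] at hcau
    obtain ⟨k, hk⟩ := hcau c hc0
    have h1 := hk (k + 1) (by omega)
    simp only [Function.comp, hTb] at h1
    rw [dist_eq_norm] at h1
    have hne : φ (k + 1) ≠ φ k := (hφ (Nat.lt_succ_self k)).ne'
    have h2 : ‖t (φ (k + 1)) • b (φ (k + 1)) - t (φ k) • b (φ k)‖ ^ 2 =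
        t (φ (k + 1)) ^ 2 + t (φ k) ^ 2 := by
      rw [@norm_sub_sq_real, inner_smul_left, inner_smul_right, hon.2 hne, norm_smul, norm_smul,
        hon.1, hon.1]
      simp
    have h3 := hck (φ k)
    have h4 := norm_nonneg (t (φ (k + 1)) • b (φ (k + 1)) - t (φ k) • b (φ k))
    nlinarith [sq_nonneg (t (φ (k + 1)))]
  -- A vector orthogonal to every `b k` satisfies `⟨T y, y⟩ ≤ t k ‖y‖²` for all `k`, hence `⟨T y, y⟩
  -- ≤ 0`, against positivity.
  have hbot : (Submodule.span ℝ (Set.range b))ᗮ = ⊥ := by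
    rw [eq_bot_iff]
    intro y hy
    rw [Submodule.mem_bot]
    by_contra hy0
    have h1 := hpos y hy0
    have h2 : ∀ k, inner ℝ (T y) y ≤ t k * ‖y‖ ^ 2 := fun k => hmx k y fun i _ =>
      hy _ (Submodule.subset_span ⟨i, rfl⟩)
    have h3 : Tendsto (fun k => t k * ‖y‖ ^ 2) atTop (𝓝 (0 * ‖y‖ ^ 2)) := hlim.mul_const _
    have h4 := ge_of_tendsto' h3 h2
    linarith
  refine ⟨t, HilbertBasis.mkOfOrthogonalEqBot hon hbot, fun k => hτ _, hanti, hlim, ?_, ?_⟩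
  · intro k
    rw [HilbertBasis.coe_mkOfOrthogonalEqBot]
    exact hTb k
  · intro k y h
    rw [HilbertBasis.coe_mkOfOrthogonalEqBot] at h
    exact hmx k y h

variable {V : Type*} [NormedAddCommGroup V] [InnerProductSpace ℝ V]

/-- The spectrum of a symmetric bounded form `a` on `V` that is coercive relative to a compact map
`J : V → H` with dense range. -/
theorem exists_spectrum_of_form [CompleteSpace H] [CompleteSpace V] (hinf : ¬ FiniteDimensional ℝ H) (J : V →L[ℝ] H)
    (hJc : IsCompactOperator J) (hJd : DenseRange J) (a : V →L[ℝ] V →L[ℝ] ℝ)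
    (hsymm : ∀ v w, a v w = a w v) (lam c : ℝ) (hc : 0 < c)
    (hcoer : ∀ v, c * ‖v‖ ^ 2 ≤ a v v + lam * ‖J v‖ ^ 2) :
    ∃ (mu : ℕ → ℝ) (b : HilbertBasis ℕ ℝ H), Monotone mu ∧ Tendsto mu atTop atTop ∧
      (∀ j, ∃ v, J v = b j ∧ ∀ w, a v w = mu j * inner ℝ (b j) (J w)) ∧
      ∀ j v, (∀ i < j, inner ℝ (b i) (J v) = 0) → mu j * ‖J v‖ ^ 2 ≤ a v v := by
  let I : H →L[ℝ] H →L[ℝ] ℝ := innerSL ℝ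
  -- The shifted form is coercive, so Lax–Milgram applies. The solution operator `R` satisfies `B (R
  -- y) w = ⟨y, J w⟩`, and `T = J R` is compact, symmetric and, as `J` has dense range, positive
  -- definite. An eigenvalue `t` of `T` corresponds to the eigenvalue `1/t - lam` of the form.
  let B : V →L[ℝ] V →L[ℝ] ℝ := a + lam • (I.bilinearComp J J)
  have hB : ∀ v w, B v w = a v w + lam * inner ℝ (J v) (J w) := fun v w => by
    have hI : I (J v) (J w) = inner ℝ (J v) (J w) := rfl
    simp [B, hI]
  have hBc : IsCoercive B := ⟨c, hc, fun v => by
    rw [hB, real_inner_self_eq_norm_sq]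
    have := hcoer v
    nlinarith⟩
  have hBs : ∀ v w, B v w = B w v := fun v w => by
    rw [hB, hB, hsymm, real_inner_comm]
  have hBpos : ∀ v, v ≠ 0 → 0 < B v v := fun v hv => by
    rw [hB, real_inner_self_eq_norm_sq]
    have h1 := hcoer v
    have h2 : 0 < ‖v‖ ^ 2 := by positivity
    nlinarith
  let A := hBc.continuousLinearEquivOfBilin
  have hA : ∀ v w, inner ℝ (A v) w = B v w := fun v w => hBc.continuousLinearEquivOfBilin_apply v w
  let R : H →L[ℝ] V := A.symm.toContinuousLinearMap ∘L (ContinuousLinearMap.adjoint J)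
  have hR : ∀ y w, B (R y) w = inner ℝ y (J w) := fun y w => by
    rw [← hA]
    simp [R, ContinuousLinearMap.adjoint_inner_left]
  let T : H →L[ℝ] H := J ∘L R
  have hTin : ∀ y z, inner ℝ (T y) z = B (R z) (R y) := fun y z => by
    rw [hR, real_inner_comm]; rfl
  have hTs : T.IsSymmetric := fun y z => by
    change inner ℝ (T y) z = inner ℝ y (T z)
    rw [hTin, real_inner_comm, hTin, hBs]
  have hTpos : ∀ x, x ≠ 0 → 0 < inner ℝ (T x) x := fun x hx => by
    rw [hTin]
    apply hBpos
    intro h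
    apply hx
    have h1 : ∀ w, inner ℝ x (J w) = 0 := fun w => by rw [← hR, h]; simp
    have h2 : ∀ z : H, inner ℝ x z = 0 := by
      intro z
      have := hJd.induction_on (p := fun z => inner ℝ x z = 0) z
        (isClosed_eq (by fun_prop) continuous_const) h1
      exact this
    exact inner_self_eq_zero.1 (h2 x)
  have hTc : IsCompactOperator T := hJc.comp_clm R
  obtain ⟨t, b, ht, hanti, hlim, heig, hmx⟩ := exists_hilbertBasis_eigenvectors hTc hTs hTpos hinf
  refine ⟨fun j => (t j)⁻¹ - lam, b, ?_, ?_, ?_, ?_⟩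
  · intro i j hij
    have := inv_anti₀ (ht j) (hanti hij)
    simpa using this
  · have h1 : Tendsto t atTop (𝓝[>] 0) :=
      tendsto_nhdsWithin_iff.2 ⟨hlim, Eventually.of_forall ht⟩
    exact tendsto_atTop_add_const_right _ _ h1.inv_tendsto_nhdsGT_zero
  · intro j
    refine ⟨(t j)⁻¹ • R (b j), ?_, ?_⟩
    · rw [map_smul]
      change (t j)⁻¹ • T (b j) = _
      rw [heig, smul_smul, inv_mul_cancel₀ (ht j).ne', one_smul]
    · intro w
      have h1 : B ((t j)⁻¹ • R (b j)) w = (t j)⁻¹ * inner ℝ (b j) (J w) := by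
        rw [map_smul, _root_.smul_apply, hR, smul_eq_mul]
      have h2 : J ((t j)⁻¹ • R (b j)) = b j := by
        rw [map_smul]
        change (t j)⁻¹ • T (b j) = _
        rw [heig, smul_smul, inv_mul_cancel₀ (ht j).ne', one_smul]
      rw [hB, h2] at h1
      linarith
  · intro j v hv
    have h1 := hmx j (J v) hv
    rw [hTin] at h1
    have h2 : B (R (J v)) v = ‖J v‖ ^ 2 := by rw [hR, real_inner_self_eq_norm_sq]
    -- The max-min property of `T` bounds `B` at `R (J v)`. Expanding `B ≥ 0` at `v - s R (J v)`
    -- with the optimal `s = 1/t j` turns this into the lower bound `B v v ≥ ‖J v‖² / t j`.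
    have h3 : ∀ s : ℝ, 0 ≤ B (v - s • R (J v)) (v - s • R (J v)) := fun s => by
      by_cases h : v - s • R (J v) = 0
      · rw [h]; simp
      · exact (hBpos _ h).le
    have h4 := h3 (t j)⁻¹
    have h5 : B v (R (J v)) = ‖J v‖ ^ 2 := by rw [hBs, h2]
    simp only [map_sub, map_smul, _root_.sub_apply, _root_.smul_apply,
      h2, h5, smul_eq_mul] at h4
    have h6 : (t j)⁻¹ * ((t j)⁻¹ * B (R (J v)) (R (J v))) ≤ (t j)⁻¹ * ‖J v‖ ^ 2 := by
      have hp : 0 < (t j)⁻¹ := inv_pos.2 (ht j)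
      refine mul_le_mul_of_nonneg_left ?_ hp.le
      rw [inv_mul_le_iff₀ (ht j)]
      exact h1
    have h7 := hB v v
    rw [real_inner_self_eq_norm_sq] at h7
    nlinarith

/-- If the form is at most `-M` times the `H`-norm on an `N`-dimensional space of vectors, then the
first `N` eigenvalues are at most `-M`. -/
theorem eigenvalue_le_of_testSpace (J : V →L[ℝ] H) (a : V →L[ℝ] V →L[ℝ] ℝ) (lam c : ℝ) (hc : 0 < c)
    (hcoer : ∀ v, c * ‖v‖ ^ 2 ≤ a v v + lam * ‖J v‖ ^ 2) {mu : ℕ → ℝ} {b : ℕ → H}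
    (hmm : ∀ j v, (∀ i < j, inner ℝ (b i) (J v) = 0) → mu j * ‖J v‖ ^ 2 ≤ a v v)
    {N : ℕ} {M : ℝ} (v : Fin N → V) (hv : LinearIndependent ℝ v)
    (hq : ∀ s : Fin N → ℝ, a (∑ i, s i • v i) (∑ i, s i • v i) ≤
      -M * ‖J (∑ i, s i • v i)‖ ^ 2) (j : ℕ) (hj : j < N) : mu j ≤ -M := by
  -- Orthogonality to the first `j < N` eigenvectors imposes `j` linear conditions on `N`
  -- coefficients, so some nonzero combination satisfies them all.
  let L : (Fin N → ℝ) →ₗ[ℝ] (Fin j → ℝ) := LinearMap.pi fun i =>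
    (innerₗ H (b i)) ∘ₗ J.toLinearMap ∘ₗ (Fintype.linearCombination ℝ v)
  have hker : LinearMap.ker L ≠ ⊥ := LinearMap.ker_ne_bot_of_finrank_lt (by simpa using hj)
  obtain ⟨s, hs, hs0⟩ := Submodule.exists_mem_ne_zero_of_ne_bot hker
  set w := ∑ i, s i • v i with hw
  have hw0 : w ≠ 0 := by
    intro h
    exact hs0 (funext (Fintype.linearIndependent_iff.1 hv s h))
  have horth : ∀ i < j, inner ℝ (b i) (J w) = 0 := fun i hi => by
    have := congrFun (LinearMap.mem_ker.1 hs) ⟨i, hi⟩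
    simpa [L, Fintype.linearCombination_apply, hw, inner_sum, inner_smul_right] using this
  have h1 := hmm j w horth
  have h2 := hq s
  have h3 := hcoer w
  have h4 : 0 < c * ‖w‖ ^ 2 := by positivity
  -- Were `J w = 0`, the form at `w` would be at most `0` by the test hypothesis and positive by
  -- coercivity.
  have h5 : 0 < ‖J w‖ ^ 2 := by
    by_contra hcon
    have h6 : ‖J w‖ ^ 2 = 0 := le_antisymm (not_lt.1 hcon) (by positivity)
    rw [← hw, h6] at h2
    rw [h6] at h3
    linarith
  rw [← hw] at h2
  by_contra hcon
  push Not at hcon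
  nlinarith

/-- A bounded operator that is uniformly approximated by finite-dimensional subspaces on a dense
subspace is compact. -/
theorem isCompactOperator_of_approx [CompleteSpace H] (K : V →L[ℝ] H) {S : Set V} (hS : Dense S)
    (h : ∀ ε > 0, ∃ U : Submodule ℝ H, FiniteDimensional ℝ U ∧
      ∀ v ∈ S, ∃ w ∈ U, ‖K v - w‖ ≤ ε * ‖v‖) : IsCompactOperator K := by
  have hcl := isClosed_setOfPred_isCompactOperator (σ₁₂ := RingHom.id ℝ) (M₁ := V) (M₂ := H)
  have : K ∈ closure {f : V →L[ℝ] H | IsCompactOperator f} := by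
    rw [Metric.mem_closure_iff]
    intro ε hε
    obtain ⟨U, hU, hap⟩ := h (ε / 2) (by positivity)
    -- The finite-rank approximant is `K` followed by the orthogonal projection to `U`. The best
    -- approximation property bounds the error on the dense set, and continuity extends the bound.
    refine ⟨U.starProjection ∘L K, ?_, ?_⟩
    · have h1 : IsCompactOperator (U.orthogonalProjectionOnto : H →L[ℝ] U) :=
        isCompactOperator_of_locallyCompactSpace_dom U.orthogonalProjectionOnto
      exact (h1.comp_clm K).clm_comp U.subtypeL
    · rw [dist_eq_norm]
      refine lt_of_le_of_lt (ContinuousLinearMap.opNorm_le_bound _ (by positivity : 0 ≤ ε / 2) ?_)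
        (by linarith)
      refine fun v => isClosed_property hS.denseRange_val
        (p := fun v => ‖(K - U.starProjection ∘L K) v‖ ≤ ε / 2 * ‖v‖)
        (isClosed_le (by fun_prop) (by fun_prop)) (fun ⟨v, hv⟩ => ?_) v
      obtain ⟨w, hw, hvw⟩ := hap v hv
      refine le_trans ?_ hvw
      have h1 : ‖K v - U.starProjection (K v)‖ = ⨅ w : U, ‖K v - w‖ :=
        U.starProjection_minimal (K v)
      change ‖K v - U.starProjection (K v)‖ ≤ _
      rw [h1]
      exact ciInf_le ⟨0, by rintro _ ⟨w, rfl⟩; positivity⟩ (⟨w, hw⟩ : U)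
  rw [hcl.closure_eq] at this
  exact this

/-- Ehrling's inequality. -/
theorem exists_norm_sq_le_of_compact {W : Type*} [SeminormedAddCommGroup W] [NormedSpace ℝ W]
    (K : V →L[ℝ] H) (hK : IsCompactOperator K)
    (J : V →L[ℝ] W) {D : Set H} (hD : Dense D)
    (h : ∀ φ ∈ D, ∃ C, ∀ v, |inner ℝ φ (K v)| ≤ C * ‖J v‖) {ε : ℝ} (hε : 0 < ε) :
    ∃ C, ∀ v, ‖K v‖ ^ 2 ≤ ε * ‖v‖ ^ 2 + C * ‖J v‖ ^ 2 := by
  choose! C hC using h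
  set δ : ℝ := ε / (4 * (‖K‖ + 1)) with hδ
  have hδ0 : 0 < δ := by positivity
  have hδK : δ * ‖K‖ ≤ ε / 4 := by
    rw [hδ, div_mul_eq_mul_div, div_le_div_iff₀ (by positivity) (by norm_num)]
    nlinarith [norm_nonneg K]
  obtain ⟨Z, hZ, hsub⟩ := hK.image_closedBall_subset_compact (f := K.toLinearMap) 1
  obtain ⟨t, -, ht, hcov⟩ := hZ.finite_cover_balls hδ0
  have happ : ∀ y : H, ∃ φ ∈ D, ‖y - φ‖ < δ := fun y => by
    obtain ⟨φ, hφ, h⟩ := Metric.mem_closure_iff.1 (hD y) δ hδ0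
    exact ⟨φ, hφ, by rwa [← dist_eq_norm]⟩
  choose φ hφD hφ using happ
  obtain ⟨C₀, hC₀⟩ := (ht.image fun y => C (φ y)).bddAbove
  set C₁ := max C₀ 0
  have hunit : ∀ v, ‖v‖ ≤ 1 → ‖K v‖ ^ 2 ≤ ε / 2 + C₁ * ‖J v‖ := by
    intro v hv
    have hKv : K v ∈ Z := hsub ⟨v, by simpa using hv, rfl⟩
    obtain ⟨y, hy, hyv⟩ := Set.mem_iUnion₂.1 (hcov hKv)
    have hb : ‖K v - y‖ < δ := by rwa [← dist_eq_norm]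
    have hKn : ‖K v‖ ≤ ‖K‖ := (K.le_opNorm v).trans (by nlinarith [norm_nonneg K])
    have e : ‖K v‖ ^ 2 = inner ℝ (K v - y) (K v) + inner ℝ (y - φ y) (K v) + inner ℝ (φ y) (K v) := by
      rw [← inner_add_left, ← inner_add_left, ← real_inner_self_eq_norm_sq]
      congr 1
      abel
    have e1 : inner ℝ (K v - y) (K v) ≤ δ * ‖K‖ :=
      (real_inner_le_norm _ _).trans (mul_le_mul hb.le hKn (norm_nonneg _) hδ0.le)
    have e2 : inner ℝ (y - φ y) (K v) ≤ δ * ‖K‖ :=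
      (real_inner_le_norm _ _).trans (mul_le_mul (hφ y).le hKn (norm_nonneg _) hδ0.le)
    have e3 : inner ℝ (φ y) (K v) ≤ C₁ * ‖J v‖ := by
      refine (le_abs_self _).trans ((hC _ (hφD y) v).trans ?_)
      refine mul_le_mul_of_nonneg_right ?_ (norm_nonneg _)
      exact (hC₀ ⟨y, hy, rfl⟩).trans (le_max_left _ _)
    linarith
  have hC₁ : 0 ≤ C₁ := le_max_right _ _
  refine ⟨C₁ ^ 2 / (2 * ε), fun v => ?_⟩
  by_cases hv : v = 0
  · subst hv; simp
  have hv0 : 0 < ‖v‖ := norm_pos_iff.2 hv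
  have h1 := hunit (‖v‖⁻¹ • v) (by rw [norm_smul]; simp [hv0.ne'])
  rw [map_smul, map_smul, norm_smul, norm_smul, norm_inv, norm_norm, mul_pow, inv_pow,
    inv_mul_le_iff₀ (by positivity)] at h1
  have h2 : ‖v‖ ^ 2 * (ε / 2 + C₁ * (‖v‖⁻¹ * ‖J v‖)) = ε / 2 * ‖v‖ ^ 2 + C₁ * ‖v‖ * ‖J v‖ := by
    field_simp
  rw [h2] at h1
  -- Young's inequality splits the mixed term left by homogeneity.
  have h3 : C₁ * ‖v‖ * ‖J v‖ ≤ ε / 2 * ‖v‖ ^ 2 + C₁ ^ 2 / (2 * ε) * ‖J v‖ ^ 2 := by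
    have : 0 ≤ (ε * ‖v‖ - C₁ * ‖J v‖) ^ 2 / (2 * ε) := by positivity
    have e : (ε * ‖v‖ - C₁ * ‖J v‖) ^ 2 / (2 * ε) =
        ε / 2 * ‖v‖ ^ 2 + C₁ ^ 2 / (2 * ε) * ‖J v‖ ^ 2 - C₁ * ‖v‖ * ‖J v‖ := by
      field_simp
      ring
    linarith
  linarith

end Spectral

/-! ### A Poincaré inequality on convex sets -/

section Poincare

theorem sq_lintegral_le {α : Type*} [MeasurableSpace α] (μ : Measure α) {f : α → ENNReal}
    (hf : AEMeasurable f μ) : (∫⁻ x, f x ∂μ) ^ 2 ≤ μ Set.univ * ∫⁻ x, f x ^ 2 ∂μ := by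
  have h := ENNReal.lintegral_mul_le_Lp_mul_Lq μ Real.HolderConjugate.two_two
    (aemeasurable_const (b := (1 : ENNReal))) hf
  simp only [Pi.mul_apply, one_mul, ENNReal.one_rpow, lintegral_const] at h
  calc (∫⁻ x, f x ∂μ) ^ 2 ≤ ((μ Set.univ) ^ (1 / 2 : ℝ) * (∫⁻ x, f x ^ (2 : ℝ) ∂μ) ^ (1 / 2 : ℝ)) ^ 2 := by
        gcongr
    _ = μ Set.univ * ∫⁻ x, f x ^ 2 ∂μ := by
        rw [mul_pow, ← ENNReal.rpow_natCast, ← ENNReal.rpow_natCast, ← ENNReal.rpow_mul,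
          ← ENNReal.rpow_mul]
        simp

variable {n : ℕ}

theorem lintegral_comp_add_smul {G : (Fin n → ℝ) → ENNReal} (hG : Measurable G) (c : Fin n → ℝ)
    {r : ℝ} (hr : r ≠ 0) :
    ∫⁻ y, G (c + r • y) = ENNReal.ofReal |(r ^ n)⁻¹| * ∫⁻ y, G y := by
  have h1 : ∫⁻ y, G (c + r • y) = ∫⁻ z, G (c + z) ∂(Measure.map (r • ·) volume) := by
    rw [lintegral_map (by fun_prop) (by fun_prop)]
  rw [h1, Measure.map_addHaar_smul volume hr, lintegral_smul_measure, lintegral_add_left_eq_self]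
  simp

/-- One of `s` and `1 - s` is at least `1/2`. Substituting in the variable that carries this
coefficient costs a Jacobian of at most `2 ^ n`, uniformly in `s`. -/
theorem lintegral_convexCombination_le {G : (Fin n → ℝ) → ENNReal} (hG : Measurable G)
    (Q : Set (Fin n → ℝ)) (s : ℝ) :
    ∫⁻ x in Q, ∫⁻ y in Q, G (y + s • (x - y)) ≤ 2 ^ n * volume Q * ∫⁻ z, G z := by
  have key : ∀ r : ℝ, 1 / 2 ≤ r → ∀ c, ∫⁻ y in Q, G (c + r • y) ≤ 2 ^ n * ∫⁻ z, G z := by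
    intro r hr c
    refine (lintegral_mono' Measure.restrict_le_self le_rfl).trans ?_
    rw [lintegral_comp_add_smul hG c (by linarith)]
    gcongr
    rw [abs_of_nonneg (by positivity), ← inv_pow]
    have h2 : r⁻¹ ≤ 2 := by
      rw [inv_le_comm₀ (by linarith) (by norm_num)]; linarith
    calc ENNReal.ofReal (r⁻¹ ^ n) ≤ ENNReal.ofReal (2 ^ n) := by
          apply ENNReal.ofReal_le_ofReal; gcongr
      _ = 2 ^ n := by rw [ENNReal.ofReal_pow (by norm_num)]; simp
  rcases le_total s (1 / 2) with h | h
  · calc ∫⁻ x in Q, ∫⁻ y in Q, G (y + s • (x - y))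
        = ∫⁻ x in Q, ∫⁻ y in Q, G (s • x + (1 - s) • y) := by
          have e : ∀ x y : Fin n → ℝ, y + s • (x - y) = s • x + (1 - s) • y := fun x y => by module
          simp_rw [e]
      _ ≤ ∫⁻ x in Q, 2 ^ n * ∫⁻ z, G z := lintegral_mono fun x => key _ (by linarith) _
      _ = _ := by simp; ring
  · rw [lintegral_lintegral_swap]
    · calc ∫⁻ y in Q, ∫⁻ x in Q, G (y + s • (x - y))
          = ∫⁻ y in Q, ∫⁻ x in Q, G ((1 - s) • y + s • x) := by
            have e : ∀ x y : Fin n → ℝ, y + s • (x - y) = (1 - s) • y + s • x := fun x y => by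
              module
            simp_rw [e]
        _ ≤ ∫⁻ x in Q, 2 ^ n * ∫⁻ z, G z := lintegral_mono fun x => key _ (by linarith) _
        _ = _ := by simp; ring
    · exact (hG.comp (by fun_prop)).aemeasurable

/-- The fundamental theorem of calculus on the segment from `y` to `x`, then Cauchy–Schwarz.
Convexity keeps the segment in `Q`, so the indicator costs nothing; it allows the later changes of
variable to range over all of space. -/
theorem enorm_sub_sq_le_lintegral_segment {Ω Q : Set (Fin n → ℝ)} (hΩ : IsOpen Ω)
    (hQ : Convex ℝ Q) (hQΩ : Q ⊆ Ω) {d : ℝ} (hd : ∀ x ∈ Q, ∀ y ∈ Q, ‖x - y‖ ≤ d)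
    {g : (Fin n → ℝ) → ℝ} (hg : ContDiffOn ℝ 1 g Ω) {x y : Fin n → ℝ} (hx : x ∈ Q) (hy : y ∈ Q) :
    ‖g x - g y‖ₑ ^ 2 ≤ ENNReal.ofReal (d ^ 2) *
      ∫⁻ s in Set.Icc (0 : ℝ) 1, Q.indicator (fun z => ‖fderiv ℝ g z‖ₑ ^ 2) (y + s • (x - y)) := by
  have hseg : ∀ s ∈ Set.Icc (0 : ℝ) 1, y + s • (x - y) ∈ Q := fun s hs =>
    hQ.add_smul_sub_mem hy hx hs
  have hcont : ContinuousOn (fun s : ℝ => fderiv ℝ g (y + s • (x - y)) (x - y)) (Set.Icc 0 1) := by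
    have h1 : ContinuousOn (fderiv ℝ g) Ω := hg.continuousOn_fderiv_of_isOpen hΩ le_rfl
    have h2 : ContinuousOn (fun s : ℝ => fderiv ℝ g (y + s • (x - y))) (Set.Icc 0 1) :=
      h1.comp (by fun_prop) fun s hs => hQΩ (hseg s hs)
    exact h2.clm_apply continuousOn_const
  have hFTC : ∫ s in (0 : ℝ)..1, fderiv ℝ g (y + s • (x - y)) (x - y) = g x - g y := by
    rw [intervalIntegral.integral_eq_sub_of_hasDerivAt (f := fun s => g (y + s • (x - y)))]
    · simp
    · intro s hs
      rw [Set.uIcc_of_le zero_le_one] at hs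
      have h1 : HasFDerivAt g (fderiv ℝ g (y + s • (x - y))) (y + s • (x - y)) :=
        ((hg.contDiffAt (hΩ.mem_nhds (hQΩ (hseg s hs)))).differentiableAt (by norm_num)).hasFDerivAt
      have h2 : HasDerivAt (fun s : ℝ => y + s • (x - y)) (x - y) s := by
        simpa using ((hasDerivAt_id s).smul_const (x - y)).const_add y
      exact h1.comp_hasDerivAt s h2
    · exact ContinuousOn.intervalIntegrable (by rwa [Set.uIcc_of_le zero_le_one])
  have hd0 : 0 ≤ d := (norm_nonneg _).trans (hd x hx y hy)
  have hmeas : Measurable fun s : ℝ => ‖fderiv ℝ g (y + s • (x - y))‖ₑ :=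
    ((measurable_fderiv ℝ g).comp (by fun_prop)).enorm
  rw [← hFTC, intervalIntegral.integral_of_le zero_le_one, ← integral_Icc_eq_integral_Ioc]
  calc ‖∫ s in Set.Icc (0 : ℝ) 1, fderiv ℝ g (y + s • (x - y)) (x - y)‖ₑ ^ 2
      ≤ (∫⁻ s in Set.Icc (0 : ℝ) 1, ‖fderiv ℝ g (y + s • (x - y)) (x - y)‖ₑ) ^ 2 := by
        gcongr; exact enorm_integral_le_lintegral_enorm _
    _ ≤ (∫⁻ s in Set.Icc (0 : ℝ) 1, ENNReal.ofReal d * ‖fderiv ℝ g (y + s • (x - y))‖ₑ) ^ 2 := by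
        gcongr with s
        refine (ContinuousLinearMap.le_opENorm _ _).trans ?_
        rw [mul_comm]
        gcongr
        rw [← ofReal_norm]
        exact ENNReal.ofReal_le_ofReal (hd x hx y hy)
    _ = ENNReal.ofReal (d ^ 2) *
        (∫⁻ s in Set.Icc (0 : ℝ) 1, ‖fderiv ℝ g (y + s • (x - y))‖ₑ) ^ 2 := by
        rw [lintegral_const_mul _ hmeas, mul_pow, ENNReal.ofReal_pow hd0]
    _ ≤ ENNReal.ofReal (d ^ 2) *
        ∫⁻ s in Set.Icc (0 : ℝ) 1, ‖fderiv ℝ g (y + s • (x - y))‖ₑ ^ 2 := by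
        gcongr
        refine (sq_lintegral_le _ hmeas.aemeasurable).trans ?_
        simp
    _ = _ := by
        congr 1
        refine setLIntegral_congr_fun measurableSet_Icc fun s hs => ?_
        simp [Set.indicator_of_mem (hseg s hs)]

theorem lintegral_lintegral_sub_sq_le {Ω Q : Set (Fin n → ℝ)} (hΩ : IsOpen Ω)
    (hQ : Convex ℝ Q) (hQm : MeasurableSet Q) (hQΩ : Q ⊆ Ω) {d : ℝ}
    (hd : ∀ x ∈ Q, ∀ y ∈ Q, ‖x - y‖ ≤ d)
    {g : (Fin n → ℝ) → ℝ} (hg : ContDiffOn ℝ 1 g Ω) :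
    ∫⁻ x in Q, ∫⁻ y in Q, ‖g x - g y‖ₑ ^ 2 ≤
      ENNReal.ofReal (d ^ 2) * (2 ^ n * volume Q * ∫⁻ z in Q, ‖fderiv ℝ g z‖ₑ ^ 2) := by
  set G : (Fin n → ℝ) → ENNReal := Q.indicator (fun z => ‖fderiv ℝ g z‖ₑ ^ 2) with hGdef
  have hG : Measurable G := ((measurable_fderiv ℝ g).enorm.pow_const 2).indicator hQm
  have hGi : ∫⁻ z, G z = ∫⁻ z in Q, ‖fderiv ℝ g z‖ₑ ^ 2 := lintegral_indicator hQm _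
  calc ∫⁻ x in Q, ∫⁻ y in Q, ‖g x - g y‖ₑ ^ 2
      ≤ ∫⁻ x in Q, ∫⁻ y in Q, ENNReal.ofReal (d ^ 2) *
          ∫⁻ s in Set.Icc (0 : ℝ) 1, G (y + s • (x - y)) :=
        setLIntegral_mono' hQm fun x hx => setLIntegral_mono' hQm fun y hy =>
          enorm_sub_sq_le_lintegral_segment hΩ hQ hQΩ hd hg hx hy
    _ = ENNReal.ofReal (d ^ 2) * ∫⁻ x in Q, ∫⁻ y in Q,
          ∫⁻ s in Set.Icc (0 : ℝ) 1, G (y + s • (x - y)) := by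
        rw [← lintegral_const_mul' _ _ ENNReal.ofReal_ne_top]
        congr! 2 with x
        rw [lintegral_const_mul' _ _ ENNReal.ofReal_ne_top]
    _ = ENNReal.ofReal (d ^ 2) * ∫⁻ s in Set.Icc (0 : ℝ) 1, ∫⁻ x in Q, ∫⁻ y in Q,
          G (y + s • (x - y)) := by
        congr 1
        calc ∫⁻ x in Q, ∫⁻ y in Q, ∫⁻ s in Set.Icc (0 : ℝ) 1, G (y + s • (x - y))
            = ∫⁻ x in Q, ∫⁻ s in Set.Icc (0 : ℝ) 1, ∫⁻ y in Q, G (y + s • (x - y)) := by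
              congr! 2 with x
              exact lintegral_lintegral_swap (hG.comp (by fun_prop)).aemeasurable
          _ = _ := by
              refine lintegral_lintegral_swap (Measurable.aemeasurable ?_)
              refine Measurable.lintegral_prod_right'
                (f := fun p : ((Fin n → ℝ) × ℝ) × (Fin n → ℝ) => G (p.2 + p.1.2 • (p.1.1 - p.2))) ?_
              exact hG.comp (by fun_prop)
    _ ≤ ENNReal.ofReal (d ^ 2) * ∫⁻ s in Set.Icc (0 : ℝ) 1, 2 ^ n * volume Q * ∫⁻ z, G z := by
        refine mul_le_mul_right ?_ _
        exact setLIntegral_mono' measurableSet_Icc fun s _ =>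
          lintegral_convexCombination_le hG Q s
    _ = _ := by rw [← hGi]; simp

/-- Poincaré's inequality on a convex set, with some constant value of `g` instead of its mean. -/
theorem exists_lintegral_sub_sq_le {Ω Q : Set (Fin n → ℝ)} (hΩ : IsOpen Ω)
    (hQ : Convex ℝ Q) (hQm : MeasurableSet Q) (hQΩ : Q ⊆ Ω) (hQfin : volume Q ≠ ⊤) {d : ℝ}
    (hd : ∀ x ∈ Q, ∀ y ∈ Q, ‖x - y‖ ≤ d)
    {g : (Fin n → ℝ) → ℝ} (hg : ContDiffOn ℝ 1 g Ω) :
    ∃ c : ℝ, ∫⁻ x in Q, ‖g x - c‖ₑ ^ 2 ≤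
      ENNReal.ofReal (d ^ 2) * 2 ^ n * ∫⁻ z in Q, ‖fderiv ℝ g z‖ₑ ^ 2 := by
  by_cases h0 : volume Q = 0
  · exact ⟨0, by rw [Measure.restrict_eq_zero.2 h0]; simp⟩
  have hgm : AEMeasurable g (volume.restrict Q) :=
    (hg.continuousOn.mono hQΩ).aemeasurable hQm
  have hm : AEMeasurable (fun y => ∫⁻ x in Q, ‖g y - g x‖ₑ ^ 2) (volume.restrict Q) := by
    have h1 : AEMeasurable (fun p : (Fin n → ℝ) × (Fin n → ℝ) => ‖g p.1 - g p.2‖ₑ ^ 2)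
        ((volume.restrict Q).prod (volume.restrict Q)) :=
      ((hgm.comp_fst.sub hgm.comp_snd).enorm.pow_const 2)
    exact h1.lintegral_prod_right'
  -- Some `y` has its inner integral at most the average over `Q`; the value `g y` then serves as
  -- the constant.
  obtain ⟨y, -, hle⟩ := exists_le_setLAverage h0 hQfin hm
  refine ⟨g y, ?_⟩
  have hswap : ∀ x, ‖g x - g y‖ₑ = ‖g y - g x‖ₑ := fun x => by rw [← enorm_neg]; congr 1; ring
  simp_rw [hswap]
  refine hle.trans ?_
  rw [setLAverage_eq]
  refine ENNReal.div_le_of_le_mul ((lintegral_lintegral_sub_sq_le hΩ hQ hQm hQΩ hd hg).trans ?_)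
  apply le_of_eq
  ring

/-- The cells of a grid of mesh `r` in `Ω`. -/
def gridCell (Ω : Set (Fin n → ℝ)) (r : ℝ) (z : Fin n → ℤ) : Set (Fin n → ℝ) :=
  {x ∈ Ω | ∀ i, ⌊x i / r⌋ = z i}

theorem gridCell_eq {Ω : Set (Fin n → ℝ)} {r : ℝ} (hr : 0 < r) (z : Fin n → ℤ) :
    gridCell Ω r z = Ω ∩ Set.univ.pi fun i => Set.Ico (z i * r) ((z i + 1) * r) := by
  ext x
  simp only [gridCell, Set.mem_ofPred_eq, Set.mem_inter_iff, Set.mem_univ_pi, Set.mem_Ico]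
  refine and_congr_right fun _ => forall_congr' fun i => ?_
  rw [Int.floor_eq_iff, le_div_iff₀ hr, div_lt_iff₀ hr]

theorem convex_gridCell {Ω : Set (Fin n → ℝ)} (hΩ : Convex ℝ Ω) {r : ℝ} (hr : 0 < r)
    (z : Fin n → ℤ) : Convex ℝ (gridCell Ω r z) := by
  rw [gridCell_eq hr]
  exact hΩ.inter (convex_pi fun i _ => convex_Ico _ _)

theorem measurableSet_gridCell {Ω : Set (Fin n → ℝ)} (hΩ : MeasurableSet Ω) {r : ℝ} (hr : 0 < r)
    (z : Fin n → ℤ) : MeasurableSet (gridCell Ω r z) := by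
  rw [gridCell_eq hr]
  exact hΩ.inter (MeasurableSet.univ_pi fun i => measurableSet_Ico)

theorem norm_sub_le_of_mem_gridCell {Ω : Set (Fin n → ℝ)} {r : ℝ} (hr : 0 < r) {z : Fin n → ℤ}
    {x y : Fin n → ℝ} (hx : x ∈ gridCell Ω r z) (hy : y ∈ gridCell Ω r z) : ‖x - y‖ ≤ r := by
  rw [gridCell_eq hr] at hx hy
  rw [pi_norm_le_iff_of_nonneg hr.le]
  intro i
  have h1 := hx.2 i (Set.mem_univ i)
  have h2 := hy.2 i (Set.mem_univ i)
  rw [Pi.sub_apply, Real.norm_eq_abs, abs_le]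
  constructor <;> nlinarith [h1.1, h1.2, h2.1, h2.2]

theorem exists_finset_gridCell_cover {Ω : Set (Fin n → ℝ)} (hΩ : Bornology.IsBounded Ω) {r : ℝ}
    (hr : 0 < r) : ∃ t : Finset (Fin n → ℤ), Ω = ⋃ z ∈ t, gridCell Ω r z := by
  obtain ⟨R, hR⟩ := hΩ.exists_norm_le
  refine ⟨Fintype.piFinset fun _ => Finset.Icc ⌊-R / r⌋ ⌊R / r⌋, ?_⟩
  ext x
  simp only [Set.mem_iUnion, exists_prop]
  refine ⟨fun hx => ⟨fun i => ⌊x i / r⌋, ?_, hx, fun i => rfl⟩, fun ⟨z, _, hx⟩ => hx.1⟩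
  rw [Fintype.mem_piFinset]
  intro i
  have h1 := abs_le.1 ((norm_le_pi_norm x i).trans (hR x hx))
  rw [Finset.mem_Icc]
  exact ⟨Int.floor_le_floor (by gcongr; exact h1.1), Int.floor_le_floor (by gcongr; exact h1.2)⟩

theorem enorm_Lp_sq {α : Type*} [MeasurableSpace α] {μ : Measure α} (F : Lp ℝ 2 μ) :
    ‖F‖ₑ ^ 2 = ∫⁻ x, ‖F x‖ₑ ^ 2 ∂μ := by
  rw [Lp.enorm_def, eLpNorm_eq_lintegral_rpow_enorm_toReal (by norm_num) (by norm_num)]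
  rw [← ENNReal.rpow_natCast, ← ENNReal.rpow_mul]
  simp

/-- On a bounded convex domain, functions with square integrable differential are close to a
finite-dimensional space of step functions. -/
theorem exists_finiteDimensional_approx {Ω : Set (Fin n → ℝ)} (hΩ : IsOpen Ω) (hconv : Convex ℝ Ω)
    (hb : Bornology.IsBounded Ω) {μ : Measure (Fin n → ℝ)} (hμ : μ ≤ volume.restrict Ω) {ε : ℝ}
    (hε : 0 < ε) :
    ∃ U : Submodule ℝ (Lp ℝ 2 μ), FiniteDimensional ℝ U ∧
      ∀ g : (Fin n → ℝ) → ℝ, ContDiffOn ℝ 1 g Ω → ∀ F : Lp ℝ 2 μ, F =ᵐ[μ] g →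
        ∃ w ∈ U, ‖F - w‖ₑ ^ 2 ≤ ENNReal.ofReal (ε ^ 2) * ∫⁻ x in Ω, ‖fderiv ℝ g x‖ₑ ^ 2 := by
  set r : ℝ := ε / 2 ^ n with hr
  have hr0 : 0 < r := by positivity
  have hrε : ENNReal.ofReal (r ^ 2) * 2 ^ n ≤ ENNReal.ofReal (ε ^ 2) := by
    have : (2 : ENNReal) ^ n = ENNReal.ofReal (2 ^ n) := by
      rw [ENNReal.ofReal_pow (by norm_num)]; simp
    rw [this, ← ENNReal.ofReal_mul (by positivity)]
    apply ENNReal.ofReal_le_ofReal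
    rw [hr, div_pow, div_mul_eq_mul_div, div_le_iff₀ (by positivity)]
    have h1 : (1 : ℝ) ≤ 2 ^ n := one_le_pow₀ (by norm_num)
    have h2 : (2 : ℝ) ^ n ≤ (2 ^ n) ^ 2 := by nlinarith
    gcongr
  obtain ⟨t, ht⟩ := exists_finset_gridCell_cover hb hr0
  have hΩfin : volume Ω < ⊤ := hb.measure_lt_top
  have hQm : ∀ z, MeasurableSet (gridCell Ω r z) :=
    fun z => measurableSet_gridCell hΩ.measurableSet hr0 z
  have hQΩ : ∀ z, gridCell Ω r z ⊆ Ω := fun z x hx => hx.1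
  have hQfin : ∀ z, μ (gridCell Ω r z) ≠ ⊤ := fun z => by
    refine ne_top_of_le_ne_top hΩfin.ne ((hμ _).trans ?_)
    exact (Measure.restrict_le_self _).trans (measure_mono (hQΩ z))
  let e : (Fin n → ℤ) → Lp ℝ 2 μ := fun z => indicatorConstLp 2 (hQm z) (hQfin z) 1
  refine ⟨Submodule.span ℝ (e '' t), FiniteDimensional.span_of_finite ℝ (t.finite_toSet.image e),
    fun g hg F hF => ?_⟩
  choose c hc using fun z => exists_lintegral_sub_sq_le hΩ (convex_gridCell hconv hr0 z) (hQm z)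
    (hQΩ z) (ne_top_of_le_ne_top hΩfin.ne (measure_mono (hQΩ z)))
    (fun x hx y hy => norm_sub_le_of_mem_gridCell hr0 hx hy) hg
  refine ⟨∑ z ∈ t, c z • e z, Submodule.sum_mem _ fun z hz =>
    Submodule.smul_mem _ _ (Submodule.subset_span ⟨z, hz, rfl⟩), ?_⟩
  have hdisj : ∀ z z' x, x ∈ gridCell Ω r z → x ∈ gridCell Ω r z' → z = z' :=
    fun z z' x h h' => funext fun i => (h.2 i).symm.trans (h'.2 i)
  have hval : ∀ᵐ x ∂μ, ∀ z ∈ t, x ∈ gridCell Ω r z → (F - ∑ z ∈ t, c z • e z) x = g x - c z := by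
    have h1 : ∀ᵐ x ∂μ, ∀ z ∈ t, e z x = (gridCell Ω r z).indicator (fun _ => (1 : ℝ)) x :=
      (Finset.eventually_all t).2 fun z _ => indicatorConstLp_coeFn
    have h2 : ∀ᵐ x ∂μ, ∀ z ∈ t, (c z • e z : Lp ℝ 2 μ) x = c z * e z x :=
      (Finset.eventually_all t).2 fun z _ => Lp.coeFn_smul _ _
    filter_upwards [h1, h2, hF, Lp.coeFn_sub F (∑ z ∈ t, c z • e z),
      Lp.coeFn_finsetSum t fun z => c z • e z] with x h1 h2 h3 h4 h5 z hz hx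
    rw [h4, Pi.sub_apply, h3, h5, Finset.sum_apply, Finset.sum_eq_single z]
    · rw [h2 z hz, h1 z hz, Set.indicator_of_mem hx, mul_one]
    · intro z' hz' hne
      rw [h2 z' hz', h1 z' hz', Set.indicator_of_notMem, mul_zero]
      exact fun h => hne (hdisj _ _ x h hx)
    · exact fun h => absurd hz h
  have hpart : ∀ f : (Fin n → ℝ) → ENNReal, ∫⁻ x in Ω, f x = ∑ z ∈ t, ∫⁻ x in gridCell Ω r z, f x := by
    intro f
    conv_lhs => rw [ht]
    refine lintegral_biUnion_finset ?_ (fun z _ => hQm z) _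
    intro z _ z' _ hne
    exact Set.disjoint_left.2 fun x h h' => hne (hdisj _ _ x h h')
  have hμΩ : ∀ᵐ x ∂μ, x ∈ Ω := (Measure.absolutelyContinuous_of_le hμ)
    (ae_restrict_mem hΩ.measurableSet)
  classical
  -- The squared error, written without reference to `F`, so that its integral against `μ` can be
  -- compared with the Lebesgue integral and then split over the cells.
  let W : (Fin n → ℝ) → ENNReal := fun x => ∑ z ∈ t, (gridCell Ω r z).indicator
    (fun x => ‖g x - c z‖ₑ ^ 2) x
  have hW : ∀ z ∈ t, ∀ x ∈ gridCell Ω r z, W x = ‖g x - c z‖ₑ ^ 2 := by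
    intro z hz x hx
    simp only [W]
    rw [Finset.sum_eq_single z]
    · rw [Set.indicator_of_mem hx]
    · intro z' _ hne
      rw [Set.indicator_of_notMem]
      exact fun h => hne (hdisj _ _ x h hx)
    · exact fun h => absurd hz h
  calc ‖F - ∑ z ∈ t, c z • e z‖ₑ ^ 2 = ∫⁻ x, ‖(F - ∑ z ∈ t, c z • e z) x‖ₑ ^ 2 ∂μ := enorm_Lp_sq _
    _ = ∫⁻ x, W x ∂μ := by
        refine lintegral_congr_ae ?_
        filter_upwards [hval, hμΩ] with x h1 h2
        rw [ht] at h2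
        obtain ⟨z, hz, hx⟩ := Set.mem_iUnion₂.1 h2
        rw [h1 z hz hx, hW z hz x hx]
    _ ≤ ∫⁻ x in Ω, W x := lintegral_mono' hμ le_rfl
    _ = ∑ z ∈ t, ∫⁻ x in gridCell Ω r z, ‖g x - c z‖ₑ ^ 2 := by
        rw [hpart]
        exact Finset.sum_congr rfl fun z hz => setLIntegral_congr_fun (hQm z) fun x hx => hW z hz x hx
    _ ≤ ∑ z ∈ t, ENNReal.ofReal (ε ^ 2) * ∫⁻ x in gridCell Ω r z, ‖fderiv ℝ g x‖ₑ ^ 2 := by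
        refine Finset.sum_le_sum fun z _ => (hc z).trans ?_
        gcongr
    _ = _ := by rw [← Finset.mul_sum, ← hpart]

end Poincare

/-! ### Curvature of the hyperbolic metric -/

section Curvature

variable {n : ℕ} [NeZero n]

theorem hyperbolicMetric_inv {x : Fin n → ℝ} (hx : x 0 ≠ 0) :
    (hyperbolicMetric n x)⁻¹ = (x 0) ^ 2 • (1 : Matrix (Fin n) (Fin n) ℝ) := by
  apply Matrix.inv_eq_right_inv
  rw [hyperbolicMetric, Matrix.smul_mul, Matrix.one_mul, smul_smul, inv_mul_cancel₀ (by positivity),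
    one_smul]

theorem pd_congr {n : ℕ} {i : Fin n} {f g : (Fin n → ℝ) → ℝ} {x : Fin n → ℝ} (h : f =ᶠ[𝓝 x] g) :
    pd i f x = pd i g x := by
  rw [pd, pd, h.fderiv_eq]

theorem pd_comp_zero {i : Fin n} {f : ℝ → ℝ} {f' : ℝ} {x : Fin n → ℝ}
    (h : HasDerivAt f f' (x 0)) : pd i (fun y => f (y 0)) x = if i = 0 then f' else 0 := by
  have h1 : HasFDerivAt (fun y : Fin n → ℝ => y 0)
    (ContinuousLinearMap.proj (R := ℝ) (φ := fun _ : Fin n => ℝ) 0) x := hasFDerivAt_apply 0 x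
  have h2 := h.comp_hasFDerivAt x h1
  rw [pd, show (fun y : Fin n → ℝ => f (y 0)) = f ∘ (fun y => y 0) from rfl, h2.fderiv]
  by_cases hi : i = 0 <;> simp [hi, eq_comm]

theorem pd_hyperbolicMetric {x : Fin n → ℝ} (hx : x 0 ≠ 0) (i j l : Fin n) :
    pd i (fun y => hyperbolicMetric n y j l) x =
      if i = 0 then (if j = l then -2 * (x 0)⁻¹ ^ 3 else 0) else 0 := by
  have e : (fun y : Fin n → ℝ => hyperbolicMetric n y j l) =
      fun y => (fun t : ℝ => (t ^ 2)⁻¹ * (if j = l then 1 else 0)) (y 0) := by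
    ext y
    simp [hyperbolicMetric, Matrix.one_apply]
  have h : HasDerivAt (fun t : ℝ => (t ^ 2)⁻¹ * (if j = l then 1 else 0))
      (-(2 * x 0) / (x 0 ^ 2) ^ 2 * (if j = l then 1 else 0)) (x 0) := by
    have h0 : HasDerivAt (fun t : ℝ => t ^ 2) (2 * x 0) (x 0) := by
      simpa using hasDerivAt_pow 2 (x 0)
    exact (h0.fun_inv (by positivity)).mul_const _
  rw [e, pd_comp_zero h]
  split_ifs <;> simp
  field_simp

theorem christoffel_hyperbolicMetric {x : Fin n → ℝ} (hx : x 0 ≠ 0) (k i j : Fin n) :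
    christoffel (hyperbolicMetric n) k i j x =
      -(x 0)⁻¹ * ((if j = 0 then if k = i then 1 else 0 else 0) +
        (if i = 0 then if k = j then 1 else 0 else 0) -
        (if k = 0 then if i = j then 1 else 0 else 0)) := by
  rw [christoffel, hyperbolicMetric_inv hx]
  simp only [pd_hyperbolicMetric hx, Matrix.smul_apply, Matrix.one_apply, smul_eq_mul, mul_ite,
    mul_one, mul_zero, ite_mul, zero_mul, Finset.sum_ite_eq, Finset.mem_univ, if_true]
  simp only [eq_comm (a := j) (b := k), eq_comm (a := i) (b := k)]
  split_ifs <;> field_simp <;> ring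

theorem pd_christoffel_hyperbolicMetric {x : Fin n → ℝ} (hx : x 0 ≠ 0) (l k i j : Fin n) :
    pd l (christoffel (hyperbolicMetric n) k i j) x =
      if l = 0 then (x 0 ^ 2)⁻¹ * ((if j = 0 then if k = i then 1 else 0 else 0) +
        (if i = 0 then if k = j then 1 else 0 else 0) -
        (if k = 0 then if i = j then 1 else 0 else 0)) else 0 := by
  have hev : christoffel (hyperbolicMetric n) k i j =ᶠ[𝓝 x] fun y => (fun t : ℝ => -t⁻¹ *
      ((if j = 0 then if k = i then 1 else 0 else 0) +
        (if i = 0 then if k = j then 1 else 0 else 0) -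
        (if k = 0 then if i = j then 1 else 0 else 0))) (y 0) := by
    have : ∀ᶠ y : Fin n → ℝ in 𝓝 x, y 0 ≠ 0 :=
      (continuous_apply (0 : Fin n)).continuousAt.eventually_ne hx
    filter_upwards [this] with y hy
    exact christoffel_hyperbolicMetric hy k i j
  rw [pd_congr hev, pd_comp_zero (((hasDerivAt_inv hx).fun_neg).mul_const _)]
  simp

/-- The hyperbolic metric has constant Ricci curvature `-(n - 1)`. -/
theorem ricci_hyperbolicMetric {x : Fin n → ℝ} (hx : x 0 ≠ 0) :
    ricci (hyperbolicMetric n) x = (-((n : ℝ) - 1) * (x 0 ^ 2)⁻¹) • (1 : Matrix (Fin n) (Fin n) ℝ) := by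
  ext i j
  simp only [ricci, Matrix.of_apply, pd_christoffel_hyperbolicMetric hx,
    christoffel_hyperbolicMetric hx, Matrix.smul_apply, Matrix.one_apply, smul_eq_mul]
  -- With `e = δ_{i0}`, `d = δ_{ij}` and `c` the bracket below, `Γ^k_ij = -c/x₀` and `∂_l Γ^k_ij =
  -- e_l c/x₀²`. The Ricci tensor is `x₀⁻²` times the contractions `S1`, `S2`, `S4` and `S5`.
  set e : Fin n → ℝ := fun i => if i = 0 then 1 else 0 with he
  set d : Fin n → Fin n → ℝ := fun i j => if i = j then 1 else 0 with hd
  have h1 : ∀ (i : Fin n) (a : ℝ), (if i = 0 then a else 0) = e i * a := fun i a => by simp [he]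
  have h2 : ∀ (i j : Fin n), (if i = j then (1 : ℝ) else 0) = d i j := fun i j => rfl
  simp only [h1, h2]
  set c : Fin n → Fin n → Fin n → ℝ := fun k i j => e j * d k i + e i * d k j - e k * d i j with hc
  have hkk : ∀ k, d k k = 1 := fun k => by simp [hd]
  have S1 : ∑ k, e k * c k i j = 2 * e i * e j - d i j := by
    simp [hc, he, hd, mul_add, mul_sub, Finset.sum_add_distrib, Finset.sum_sub_distrib]
    grind
  have S2 : ∑ k, c k i k = n * e i := by
    simp [hc, he, hd, Finset.sum_add_distrib, Finset.sum_sub_distrib]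
  have S3 : ∀ l, ∑ k, c k k l = n * e l := fun l => by
    simp [hc, he, hd]
  have S4 : ∑ k, ∑ l, c k j l * c l i k = (n + 2) * e i * e j - 2 * d i j := by
    simp [hc, he, hd, mul_add, mul_sub, Finset.sum_add_distrib,
      Finset.sum_sub_distrib]
    grind
  have S5 : ∑ k, ∑ l, c k k l * c l i j = n * (2 * e i * e j - d i j) := by
    rw [Finset.sum_comm]
    simp_rw [← Finset.sum_mul, S3, mul_assoc, ← Finset.mul_sum, S1]
    ring
  calc _ = (x 0 ^ 2)⁻¹ * (∑ k, e k * c k i j - e j * ∑ k, c k i k +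
        ∑ k, ∑ l, c k k l * c l i j - ∑ k, ∑ l, c k j l * c l i k) := by
        rw [Finset.mul_sum, ← Finset.sum_sub_distrib, add_sub_assoc, ← Finset.sum_sub_distrib,
          mul_add, Finset.mul_sum, Finset.mul_sum]
        congr 1
        · refine Finset.sum_congr rfl fun k _ => ?_
          simp only [hc, hkk, if_true]
          ring
        · refine Finset.sum_congr rfl fun k _ => ?_
          rw [← Finset.sum_sub_distrib, Finset.mul_sum]
          refine Finset.sum_congr rfl fun l _ => ?_
          simp only [hc, hkk, if_true]
          field_simp
    _ = _ := by
        rw [S1, S2, S4, S5]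
        ring

theorem covInner_hyperbolicMetric {x : Fin n → ℝ} (hx : x 0 ≠ 0) (p q : Fin n → ℝ) :
    covInner (hyperbolicMetric n x) p q = ∑ i, (x 0 * p i) * (x 0 * q i) := by
  rw [covInner, hyperbolicMetric_inv hx, Matrix.smul_mulVec, Matrix.one_mulVec]
  simp only [dotProduct, Pi.smul_apply, smul_eq_mul]
  exact Finset.sum_congr rfl fun i _ => by ring

theorem tensorInner_hyperbolicMetric {x : Fin n → ℝ} (hx : x 0 ≠ 0)
    (h k : Matrix (Fin n) (Fin n) ℝ) :
    tensorInner (hyperbolicMetric n x) h k =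
      ∑ ij : Fin n × Fin n, (x 0 ^ 2 * h ij.1 ij.2) * (x 0 ^ 2 * k ij.1 ij.2) := by
  rw [tensorInner, hyperbolicMetric_inv hx, Fintype.sum_prod_type]
  refine Finset.sum_congr rfl fun i _ => Finset.sum_congr rfl fun j _ => ?_
  simp only [Matrix.smul_apply, Matrix.one_apply, smul_eq_mul, mul_ite, mul_one, mul_zero, ite_mul,
    zero_mul, Finset.sum_ite_eq, Finset.mem_univ, if_true]
  ring

theorem evalSharp_ricci_hyperbolicMetric {x : Fin n → ℝ} (hx : x 0 ≠ 0) (p q : Fin n → ℝ) :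
    evalSharp (hyperbolicMetric n x) (ricci (hyperbolicMetric n) x) p q =
      -((n : ℝ) - 1) * ∑ i, (x 0 * p i) * (x 0 * q i) := by
  rw [evalSharp, hyperbolicMetric_inv hx, ricci_hyperbolicMetric hx]
  simp only [Matrix.smul_mulVec, Matrix.one_mulVec, dotProduct, Pi.smul_apply, smul_eq_mul]
  rw [Finset.mul_sum]
  refine Finset.sum_congr rfl fun i _ => ?_
  field_simp

theorem hessian_hyperbolicMetric {x : Fin n → ℝ} (hx : x 0 ≠ 0) (f : (Fin n → ℝ) → ℝ)
    (i j : Fin n) :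
    hessian (hyperbolicMetric n) f x i j = pd i (pd j f) x + (x 0)⁻¹ *
      ((if j = 0 then pd i f x else 0) + (if i = 0 then pd j f x else 0) -
        (if i = j then pd 0 f x else 0)) := by
  simp only [hessian, Matrix.of_apply, christoffel_hyperbolicMetric hx]
  have : ∑ k, -(x 0)⁻¹ * ((if j = 0 then if k = i then 1 else 0 else 0) +
        (if i = 0 then if k = j then 1 else 0 else 0) -
        (if k = 0 then if i = j then 1 else 0 else 0)) * pd k f x = -(x 0)⁻¹ *
      ((if j = 0 then pd i f x else 0) + (if i = 0 then pd j f x else 0) -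
        (if i = j then pd 0 f x else 0)) := by
    simp_rw [mul_assoc, ← Finset.mul_sum, sub_mul, add_mul, Finset.sum_sub_distrib,
      Finset.sum_add_distrib]
    congr 3
    · split_ifs <;> simp
    · split_ifs <;> simp
    · split_ifs <;> simp
  rw [this]
  ring

theorem sqrt_det_hyperbolicMetric {x : Fin n → ℝ} (hx : 0 < x 0) :
    Real.sqrt (hyperbolicMetric n x).det = ((x 0) ^ n)⁻¹ := by
  rw [hyperbolicMetric, Matrix.det_smul, Matrix.det_one, mul_one, Fintype.card_fin, inv_pow,
    ← pow_mul, mul_comm 2 n, pow_mul, Real.sqrt_inv, Real.sqrt_sq (by positivity)]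

end Curvature

/-! ### The Sobolev space as a Hilbert space of jets -/

section Jets

variable {n : ℕ} [NeZero n]

/-- A bounded convex domain of the half-space model contained in a horizontal strip. -/
structure IsStripDomain (Ω : Set (Fin n → ℝ)) (K : ℝ) : Prop where
  isOpen : IsOpen Ω
  convex : Convex ℝ Ω
  isBounded : Bornology.IsBounded Ω
  nonempty : Ω.Nonempty
  one_lt : ∀ x ∈ Ω, 1 < x 0
  lt : ∀ x ∈ Ω, x 0 < K

/-- The hyperbolic volume on `Ω`. -/
abbrev hypMeasure (Ω : Set (Fin n → ℝ)) : Measure (Fin n → ℝ) :=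
  (riemVolume (hyperbolicMetric n)).restrict Ω

theorem hypMeasure_eq_withDensity {Ω : Set (Fin n → ℝ)} (hΩ : MeasurableSet Ω)
    (hpos : ∀ x ∈ Ω, 0 < x 0) :
    hypMeasure Ω = (volume.restrict Ω).withDensity fun x => ENNReal.ofReal ((x 0 ^ n)⁻¹) := by
  rw [hypMeasure, riemVolume, restrict_withDensity hΩ]
  refine withDensity_congr_ae ?_
  filter_upwards [ae_restrict_mem hΩ] with x hx
  rw [sqrt_det_hyperbolicMetric (hpos x hx)]

theorem integral_hypMeasure {Ω : Set (Fin n → ℝ)} (hΩ : MeasurableSet Ω)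
    (hpos : ∀ x ∈ Ω, 0 < x 0) (f : (Fin n → ℝ) → ℝ) :
    ∫ x, f x ∂(hypMeasure Ω) = ∫ x in Ω, (x 0 ^ n)⁻¹ * f x := by
  rw [hypMeasure_eq_withDensity hΩ hpos, integral_withDensity_eq_integral_toReal_smul
    (by fun_prop) (by simp)]
  refine setIntegral_congr_fun hΩ fun x hx => ?_
  have := hpos x hx
  simp only [smul_eq_mul]
  rw [ENNReal.toReal_ofReal (by positivity)]

namespace IsStripDomain

variable {Ω : Set (Fin n → ℝ)} {K : ℝ}

theorem pos (h : IsStripDomain Ω K) : ∀ x ∈ Ω, 0 < x 0 := fun x hx => by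
  linarith [h.one_lt x hx]

/-- On the strip `1 < x₀ < K` the volume density `x₀⁻ⁿ` lies between `K⁻ⁿ` and `1`. This bound and
`lintegral_le` make hyperbolic and Lebesgue integrals comparable, which brings in the Euclidean
Poincaré inequality. -/
theorem hypMeasure_le (h : IsStripDomain Ω K) : hypMeasure Ω ≤ volume.restrict Ω := by
  rw [hypMeasure_eq_withDensity h.isOpen.measurableSet h.pos]
  calc _ ≤ (volume.restrict Ω).withDensity 1 := by
        refine withDensity_mono ?_
        filter_upwards [ae_restrict_mem h.isOpen.measurableSet] with x hx
        rw [Pi.one_apply, ENNReal.ofReal_le_one]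
        exact inv_le_one_of_one_le₀ (one_le_pow₀ (h.one_lt x hx).le)
    _ = _ := withDensity_one

theorem lintegral_le (h : IsStripDomain Ω K) (f : (Fin n → ℝ) → ENNReal) :
    ∫⁻ x in Ω, f x ≤ ENNReal.ofReal (K ^ n) * ∫⁻ x, f x ∂(hypMeasure Ω) := by
  rw [hypMeasure_eq_withDensity h.isOpen.measurableSet h.pos,
    lintegral_withDensity_eq_lintegral_mul_non_measurable _ (by fun_prop) (by simp),
    ← lintegral_const_mul' _ _ ENNReal.ofReal_ne_top]
  refine setLIntegral_mono' h.isOpen.measurableSet fun x hx => ?_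
  have h0 := h.pos x hx
  rw [Pi.mul_apply, ← mul_assoc, ← ENNReal.ofReal_mul (by have := h0.trans (h.lt x hx); positivity)]
  refine le_mul_of_one_le_left (by positivity) ?_
  rw [ENNReal.one_le_ofReal, ← div_eq_mul_inv, one_le_div (by positivity)]
  have := h.lt x hx
  gcongr

theorem ae_mem (h : IsStripDomain Ω K) : ∀ᵐ x ∂(hypMeasure Ω), x ∈ Ω :=
  ae_restrict_mem h.isOpen.measurableSet

theorem isFiniteMeasure (h : IsStripDomain Ω K) : IsFiniteMeasure (hypMeasure Ω) :=
  ⟨(h.hypMeasure_le _).trans_lt (by simpa using h.isBounded.measure_lt_top)⟩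

end IsStripDomain

/-- Indices of the components of a second order jet. -/
abbrev JetIndex (n : ℕ) : Type := Unit ⊕ Fin n ⊕ Fin n × Fin n

/-- The components of the jet `(u, p, h)` in the orthonormal frame `x₀ ∂_i`. -/
def jetComp (u : (Fin n → ℝ) → ℝ) (p : (Fin n → ℝ) → Fin n → ℝ)
    (h : (Fin n → ℝ) → Matrix (Fin n) (Fin n) ℝ) : JetIndex n → (Fin n → ℝ) → ℝ
  | .inl _ => u
  | .inr (.inl i) => fun x => x 0 * p x i
  | .inr (.inr ij) => fun x => x 0 ^ 2 * h x ij.1 ij.2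

/-- The components of the jet of a function. -/
def jetOf (f : (Fin n → ℝ) → ℝ) : JetIndex n → (Fin n → ℝ) → ℝ :=
  jetComp f (differential f) (hessian (hyperbolicMetric n) f)

theorem jetComp_sub (u u' : (Fin n → ℝ) → ℝ) (p p' : (Fin n → ℝ) → Fin n → ℝ)
    (h h' : (Fin n → ℝ) → Matrix (Fin n) (Fin n) ℝ) (a : JetIndex n) (x : Fin n → ℝ) :
    jetComp (fun x => u x - u' x) (fun x => p x - p' x) (fun x => h x - h' x) a x =
      jetComp u p h a x - jetComp u' p' h' a x := by
  rcases a with _ | i | ij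
  · rfl
  · simp [jetComp, mul_sub]
  · simp [jetComp, mul_sub]

/-- Square integrable jets on `Ω`. -/
abbrev JetSpace (Ω : Set (Fin n → ℝ)) : Type :=
  PiLp 2 fun _ : JetIndex n => Lp ℝ 2 (hypMeasure Ω)

theorem contDiffOn_pd {n : ℕ} {f : (Fin n → ℝ) → ℝ} {U : Set (Fin n → ℝ)} (hU : IsOpen U)
    (hf : ContDiffOn ℝ ∞ f U) (i : Fin n) : ContDiffOn ℝ ∞ (pd i f) U :=
  (hf.fderiv_of_isOpen hU (by simp)).clm_apply contDiffOn_const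

theorem differentiableAt_of_contDiffOn {n : ℕ} {f : (Fin n → ℝ) → ℝ} {U : Set (Fin n → ℝ)} (hU : IsOpen U)
    (hf : ContDiffOn ℝ ∞ f U) {x : Fin n → ℝ} (hx : x ∈ U) : DifferentiableAt ℝ f x :=
  (hf.contDiffAt (hU.mem_nhds hx)).differentiableAt (by simp)

theorem continuousOn_jetOf {f : (Fin n → ℝ) → ℝ} {U : Set (Fin n → ℝ)} (hU : IsOpen U)
    (hpos : ∀ x ∈ U, 0 < x 0) (hf : ContDiffOn ℝ ∞ f U) (a : JetIndex n) :
    ContinuousOn (jetOf f a) U := by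
  have h0 : ContinuousOn (fun x : Fin n → ℝ => x 0) U := (continuous_apply 0).continuousOn
  have h1 : ∀ i, ContinuousOn (pd i f) U := fun i => (contDiffOn_pd hU hf i).continuousOn
  have h2 : ∀ i j, ContinuousOn (pd i (pd j f)) U := fun i j =>
    (contDiffOn_pd hU (contDiffOn_pd hU hf j) i).continuousOn
  rcases a with _ | i | ⟨i, j⟩
  · exact hf.continuousOn
  · exact h0.mul (h1 i)
  · refine (h0.pow 2).mul ?_
    have h3 : ContinuousOn (fun x => pd i (pd j f) x + (x 0)⁻¹ *
      ((if j = 0 then pd i f x else 0) + (if i = 0 then pd j f x else 0) -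
        (if i = j then pd 0 f x else 0))) U := by
      refine (h2 i j).add ((h0.inv₀ fun x hx => (hpos x hx).ne').mul ?_)
      refine (ContinuousOn.add ?_ ?_).sub ?_ <;> split_ifs <;>
        first | exact h1 _ | exact continuousOn_const
    exact h3.congr fun x hx => hessian_hyperbolicMetric (hpos x hx).ne' f i j

theorem pd_add {n : ℕ} {f g : (Fin n → ℝ) → ℝ} {x : Fin n → ℝ} (hf : DifferentiableAt ℝ f x)
    (hg : DifferentiableAt ℝ g x) (i : Fin n) :
    pd i (fun y => f y + g y) x = pd i f x + pd i g x := by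
  rw [pd, fderiv_fun_add hf hg]; rfl

theorem pd_const_mul {n : ℕ} {f : (Fin n → ℝ) → ℝ} {x : Fin n → ℝ} (hf : DifferentiableAt ℝ f x) (c : ℝ)
    (i : Fin n) : pd i (fun y => c * f y) x = c * pd i f x := by
  rw [pd, fderiv_const_mul hf]; rfl

theorem jetOf_add {f g : (Fin n → ℝ) → ℝ} {U : Set (Fin n → ℝ)} (hU : IsOpen U)
    (hpos : ∀ x ∈ U, 0 < x 0) (hf : ContDiffOn ℝ ∞ f U) (hg : ContDiffOn ℝ ∞ g U)
    {x : Fin n → ℝ} (hx : x ∈ U) (a : JetIndex n) :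
    jetOf (fun y => f y + g y) a x = jetOf f a x + jetOf g a x := by
  have h1 : ∀ i, ∀ y ∈ U, pd i (fun y => f y + g y) y = pd i f y + pd i g y := fun i y hy =>
    pd_add (differentiableAt_of_contDiffOn hU hf hy) (differentiableAt_of_contDiffOn hU hg hy) i
  have h2 : ∀ i j, pd i (pd j fun y => f y + g y) x = pd i (pd j f) x + pd i (pd j g) x := by
    intro i j
    rw [pd_congr (g := fun y => pd j f y + pd j g y), pd_add]
    · exact differentiableAt_of_contDiffOn hU (contDiffOn_pd hU hf j) hx
    · exact differentiableAt_of_contDiffOn hU (contDiffOn_pd hU hg j) hx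
    · filter_upwards [hU.mem_nhds hx] with y hy using h1 j y hy
  rcases a with _ | i | ⟨i, j⟩
  · rfl
  · simp only [jetOf, jetComp, differential, h1 i x hx, mul_add]
  · simp only [jetOf, jetComp, hessian_hyperbolicMetric (hpos x hx).ne', h1 _ x hx, h2]
    split_ifs <;> ring

theorem jetOf_const_mul {f : (Fin n → ℝ) → ℝ} {U : Set (Fin n → ℝ)} (hU : IsOpen U)
    (hpos : ∀ x ∈ U, 0 < x 0) (hf : ContDiffOn ℝ ∞ f U) (c : ℝ)
    {x : Fin n → ℝ} (hx : x ∈ U) (a : JetIndex n) :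
    jetOf (fun y => c * f y) a x = c * jetOf f a x := by
  have h1 : ∀ i, ∀ y ∈ U, pd i (fun y => c * f y) y = c * pd i f y := fun i y hy =>
    pd_const_mul (differentiableAt_of_contDiffOn hU hf hy) c i
  have h2 : ∀ i j, pd i (pd j fun y => c * f y) x = c * pd i (pd j f) x := by
    intro i j
    rw [pd_congr (g := fun y => c * pd j f y), pd_const_mul]
    · exact differentiableAt_of_contDiffOn hU (contDiffOn_pd hU hf j) hx
    · filter_upwards [hU.mem_nhds hx] with y hy using h1 j y hy
  rcases a with _ | i | ⟨i, j⟩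
  · rfl
  · simp only [jetOf, jetComp, differential, h1 i x hx]
    ring
  · simp only [jetOf, jetComp, hessian_hyperbolicMetric (hpos x hx).ne', h1 _ x hx, h2]
    split_ifs <;> ring

/-- The jets of smooth functions of finite energy. -/
def smoothJets {Ω : Set (Fin n → ℝ)} {K : ℝ} (hΩ : IsStripDomain Ω K) :
    Submodule ℝ (JetSpace Ω) where
  carrier := {F | ∃ f, ContDiffOn ℝ ∞ f Ω ∧ ∀ a, F a =ᵐ[hypMeasure Ω] jetOf f a}
  zero_mem' := by
    -- Writing zero as a product reduces its jet to `jetOf_const_mul`.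
    refine ⟨fun _ => 0 * 0, contDiffOn_const, fun a => ?_⟩
    filter_upwards [Lp.coeFn_zero ℝ 2 (hypMeasure Ω), hΩ.ae_mem] with x h1 h2
    rw [jetOf_const_mul hΩ.isOpen hΩ.pos contDiffOn_const 0 h2, PiLp.zero_apply, h1]
    simp
  add_mem' := by
    rintro F G ⟨f, hf, hF⟩ ⟨g, hg, hG⟩
    refine ⟨fun x => f x + g x, hf.add hg, fun a => ?_⟩
    filter_upwards [Lp.coeFn_add (F a) (G a), hΩ.ae_mem, hF a, hG a] with x h1 h2 h3 h4
    rw [jetOf_add hΩ.isOpen hΩ.pos hf hg h2, PiLp.add_apply, h1, Pi.add_apply, h3, h4]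
  smul_mem' := by
    rintro c F ⟨f, hf, hF⟩
    refine ⟨fun x => c * f x, contDiffOn_const.mul hf, fun a => ?_⟩
    filter_upwards [Lp.coeFn_smul c (F a), hΩ.ae_mem, hF a] with x h1 h2 h3
    rw [jetOf_const_mul hΩ.isOpen hΩ.pos hf c h2, PiLp.smul_apply, h1, Pi.smul_apply, h3,
      smul_eq_mul]

/-- The Sobolev space `H²(Ω)`, as a space of jets. -/
def sobolevH2 {Ω : Set (Fin n → ℝ)} {K : ℝ} (hΩ : IsStripDomain Ω K) :
    Submodule ℝ (JetSpace Ω) :=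
  (smoothJets hΩ).topologicalClosure

theorem isClosed_sobolevH2 {Ω : Set (Fin n → ℝ)} {K : ℝ} (hΩ : IsStripDomain Ω K) :
    IsClosed (sobolevH2 hΩ : Set (JetSpace Ω)) :=
  Submodule.isClosed_topologicalClosure _

theorem dense_smoothJets {Ω : Set (Fin n → ℝ)} {K : ℝ} (hΩ : IsStripDomain Ω K) :
    Dense {v : sobolevH2 hΩ | (v : JetSpace Ω) ∈ smoothJets hΩ} := by
  rw [Topology.IsInducing.subtypeVal.dense_iff]
  rintro ⟨v, hv⟩
  have h1 : v ∈ closure (smoothJets hΩ : Set (JetSpace Ω)) := hv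
  refine closure_mono ?_ h1
  intro w hw
  exact ⟨⟨w, Submodule.le_topologicalClosure _ hw⟩, hw, rfl⟩

/-! #### Jets and the energy -/

variable {Ω : Set (Fin n → ℝ)} {K : ℝ}

/-- The factors `x₀` and `x₀²` in `jetComp` absorb the inverse metric, so that the pointwise inner
products become plain sums of products and the `H²` norm is that of a product of `L²` spaces. -/
theorem sum_jetComp_mul {x : Fin n → ℝ} (hx : x 0 ≠ 0) (u u' : (Fin n → ℝ) → ℝ)
    (p p' : (Fin n → ℝ) → Fin n → ℝ) (h h' : (Fin n → ℝ) → Matrix (Fin n) (Fin n) ℝ) :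
    tensorInner (hyperbolicMetric n x) (h x) (h' x) + covInner (hyperbolicMetric n x) (p x) (p' x) +
      u x * u' x = ∑ a, jetComp u p h a x * jetComp u' p' h' a x := by
  rw [tensorInner_hyperbolicMetric hx, covInner_hyperbolicMetric hx, Fintype.sum_sum_type,
    Fintype.sum_sum_type]
  simp only [jetComp, Finset.univ_unique, Finset.sum_singleton]
  ring

theorem h2Energy_eq_lintegral (hΩ : IsStripDomain Ω K) (u : (Fin n → ℝ) → ℝ)
    (p : (Fin n → ℝ) → Fin n → ℝ) (h : (Fin n → ℝ) → Matrix (Fin n) (Fin n) ℝ) :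
    h2Energy (hyperbolicMetric n) Ω u p h =
      ∫⁻ x, ∑ a, ‖jetComp u p h a x‖ₑ ^ 2 ∂(hypMeasure Ω) := by
  rw [h2Energy]
  refine lintegral_congr_ae ?_
  filter_upwards [hΩ.ae_mem] with x hx
  rw [sq (u x), sum_jetComp_mul (hΩ.pos x hx).ne',
    ENNReal.ofReal_sum_of_nonneg fun a _ => mul_self_nonneg _]
  refine Finset.sum_congr rfl fun a _ => ?_
  rw [← sq, ← sq_abs, ENNReal.ofReal_pow (abs_nonneg _), ← Real.norm_eq_abs, ofReal_norm]

theorem h2Energy_eq_sum (hΩ : IsStripDomain Ω K) {u : (Fin n → ℝ) → ℝ}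
    {p : (Fin n → ℝ) → Fin n → ℝ} {h : (Fin n → ℝ) → Matrix (Fin n) (Fin n) ℝ}
    (hm : ∀ a, AEStronglyMeasurable (jetComp u p h a) (hypMeasure Ω)) :
    h2Energy (hyperbolicMetric n) Ω u p h =
      ∑ a, ∫⁻ x, ‖jetComp u p h a x‖ₑ ^ 2 ∂(hypMeasure Ω) := by
  rw [h2Energy_eq_lintegral hΩ, lintegral_finsetSum' _ fun a _ => (hm a).enorm.pow_const 2]

theorem h2Energy_eq_norm_sq (hΩ : IsStripDomain Ω K) {u : (Fin n → ℝ) → ℝ}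
    {p : (Fin n → ℝ) → Fin n → ℝ} {h : (Fin n → ℝ) → Matrix (Fin n) (Fin n) ℝ}
    {F : JetSpace Ω} (hF : ∀ a, F a =ᵐ[hypMeasure Ω] jetComp u p h a) :
    h2Energy (hyperbolicMetric n) Ω u p h = ENNReal.ofReal (‖F‖ ^ 2) := by
  rw [h2Energy_eq_sum hΩ fun a => (Lp.aestronglyMeasurable (F a)).congr (hF a),
    PiLp.norm_sq_eq_of_L2, ENNReal.ofReal_sum_of_nonneg fun a _ => by positivity]
  refine Finset.sum_congr rfl fun a _ => ?_
  rw [ENNReal.ofReal_pow (norm_nonneg _), ofReal_norm, enorm_Lp_sq]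
  refine lintegral_congr_ae ?_
  filter_upwards [hF a] with x hx
  rw [hx]

theorem exists_jet_of_h2Energy_lt_top (hΩ : IsStripDomain Ω K) {u : (Fin n → ℝ) → ℝ}
    {p : (Fin n → ℝ) → Fin n → ℝ} {h : (Fin n → ℝ) → Matrix (Fin n) (Fin n) ℝ}
    (hm : ∀ a, AEStronglyMeasurable (jetComp u p h a) (hypMeasure Ω))
    (hfin : h2Energy (hyperbolicMetric n) Ω u p h < ⊤) :
    ∃ F : JetSpace Ω, ∀ a, F a =ᵐ[hypMeasure Ω] jetComp u p h a := by
  rw [h2Energy_eq_sum hΩ hm, ENNReal.sum_lt_top] at hfin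
  have hmem : ∀ a, MemLp (jetComp u p h a) 2 (hypMeasure Ω) := fun a => by
    refine ⟨hm a, ?_⟩
    rw [eLpNorm_lt_top_iff_lintegral_rpow_enorm_lt_top (by norm_num) (by norm_num)]
    simpa using hfin a (Finset.mem_univ a)
  exact ⟨WithLp.toLp 2 fun a => (hmem a).toLp _, fun a => (hmem a).coeFn_toLp⟩

theorem aestronglyMeasurable_jetOf (hΩ : IsStripDomain Ω K) {f : (Fin n → ℝ) → ℝ}
    (hf : ContDiffOn ℝ ∞ f Ω) (a : JetIndex n) :
    AEStronglyMeasurable (jetOf f a) (hypMeasure Ω) :=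
  (continuousOn_jetOf hΩ.isOpen hΩ.pos hf a).aestronglyMeasurable hΩ.isOpen.measurableSet

/-- With `memH2_of_mem_sobolevH2`, this identifies the completion in `MemH2` with the closed
subspace `sobolevH2` of jets. -/
theorem exists_mem_sobolevH2_of_memH2 (hΩ : IsStripDomain Ω K) {u : (Fin n → ℝ) → ℝ}
    {p : (Fin n → ℝ) → Fin n → ℝ} {h : (Fin n → ℝ) → Matrix (Fin n) (Fin n) ℝ}
    (hu : MemH2 (hyperbolicMetric n) Ω u p h) :
    ∃ F ∈ sobolevH2 hΩ, ∀ a, F a =ᵐ[hypMeasure Ω] jetComp u p h a := by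
  obtain ⟨hum, hpm, hhm, f, hf, hlim⟩ := hu
  have h0 : AEStronglyMeasurable (fun x : Fin n → ℝ => x 0) (hypMeasure Ω) :=
    (continuous_apply (0 : Fin n)).aestronglyMeasurable
  have hm : ∀ a, AEStronglyMeasurable (jetComp u p h a) (hypMeasure Ω) := by
    rintro (_ | i | ⟨i, j⟩)
    · exact hum
    · exact h0.mul ((continuous_apply i).comp_aestronglyMeasurable hpm)
    · exact (h0.pow 2).mul
        ((continuous_id.matrix_elem i j).comp_aestronglyMeasurable hhm)
  have hG : ∀ k, ∃ G ∈ smoothJets hΩ, ∀ a, G a =ᵐ[hypMeasure Ω] jetOf (f k) a := fun k => by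
    obtain ⟨G, hG⟩ := exists_jet_of_h2Energy_lt_top hΩ
      (aestronglyMeasurable_jetOf hΩ (hf k).1) (hf k).2
    exact ⟨G, ⟨f k, (hf k).1, hG⟩, hG⟩
  choose G hGs hG using hG
  have hdm : ∀ k a, AEStronglyMeasurable (jetComp (fun x => u x - f k x)
      (fun x => p x - differential (f k) x) (fun x => h x - hessian (hyperbolicMetric n) (f k) x) a)
      (hypMeasure Ω) := fun k a => by
    refine ((hm a).sub (aestronglyMeasurable_jetOf hΩ (hf k).1 a)).congr ?_
    exact Eventually.of_forall fun x => (jetComp_sub _ _ _ _ _ _ a x).symm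
  -- Finite energy of `(u, p, h)` is not part of the definition. It is recovered by adding a smooth
  -- jet of finite energy to a difference of finite energy.
  obtain ⟨k₀, hk₀⟩ := (hlim.eventually_lt_const ENNReal.zero_lt_top).exists
  obtain ⟨D, hD⟩ := exists_jet_of_h2Energy_lt_top hΩ (hdm k₀) hk₀
  have hF : ∀ a, (D + G k₀) a =ᵐ[hypMeasure Ω] jetComp u p h a := fun a => by
    filter_upwards [Lp.coeFn_add (D a) (G k₀ a), hD a, hG k₀ a] with x h1 h2 h3
    rw [PiLp.add_apply, h1, Pi.add_apply, h2, h3, jetComp_sub, jetOf]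
    ring
  refine ⟨D + G k₀, ?_, hF⟩
  have hconv : Tendsto G atTop (𝓝 (D + G k₀)) := by
    rw [tendsto_iff_norm_sub_tendsto_zero]
    have h1 : ∀ k, h2Energy (hyperbolicMetric n) Ω (fun x => u x - f k x)
        (fun x => p x - differential (f k) x)
        (fun x => h x - hessian (hyperbolicMetric n) (f k) x) =
        ENNReal.ofReal (‖D + G k₀ - G k‖ ^ 2) := fun k => by
      refine h2Energy_eq_norm_sq hΩ fun a => ?_
      filter_upwards [Lp.coeFn_sub ((D + G k₀) a) (G k a), hF a, hG k a] with x h1 h2 h3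
      rw [PiLp.sub_apply, h1, Pi.sub_apply, h2, h3, jetComp_sub, jetOf]
    simp_rw [h1] at hlim
    have h2 := (ENNReal.tendsto_toReal ENNReal.zero_ne_top).comp hlim
    have h3 : Tendsto (fun k => ‖D + G k₀ - G k‖ ^ 2) atTop (𝓝 0) := by
      simpa [Function.comp_def] using h2
    have h4 := h3.sqrt
    simp only [Real.sqrt_zero, Real.sqrt_sq (norm_nonneg _)] at h4
    simpa [norm_sub_rev] using h4
  exact mem_closure_of_tendsto hconv (Eventually.of_forall hGs)

/-- The representative `u` is prescribed because an eigenfunction enters `IsNeumannSolution` as the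
function underlying a basis vector; `p` and `h` are obtained by undoing the frame factors. -/
theorem memH2_of_mem_sobolevH2 (hΩ : IsStripDomain Ω K) {F : JetSpace Ω} (hF : F ∈ sobolevH2 hΩ)
    {u : (Fin n → ℝ) → ℝ} (hu : F (.inl ()) =ᵐ[hypMeasure Ω] u) :
    ∃ p h, MemH2 (hyperbolicMetric n) Ω u p h ∧
      ∀ a, F a =ᵐ[hypMeasure Ω] jetComp u p h a := by
  set p : (Fin n → ℝ) → Fin n → ℝ := fun x i => (x 0)⁻¹ * F (.inr (.inl i)) x with hp
  set h : (Fin n → ℝ) → Matrix (Fin n) (Fin n) ℝ :=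
    fun x => Matrix.of fun i j => (x 0 ^ 2)⁻¹ * F (.inr (.inr (i, j))) x with hh
  have hFc : ∀ a, F a =ᵐ[hypMeasure Ω] jetComp u p h a := by
    rintro (_ | i | ⟨i, j⟩)
    · exact hu
    · filter_upwards [hΩ.ae_mem] with x hx
      have := hΩ.pos x hx
      simp only [jetComp, hp]
      field_simp
    · filter_upwards [hΩ.ae_mem] with x hx
      have := hΩ.pos x hx
      simp only [jetComp, hh, Matrix.of_apply]
      field_simp
  refine ⟨p, h, ⟨(Lp.aestronglyMeasurable (F (.inl ()))).congr hu, ?_, ?_, ?_⟩, hFc⟩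
  · have h0 : Measurable fun x : Fin n → ℝ => (x 0)⁻¹ := by fun_prop
    refine AEMeasurable.aestronglyMeasurable (aemeasurable_pi_lambda _ fun i => ?_)
    exact h0.aemeasurable.mul (Lp.aestronglyMeasurable _).aemeasurable
  · have h0 : Measurable fun x : Fin n → ℝ => (x 0 ^ 2)⁻¹ := by fun_prop
    have h1 : AEMeasurable (fun x (i j : Fin n) => (x 0 ^ 2)⁻¹ * F (.inr (.inr (i, j))) x)
        (hypMeasure Ω) := aemeasurable_pi_lambda _ fun i => aemeasurable_pi_lambda _ fun j =>
      h0.aemeasurable.mul (Lp.aestronglyMeasurable _).aemeasurable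
    exact h1.aestronglyMeasurable
  · obtain ⟨G, hGs, hG⟩ := mem_closure_iff_seq_limit.1 hF
    choose f hf hGf using hGs
    refine ⟨f, fun k => ⟨hf k, ?_⟩, ?_⟩
    · rw [h2Energy_eq_norm_sq hΩ (F := G k) (hGf k)]
      exact ENNReal.ofReal_lt_top
    · have h1 : ∀ k, h2Energy (hyperbolicMetric n) Ω (fun x => u x - f k x)
          (fun x => p x - differential (f k) x)
          (fun x => h x - hessian (hyperbolicMetric n) (f k) x) =
          ENNReal.ofReal (‖F - G k‖ ^ 2) := fun k => by
        refine h2Energy_eq_norm_sq hΩ fun a => ?_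
        filter_upwards [Lp.coeFn_sub (F a) (G k a), hFc a, hGf k a] with x h1 h2 h3
        rw [PiLp.sub_apply, h1, Pi.sub_apply, h2, h3, jetComp_sub, jetOf]
      simp_rw [h1]
      rw [tendsto_iff_norm_sub_tendsto_zero] at hG
      have h2 : Tendsto (fun k => ‖F - G k‖ ^ 2) atTop (𝓝 0) := by
        simpa [norm_sub_rev] using hG.pow 2
      simpa using ENNReal.tendsto_ofReal h2

end Jets

/-! ### The Neumann form on `H²(Ω)` -/

section Form

variable {n : ℕ} [NeZero n] {Ω : Set (Fin n → ℝ)} {K : ℝ}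

/-- The component of index `a` of a jet in `H²(Ω)`. -/
def jetProj (hΩ : IsStripDomain Ω K) (a : JetIndex n) :
    sobolevH2 hΩ →L[ℝ] Lp ℝ 2 (hypMeasure Ω) :=
  (PiLp.proj 2 (𝕜 := ℝ) (fun _ : JetIndex n => Lp ℝ 2 (hypMeasure Ω)) a) ∘L (sobolevH2 hΩ).subtypeL

theorem jetProj_apply (hΩ : IsStripDomain Ω K) (a : JetIndex n) (v : sobolevH2 hΩ) :
    jetProj hΩ a v = (v : JetSpace Ω) a := rfl

/-- The form `∫ ⟨D²u, D²φ⟩ + Ric(∇u, ∇φ)` on `H²(Ω)`. -/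
def neumannForm (hΩ : IsStripDomain Ω K) : sobolevH2 hΩ →L[ℝ] sobolevH2 hΩ →L[ℝ] ℝ :=
  let I : Lp ℝ 2 (hypMeasure Ω) →L[ℝ] Lp ℝ 2 (hypMeasure Ω) →L[ℝ] ℝ := innerSL ℝ
  (∑ ij, I.bilinearComp (jetProj hΩ (.inr (.inr ij))) (jetProj hΩ (.inr (.inr ij)))) -
    ((n : ℝ) - 1) • ∑ i, I.bilinearComp (jetProj hΩ (.inr (.inl i))) (jetProj hΩ (.inr (.inl i)))

theorem neumannForm_apply (hΩ : IsStripDomain Ω K) (v w : sobolevH2 hΩ) :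
    neumannForm hΩ v w =
      ∑ ij, inner ℝ (jetProj hΩ (.inr (.inr ij)) v) (jetProj hΩ (.inr (.inr ij)) w) -
      ((n : ℝ) - 1) * ∑ i, inner ℝ (jetProj hΩ (.inr (.inl i)) v) (jetProj hΩ (.inr (.inl i)) w) := by
  simp only [neumannForm, _root_.sub_apply, _root_.smul_apply, _root_.sum_apply, smul_eq_mul]
  rfl

theorem neumannForm_symm (hΩ : IsStripDomain Ω K) (v w : sobolevH2 hΩ) :
    neumannForm hΩ v w = neumannForm hΩ w v := by
  simp only [neumannForm_apply]
  congr 1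
  · exact Finset.sum_congr rfl fun _ _ => real_inner_comm _ _
  · congr 1
    exact Finset.sum_congr rfl fun _ _ => real_inner_comm _ _

theorem inner_eq_integral_of_ae_eq {α : Type*} [MeasurableSpace α] {μ : Measure α} {F G : Lp ℝ 2 μ}
    {f g : α → ℝ} (hF : F =ᵐ[μ] f) (hG : G =ᵐ[μ] g) :
    inner ℝ F G = ∫ x, f x * g x ∂μ := by
  rw [L2.inner_def]
  refine integral_congr_ae ?_
  filter_upwards [hF, hG] with x h1 h2
  rw [h1, h2]
  simp [mul_comm]

theorem integrable_mul_of_ae_eq {α : Type*} [MeasurableSpace α] {μ : Measure α} {F G : Lp ℝ 2 μ}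
    {f g : α → ℝ} (hF : F =ᵐ[μ] f) (hG : G =ᵐ[μ] g) :
    Integrable (fun x => f x * g x) μ :=
  ((memLp_congr_ae hF).1 (Lp.memLp F)).integrable_mul ((memLp_congr_ae hG).1 (Lp.memLp G))

theorem neumannForm_eq_integral (hΩ : IsStripDomain Ω K) {v w : sobolevH2 hΩ}
    {u u' : (Fin n → ℝ) → ℝ} {p p' : (Fin n → ℝ) → Fin n → ℝ}
    {h h' : (Fin n → ℝ) → Matrix (Fin n) (Fin n) ℝ}
    (hv : ∀ a, (v : JetSpace Ω) a =ᵐ[hypMeasure Ω] jetComp u p h a)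
    (hw : ∀ a, (w : JetSpace Ω) a =ᵐ[hypMeasure Ω] jetComp u' p' h' a) :
    neumannForm hΩ v w = ∫ x in Ω, (tensorInner (hyperbolicMetric n x) (h x) (h' x) +
      evalSharp (hyperbolicMetric n x) (ricci (hyperbolicMetric n) x) (p x) (p' x))
        ∂(riemVolume (hyperbolicMetric n)) := by
  have hint : ∀ a, Integrable (fun x => jetComp u p h a x * jetComp u' p' h' a x) (hypMeasure Ω) :=
    fun a => integrable_mul_of_ae_eq (hv a) (hw a)
  have hin : ∀ a, inner ℝ (jetProj hΩ a v) (jetProj hΩ a w) =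
      ∫ x, jetComp u p h a x * jetComp u' p' h' a x ∂(hypMeasure Ω) := fun a =>
    inner_eq_integral_of_ae_eq (hv a) (hw a)
  rw [neumannForm_apply]
  simp_rw [hin]
  rw [← integral_finsetSum _ fun a _ => hint _, ← integral_finsetSum _ fun a _ => hint _,
    ← integral_const_mul, ← integral_sub]
  · refine setIntegral_congr_fun hΩ.isOpen.measurableSet fun x hx => ?_
    have hx0 := (hΩ.pos x hx).ne'
    simp only [tensorInner_hyperbolicMetric hx0, evalSharp_ricci_hyperbolicMetric hx0, jetComp]
    ring
  · exact integrable_finsetSum _ fun a _ => hint _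
  · exact (integrable_finsetSum _ fun a _ => hint _).const_mul _

/-! #### Compactness -/

theorem norm_fderiv_le_sum {n : ℕ} (g : (Fin n → ℝ) → ℝ) (x : Fin n → ℝ) :
    ‖fderiv ℝ g x‖ ≤ ∑ j, |pd j g x| := by
  refine ContinuousLinearMap.opNorm_le_bound _ (by positivity) fun v => ?_
  have h1 : fderiv ℝ g x v = ∑ j, v j * pd j g x := by
    conv_lhs => rw [pi_eq_sum_univ' v]
    simp [pd]
  rw [h1, Finset.sum_mul]
  refine (norm_sum_le _ _).trans (Finset.sum_le_sum fun j _ => ?_)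
  rw [norm_mul, mul_comm]
  exact mul_le_mul_of_nonneg_left (norm_le_pi_norm v j) (norm_nonneg _)

theorem pd_zero_mul {f : (Fin n → ℝ) → ℝ} {x : Fin n → ℝ} (hf : DifferentiableAt ℝ f x)
    (j : Fin n) : pd j (fun y => y 0 * f y) x = (if j = 0 then f x else 0) + x 0 * pd j f x := by
  have h1 : HasFDerivAt (fun y : Fin n → ℝ => y 0)
    (ContinuousLinearMap.proj (R := ℝ) (φ := fun _ : Fin n => ℝ) 0) x := hasFDerivAt_apply 0 x
  have h2 := h1.fun_mul hf.hasFDerivAt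
  rw [pd, h2.fderiv]
  by_cases hj : j = 0 <;> simp [hj, pd, eq_comm, add_comm]

/-- The gradients of the zeroth and first order jet components are controlled by the jet. -/
theorem norm_fderiv_jetOf_le (hΩ : IsStripDomain Ω K) {f : (Fin n → ℝ) → ℝ}
    (hf : ContDiffOn ℝ ∞ f Ω) {x : Fin n → ℝ} (hx : x ∈ Ω) :
    ‖fderiv ℝ f x‖ ≤ 5 * n * ∑ b, |jetOf f b x| ∧
      ∀ i, ‖fderiv ℝ (fun y => y 0 * pd i f y) x‖ ≤ 5 * n * ∑ b, |jetOf f b x| := by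
  have h0 := hΩ.pos x hx
  have h1 := hΩ.one_lt x hx
  have hinv : (x 0)⁻¹ ≤ 1 := inv_le_one_of_one_le₀ h1.le
  set S := ∑ b, |jetOf f b x| with hS
  have hle : ∀ b, |jetOf f b x| ≤ S := fun b =>
    Finset.single_le_sum (f := fun b => |jetOf f b x|) (fun _ _ => abs_nonneg _) (Finset.mem_univ b)
  have hS0 : 0 ≤ S := (abs_nonneg _).trans (hle (.inl ()))
  have hpd0 : ∀ i, x 0 * |pd i f x| ≤ S := fun i => by
    have := hle (.inr (.inl i))
    simpa [jetOf, jetComp, differential, abs_mul, abs_of_pos h0] using this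
  have hpd : ∀ i, |pd i f x| ≤ S := fun i => by
    nlinarith [hpd0 i, abs_nonneg (pd i f x)]
  have hh : ∀ i j, x 0 * |hessian (hyperbolicMetric n) f x i j| ≤ S := fun i j => by
    have := hle (.inr (.inr (i, j)))
    simp only [jetOf, jetComp, abs_mul, abs_of_pos h0, abs_pow] at this
    have h3 := abs_nonneg (hessian (hyperbolicMetric n) f x i j)
    nlinarith [mul_nonneg h0.le h3]
  -- The `5` counts the terms of `∂_j(x₀ ∂_i f)`: one from the product rule, one Hessian entry, and
  -- three Christoffel terms. Each is at most `S`, since `x₀ > 1`. The factor `n` comes from summing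
  -- over `j`.
  have hsum : ∀ g : (Fin n → ℝ) → ℝ, (∀ j, |pd j g x| ≤ 5 * S) → ‖fderiv ℝ g x‖ ≤ 5 * n * S := by
    intro g hg
    refine (norm_fderiv_le_sum g x).trans ((Finset.sum_le_sum fun j _ => hg j).trans ?_)
    simp
    apply le_of_eq
    ring
  refine ⟨hsum f fun j => (hpd j).trans (by linarith), fun i => hsum _ fun j => ?_⟩
  rw [pd_zero_mul (differentiableAt_of_contDiffOn hΩ.isOpen (contDiffOn_pd hΩ.isOpen hf i) hx)]
  have e : x 0 * pd j (pd i f) x = x 0 * hessian (hyperbolicMetric n) f x j i -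
      ((if i = 0 then pd j f x else 0) + (if j = 0 then pd i f x else 0) -
        (if j = i then pd 0 f x else 0)) := by
    rw [hessian_hyperbolicMetric h0.ne']
    field_simp
    ring
  rw [e]
  have hite : ∀ (P : Prop) [Decidable P] (k : Fin n), |if P then pd k f x else 0| ≤ S := by
    intro P _ k
    split_ifs
    · exact hpd k
    · simpa using hS0
  have h4 : |x 0 * hessian (hyperbolicMetric n) f x j i| ≤ S := by
    rw [abs_mul, abs_of_pos h0]; exact hh j i
  have a1 := abs_le.1 (hite (j = 0) i)
  have a2 := abs_le.1 (hite (i = 0) j)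
  have a3 := abs_le.1 (hite (j = i) 0)
  have a4 := abs_le.1 h4
  rw [abs_le]
  constructor <;> linarith [a1.1, a1.2, a2.1, a2.2, a3.1, a3.2, a4.1, a4.2]

theorem exists_lintegral_enorm_fderiv_le (hΩ : IsStripDomain Ω K) :
    ∃ C : ℝ, 0 ≤ C ∧ ∀ f : (Fin n → ℝ) → ℝ, ContDiffOn ℝ ∞ f Ω → ∀ F : JetSpace Ω,
      (∀ a, F a =ᵐ[hypMeasure Ω] jetOf f a) → ∀ g : (Fin n → ℝ) → ℝ,
      (∀ x ∈ Ω, ‖fderiv ℝ g x‖ ≤ 5 * n * ∑ b, |jetOf f b x|) →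
      ∫⁻ x in Ω, ‖fderiv ℝ g x‖ₑ ^ 2 ≤ ENNReal.ofReal (C * ‖F‖ ^ 2) := by
  have hK : 0 < K := by
    obtain ⟨x, hx⟩ := hΩ.nonempty
    exact (hΩ.pos x hx).trans (hΩ.lt x hx)
  set A : ℝ := (5 * n) ^ 2 * Fintype.card (JetIndex n) with hA
  refine ⟨K ^ n * A, by positivity, fun f hf F hF g hg => ?_⟩
  have hpt : ∀ x ∈ Ω, ‖fderiv ℝ g x‖ₑ ^ 2 ≤ ENNReal.ofReal A * ∑ b, ‖jetOf f b x‖ₑ ^ 2 := by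
    intro x hx
    have e : ∑ b, ‖jetOf f b x‖ₑ ^ 2 = ENNReal.ofReal (∑ b, |jetOf f b x| ^ 2) := by
      rw [ENNReal.ofReal_sum_of_nonneg fun b _ => by positivity]
      refine Finset.sum_congr rfl fun b _ => ?_
      rw [ENNReal.ofReal_pow (abs_nonneg _), ← Real.norm_eq_abs, ofReal_norm]
    rw [e, ← ENNReal.ofReal_mul (by positivity), ← ofReal_norm,
      ← ENNReal.ofReal_pow (norm_nonneg _)]
    apply ENNReal.ofReal_le_ofReal
    calc ‖fderiv ℝ g x‖ ^ 2 ≤ (5 * n * ∑ b, |jetOf f b x|) ^ 2 := by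
          gcongr; exact hg x hx
      _ = (5 * n) ^ 2 * (∑ b, |jetOf f b x|) ^ 2 := by ring
      _ ≤ (5 * n) ^ 2 * (Fintype.card (JetIndex n) * ∑ b, |jetOf f b x| ^ 2) := by
          gcongr
          exact sq_sum_le_card_mul_sum_sq
      _ = _ := by rw [hA]; ring
  have hE : ∫⁻ x, ∑ b, ‖jetOf f b x‖ₑ ^ 2 ∂(hypMeasure Ω) = ENNReal.ofReal (‖F‖ ^ 2) := by
    rw [← h2Energy_eq_norm_sq hΩ hF, h2Energy_eq_lintegral hΩ]
    rfl
  calc ∫⁻ x in Ω, ‖fderiv ℝ g x‖ₑ ^ 2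
      ≤ ∫⁻ x in Ω, ENNReal.ofReal A * ∑ b, ‖jetOf f b x‖ₑ ^ 2 :=
        setLIntegral_mono' hΩ.isOpen.measurableSet hpt
    _ = ENNReal.ofReal A * ∫⁻ x in Ω, ∑ b, ‖jetOf f b x‖ₑ ^ 2 :=
        lintegral_const_mul' _ _ ENNReal.ofReal_ne_top
    _ ≤ ENNReal.ofReal A * (ENNReal.ofReal (K ^ n) * ENNReal.ofReal (‖F‖ ^ 2)) := by
        gcongr
        rw [← hE]
        exact hΩ.lintegral_le _
    _ = _ := by
        rw [← ENNReal.ofReal_mul (by positivity), ← ENNReal.ofReal_mul (by positivity)]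
        congr 1
        ring

/-- Rellich's theorem for one component: if its differential is controlled by the whole jet, the
step-function approximation is uniform on bounded sets of smooth jets, which are dense. -/
theorem isCompactOperator_jetProj_of (hΩ : IsStripDomain Ω K) (a : JetIndex n)
    (hreg : ∀ f : (Fin n → ℝ) → ℝ, ContDiffOn ℝ ∞ f Ω → ContDiffOn ℝ 1 (jetOf f a) Ω ∧
      ∀ x ∈ Ω, ‖fderiv ℝ (jetOf f a) x‖ ≤ 5 * n * ∑ b, |jetOf f b x|) :
    IsCompactOperator (jetProj hΩ a) := by
  obtain ⟨C, hC0, hC⟩ := exists_lintegral_enorm_fderiv_le hΩ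
  refine isCompactOperator_of_approx _ (dense_smoothJets hΩ) fun ε hε => ?_
  set η : ℝ := ε / (C + 1) with hη
  have hη0 : 0 < η := by positivity
  obtain ⟨U, hU, happ⟩ := exists_finiteDimensional_approx hΩ.isOpen hΩ.convex hΩ.isBounded
    hΩ.hypMeasure_le hη0
  refine ⟨U, hU, ?_⟩
  rintro v ⟨f, hf, hv⟩
  obtain ⟨hg, hgb⟩ := hreg f hf
  obtain ⟨w, hw, hle⟩ := happ (jetOf f a) hg (jetProj hΩ a v) (hv a)
  refine ⟨w, hw, ?_⟩
  have h1 := hle.trans (mul_le_mul_right (hC f hf v hv _ hgb) _)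
  rw [← ofReal_norm, ← ENNReal.ofReal_pow (norm_nonneg _),
    ← ENNReal.ofReal_mul (by positivity), ENNReal.ofReal_le_ofReal_iff (by positivity)] at h1
  refine abs_le_of_sq_le_sq' ?_ (by positivity) |>.2
  refine h1.trans ?_
  have h2 : η ^ 2 * C ≤ ε ^ 2 := by
    rw [hη, div_pow, div_mul_eq_mul_div, div_le_iff₀ (by positivity)]
    have : C ≤ (C + 1) ^ 2 := by nlinarith
    gcongr
  calc η ^ 2 * (C * ‖(v : JetSpace Ω)‖ ^ 2) = η ^ 2 * C * ‖v‖ ^ 2 := by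
        rw [Submodule.coe_norm]; ring
    _ ≤ ε ^ 2 * ‖v‖ ^ 2 := by gcongr
    _ = _ := by ring

theorem isCompactOperator_jetProj_zero (hΩ : IsStripDomain Ω K) :
    IsCompactOperator (jetProj hΩ (.inl ())) :=
  isCompactOperator_jetProj_of hΩ _ fun f hf =>
    ⟨hf.of_le (by simp), fun x hx => (norm_fderiv_jetOf_le hΩ hf hx).1⟩

theorem isCompactOperator_jetProj_one (hΩ : IsStripDomain Ω K) (i : Fin n) :
    IsCompactOperator (jetProj hΩ (.inr (.inl i))) :=
  isCompactOperator_jetProj_of hΩ _ fun f hf => by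
    refine ⟨?_, fun x hx => (norm_fderiv_jetOf_le hΩ hf hx).2 i⟩
    have h1 : ContDiffOn ℝ ∞ (fun x : Fin n → ℝ => x 0 * pd i f x) Ω :=
      (contDiff_apply ℝ ℝ (0 : Fin n)).contDiffOn.mul (contDiffOn_pd hΩ.isOpen hf i)
    exact h1.of_le (by simp)

end Form

/-! ### Test functions, coercivity and existence of the spectrum -/

section Existence

variable {n : ℕ} [NeZero n] {Ω : Set (Fin n → ℝ)} {K : ℝ}

/-- Smooth functions with compact support in `Ω`. -/
structure IsTestFunction {n : ℕ} (Ω : Set (Fin n → ℝ)) (Φ : (Fin n → ℝ) → ℝ) : Prop where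
  contDiff : ContDiff ℝ ∞ Φ
  hasCompactSupport : HasCompactSupport Φ
  tsupport_subset : tsupport Φ ⊆ Ω

theorem IsTestFunction.pd {n : ℕ} {Ω : Set (Fin n → ℝ)} {Φ : (Fin n → ℝ) → ℝ}
    (h : IsTestFunction Ω Φ) (i : Fin n) : IsTestFunction Ω (pd i Φ) :=
  ⟨(h.contDiff.fderiv_right (by simp)).clm_apply contDiff_const,
    h.hasCompactSupport.fderiv_apply ℝ _,
    (tsupport_fderiv_apply_subset ℝ _).trans h.tsupport_subset⟩

theorem IsTestFunction.mul_left {n : ℕ} {Ω : Set (Fin n → ℝ)} {Φ f : (Fin n → ℝ) → ℝ}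
    (h : IsTestFunction Ω Φ) (hf : ContDiff ℝ ∞ f) : IsTestFunction Ω fun x => f x * Φ x :=
  ⟨hf.mul h.contDiff, h.hasCompactSupport.mul_left,
    (tsupport_mul_subset_right).trans h.tsupport_subset⟩

theorem IsTestFunction.integrable_mul {n : ℕ} {Ω : Set (Fin n → ℝ)} {Φ f : (Fin n → ℝ) → ℝ}
    (h : IsTestFunction Ω Φ) (hΩ : IsOpen Ω) (hf : ContinuousOn f Ω) :
    Integrable fun x => Φ x * f x := by
  refine Continuous.integrable_of_hasCompactSupport ?_ h.hasCompactSupport.mul_right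
  exact (h.contDiff.continuous.continuousOn.mul hf).continuous_of_tsupport_subset hΩ
    ((tsupport_mul_subset_left).trans h.tsupport_subset)

/-- The support of `Φ` is compact in `Ω`, so `f` need only be smooth inside `Ω` and no boundary term
arises. -/
theorem IsTestFunction.integral_mul_pd {n : ℕ} {Ω : Set (Fin n → ℝ)} {Φ f : (Fin n → ℝ) → ℝ}
    (h : IsTestFunction Ω Φ) (hΩ : IsOpen Ω) (hf : ContDiffOn ℝ ∞ f Ω) (i : Fin n) :
    ∫ x, Φ x * BiharmonicNeumann.pd i f x = -∫ x, BiharmonicNeumann.pd i Φ x * f x := by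
  refine integral_mul_fderiv_eq_neg_fderiv_mul_of_integrable ?_ ?_ ?_ ?_ ?_
  · exact (h.pd i).integrable_mul hΩ hf.continuousOn
  · exact h.integrable_mul hΩ (contDiffOn_pd hΩ hf i).continuousOn
  · exact h.integrable_mul hΩ hf.continuousOn
  · exact fun x _ => (h.contDiff.differentiable (by simp)) x
  · exact fun x hx => differentiableAt_of_contDiffOn hΩ hf (h.tsupport_subset hx)

theorem IsStripDomain.closure_subset (hΩ : IsStripDomain Ω K) : closure Ω ⊆ halfSpace n := by
  have h1 : closure Ω ⊆ {x : Fin n → ℝ | 1 ≤ x 0} :=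
    closure_minimal (fun x hx => (hΩ.one_lt x hx).le)
      (isClosed_le continuous_const (continuous_apply 0))
  intro x hx
  have : 1 ≤ x 0 := h1 hx
  exact lt_of_lt_of_le one_pos this

theorem isOpen_halfSpace : IsOpen (halfSpace n) :=
  isOpen_lt continuous_const (continuous_apply 0)

theorem IsStripDomain.memLp (hΩ : IsStripDomain Ω K) {f : (Fin n → ℝ) → ℝ}
    (hf : ContinuousOn f (halfSpace n)) : MemLp f 2 (hypMeasure Ω) := by
  have := hΩ.isFiniteMeasure
  have hc : IsCompact (closure Ω) := hΩ.isBounded.isCompact_closure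
  obtain ⟨C, hC⟩ := hc.exists_bound_of_continuousOn (hf.mono hΩ.closure_subset)
  refine MemLp.of_bound ?_ C ?_
  · exact (hf.mono (subset_closure.trans hΩ.closure_subset)).aestronglyMeasurable
      hΩ.isOpen.measurableSet
  · filter_upwards [hΩ.ae_mem] with x hx using hC x (subset_closure hx)

/-- Functions smooth on the half-space have a jet in `H²(Ω)`. -/
theorem exists_smoothJet (hΩ : IsStripDomain Ω K) {f : (Fin n → ℝ) → ℝ}
    (hf : ContDiffOn ℝ ∞ f (halfSpace n)) :
    ∃ v : sobolevH2 hΩ, ∀ a, (v : JetSpace Ω) a =ᵐ[hypMeasure Ω] jetOf f a := by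
  have hm : ∀ a, MemLp (jetOf f a) 2 (hypMeasure Ω) := fun a =>
    hΩ.memLp (continuousOn_jetOf isOpen_halfSpace (fun x hx => hx) hf a)
  let F : JetSpace Ω := WithLp.toLp 2 fun a => (hm a).toLp _
  have hF : ∀ a, F a =ᵐ[hypMeasure Ω] jetOf f a := fun a => (hm a).coeFn_toLp
  refine ⟨⟨F, Submodule.le_topologicalClosure _ ⟨f, ?_, hF⟩⟩, hF⟩
  exact hf.mono (subset_closure.trans hΩ.closure_subset)

/-- The weighted test functions `x₀ⁿ Φ` in `L²(Ω)`. -/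
def testSpan (Ω : Set (Fin n → ℝ)) : Submodule ℝ (Lp ℝ 2 (hypMeasure Ω)) :=
  Submodule.span ℝ {φ | ∃ Φ, IsTestFunction Ω Φ ∧ φ =ᵐ[hypMeasure Ω] fun x => x 0 ^ n * Φ x}

theorem IsStripDomain.exists_testVector (hΩ : IsStripDomain Ω K) {Φ : (Fin n → ℝ) → ℝ}
    (hΦ : IsTestFunction Ω Φ) :
    ∃ φ : Lp ℝ 2 (hypMeasure Ω), φ =ᵐ[hypMeasure Ω] fun x => x 0 ^ n * Φ x :=
  ⟨(hΩ.memLp (((continuous_apply (0 : Fin n)).pow n).mul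
    hΦ.contDiff.continuous).continuousOn).toLp _, MemLp.coeFn_toLp _⟩

/-- The weight `x₀ⁿ` cancels the hyperbolic density, so pairings with these vectors are Lebesgue
integrals and can be integrated by parts without further terms. -/
theorem IsStripDomain.inner_testVector (hΩ : IsStripDomain Ω K) {Φ : (Fin n → ℝ) → ℝ}
    (hΦ : IsTestFunction Ω Φ) {φ G : Lp ℝ 2 (hypMeasure Ω)} {g : (Fin n → ℝ) → ℝ}
    (hφ : φ =ᵐ[hypMeasure Ω] fun x => x 0 ^ n * Φ x) (hG : G =ᵐ[hypMeasure Ω] g) :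
    inner ℝ φ G = ∫ x, Φ x * g x := by
  rw [inner_eq_integral_of_ae_eq hφ hG, integral_hypMeasure hΩ.isOpen.measurableSet hΩ.pos]
  refine Eq.trans ?_ (setIntegral_eq_integral_of_forall_compl_eq_zero (s := Ω) ?_)
  · refine setIntegral_congr_fun hΩ.isOpen.measurableSet fun x hx => ?_
    have := hΩ.pos x hx
    field_simp
  · intro x hx
    rw [image_eq_zero_of_notMem_tsupport fun h => hx (hΦ.tsupport_subset h), zero_mul]

theorem IsStripDomain.volume_restrict_le (hΩ : IsStripDomain Ω K) :
    volume.restrict Ω ≤ ENNReal.ofReal (K ^ n) • hypMeasure Ω := by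
  refine Measure.le_iff.2 fun s hs => ?_
  have := hΩ.lintegral_le (s.indicator 1)
  rwa [lintegral_indicator_one hs, lintegral_indicator_one hs] at this

/-- A function orthogonal to the span has zero Lebesgue pairing with every test function, hence
vanishes almost everywhere by the fundamental lemma of the calculus of variations. -/
theorem dense_testSpan (hΩ : IsStripDomain Ω K) :
    Dense (testSpan Ω : Set (Lp ℝ 2 (hypMeasure Ω))) := by
  have := hΩ.isFiniteMeasure
  rw [Submodule.dense_iff_topologicalClosure_eq_top, Submodule.topologicalClosure_eq_top_iff,
    eq_bot_iff]
  intro G hG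
  rw [Submodule.mem_bot]
  have hint : IntegrableOn G Ω volume := by
    have h1 : Integrable G (hypMeasure Ω) := (Lp.memLp G).integrable (by norm_num)
    exact (h1.smul_measure ENNReal.ofReal_ne_top).mono_measure hΩ.volume_restrict_le
  have hz := hΩ.isOpen.ae_eq_zero_of_integral_contDiff_smul_eq_zero (μ := volume) (f := G)
    hint.locallyIntegrableOn fun Φ h1 h2 h3 => by
      obtain ⟨φ, hφ⟩ := hΩ.exists_testVector ⟨h1, h2, h3⟩
      have h4 := hG φ (Submodule.subset_span ⟨Φ, ⟨h1, h2, h3⟩, hφ⟩)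
      rw [hΩ.inner_testVector ⟨h1, h2, h3⟩ hφ (ae_eq_refl _)] at h4
      exact h4
  have hz' : ∀ᵐ x ∂(volume.restrict Ω), G x = 0 :=
    (ae_restrict_iff' hΩ.isOpen.measurableSet).2 hz
  have hz'' := (Measure.absolutelyContinuous_of_le hΩ.hypMeasure_le) hz'
  exact (Lp.eq_zero_iff_ae_eq_zero).2 hz''

theorem denseRange_jetProj_zero (hΩ : IsStripDomain Ω K) : DenseRange (jetProj hΩ (.inl ())) := by
  have h1 : testSpan Ω ≤ LinearMap.range (jetProj hΩ (.inl ())).toLinearMap := by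
    rw [testSpan, Submodule.span_le]
    rintro φ ⟨Φ, hΦ, hφ⟩
    have hs : ContDiff ℝ ∞ fun x : Fin n → ℝ => x 0 ^ n * Φ x :=
      ((contDiff_apply ℝ ℝ (0 : Fin n)).pow n).mul hΦ.contDiff
    obtain ⟨v, hv⟩ := exists_smoothJet hΩ hs.contDiffOn
    exact ⟨v, Lp.ext ((hv (.inl ())).trans hφ.symm)⟩
  exact (dense_testSpan hΩ).mono h1

/-- Weak differentiation: the pairing of a derivative with a test function is controlled by the
`L²` norm of the function. -/
theorem exists_abs_inner_jetProj_le (hΩ : IsStripDomain Ω K) (i : Fin n)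
    {φ : Lp ℝ 2 (hypMeasure Ω)} (hφ : φ ∈ testSpan Ω) :
    ∃ C, ∀ v, |inner ℝ φ (jetProj hΩ (.inr (.inl i)) v)| ≤ C * ‖jetProj hΩ (.inl ()) v‖ := by
  induction hφ using Submodule.span_induction with
  | mem φ h =>
    obtain ⟨Φ, hΦ, hφ⟩ := h
    have hΨ : IsTestFunction Ω fun x => x 0 * Φ x := hΦ.mul_left (contDiff_apply ℝ ℝ (0 : Fin n))
    obtain ⟨ψ, hψ⟩ := hΩ.exists_testVector (hΨ.pd i)
    -- Integration by parts against `x₀ Φ` gives this for smooth jets; both sides are continuous in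
    -- `v`, so it passes to the closure.
    have key : ∀ v, inner ℝ φ (jetProj hΩ (.inr (.inl i)) v) =
        -inner ℝ ψ (jetProj hΩ (.inl ()) v) := by
      intro v
      refine isClosed_property (dense_smoothJets hΩ).denseRange_val
        (p := fun v => inner ℝ φ (jetProj hΩ (.inr (.inl i)) v) =
          -inner ℝ ψ (jetProj hΩ (.inl ()) v))
        (isClosed_eq (by fun_prop) (by fun_prop)) ?_ v
      rintro ⟨v, hvS⟩
      obtain ⟨f, hf, hv⟩ := hvS
      have e1 : inner ℝ φ (jetProj hΩ (.inr (.inl i)) v) = _ :=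
        hΩ.inner_testVector hΦ hφ (hv (.inr (.inl i)))
      have e2 : inner ℝ ψ (jetProj hΩ (.inl ()) v) = _ :=
        hΩ.inner_testVector (hΨ.pd i) hψ (hv (.inl ()))
      change inner ℝ φ (jetProj hΩ (.inr (.inl i)) v) = -inner ℝ ψ (jetProj hΩ (.inl ()) v)
      rw [e1, e2]
      refine Eq.trans ?_ (hΨ.integral_mul_pd hΩ.isOpen hf i)
      refine integral_congr_ae (Eventually.of_forall fun x => ?_)
      simp only [jetOf, jetComp, differential]
      ring
    refine ⟨‖ψ‖, fun v => ?_⟩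
    rw [key, abs_neg]
    exact abs_real_inner_le_norm _ _
  | zero => exact ⟨0, fun v => by simp⟩
  | add φ ψ _ _ h1 h2 =>
    obtain ⟨C, hC⟩ := h1
    obtain ⟨D, hD⟩ := h2
    refine ⟨C + D, fun v => ?_⟩
    rw [inner_add_left, add_mul]
    exact (abs_add_le _ _).trans (add_le_add (hC v) (hD v))
  | smul c φ _ h =>
    obtain ⟨C, hC⟩ := h
    refine ⟨|c| * C, fun v => ?_⟩
    rw [real_inner_smul_left, abs_mul, mul_assoc]
    exact mul_le_mul_of_nonneg_left (hC v) (abs_nonneg c)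

theorem norm_sq_sobolevH2 (hΩ : IsStripDomain Ω K) (v : sobolevH2 hΩ) :
    ‖v‖ ^ 2 = ‖jetProj hΩ (.inl ()) v‖ ^ 2 + (∑ i, ‖jetProj hΩ (.inr (.inl i)) v‖ ^ 2 +
      ∑ ij, ‖jetProj hΩ (.inr (.inr ij)) v‖ ^ 2) := by
  rw [Submodule.coe_norm, PiLp.norm_sq_eq_of_L2, Fintype.sum_sum_type, Fintype.sum_sum_type]
  simp [jetProj_apply]

/-- Gårding's inequality for the Neumann form. -/
theorem exists_coercive (hΩ : IsStripDomain Ω K) :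
    ∃ lam : ℝ, ∀ v, 1 / 2 * ‖v‖ ^ 2 ≤
      neumannForm hΩ v v + lam * ‖jetProj hΩ (.inl ()) v‖ ^ 2 := by
  have hn : (0 : ℝ) < n := by exact_mod_cast Nat.pos_of_ne_zero (NeZero.ne n)
  -- The form equals `‖v‖² - |u|² - n|∇u|²` after integration. The constant `1/(2n²)` is such that
  -- summing over the `n` components and multiplying by `n` gives `‖v‖²/2`.
  have h1 : ∀ i, ∃ C, ∀ v, ‖jetProj hΩ (.inr (.inl i)) v‖ ^ 2 ≤
      1 / (2 * (n : ℝ) ^ 2) * ‖v‖ ^ 2 + C * ‖jetProj hΩ (.inl ()) v‖ ^ 2 := fun i =>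
    exists_norm_sq_le_of_compact _ (isCompactOperator_jetProj_one hΩ i) _ (dense_testSpan hΩ)
      (fun φ hφ => exists_abs_inner_jetProj_le hΩ i hφ) (by positivity)
  choose C hC using h1
  refine ⟨1 + n * ∑ i, C i, fun v => ?_⟩
  have h2 : ∑ i, ‖jetProj hΩ (.inr (.inl i)) v‖ ^ 2 ≤
      n * (1 / (2 * (n : ℝ) ^ 2) * ‖v‖ ^ 2) + (∑ i, C i) * ‖jetProj hΩ (.inl ()) v‖ ^ 2 := by
    refine (Finset.sum_le_sum fun i _ => hC i v).trans ?_
    rw [Finset.sum_add_distrib, Finset.sum_const, Finset.card_univ, Fintype.card_fin, nsmul_eq_mul,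
      Finset.sum_mul]
  have h3 := mul_le_mul_of_nonneg_left h2 hn.le
  have h4 : (n : ℝ) * (n * (1 / (2 * (n : ℝ) ^ 2) * ‖v‖ ^ 2)) = 1 / 2 * ‖v‖ ^ 2 := by
    field_simp
  rw [mul_add, h4] at h3
  have h5 := norm_sq_sobolevH2 hΩ v
  rw [neumannForm_apply]
  simp only [real_inner_self_eq_norm_sq]
  nlinarith

/-- Needed for a Hilbert basis indexed by all of `ℕ`. Polynomials in the height embed, since a
polynomial vanishing almost everywhere on an open set has infinitely many roots. -/
theorem not_finiteDimensional_L2 (hΩ : IsStripDomain Ω K) :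
    ¬ FiniteDimensional ℝ (Lp ℝ 2 (hypMeasure Ω)) := by
  intro hfin
  have hc : ∀ P : Polynomial ℝ, Continuous fun x : Fin n → ℝ => P.eval (x 0) := fun P =>
    P.continuous.comp (continuous_apply 0)
  have hm : ∀ P : Polynomial ℝ, MemLp (fun x : Fin n → ℝ => P.eval (x 0)) 2 (hypMeasure Ω) :=
    fun P => hΩ.memLp (hc P).continuousOn
  let L : Polynomial ℝ →ₗ[ℝ] Lp ℝ 2 (hypMeasure Ω) :=
    { toFun := fun P => (hm P).toLp _
      map_add' := fun P Q => by
        rw [← MemLp.toLp_add]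
        congr 1
        ext x
        simp
      map_smul' := fun c P => by
        rw [RingHom.id_apply, ← MemLp.toLp_const_smul]
        congr 1
        ext x
        simp }
  have hinj : Function.Injective L := by
    rw [← LinearMap.ker_eq_bot, LinearMap.ker_eq_bot']
    intro P hP
    have h1 : (fun x : Fin n → ℝ => P.eval (x 0)) =ᵐ[hypMeasure Ω] fun _ => 0 := by
      refine (hm P).coeFn_toLp.symm.trans ?_
      change (L P : (Fin n → ℝ) → ℝ) =ᵐ[hypMeasure Ω] _
      rw [hP]
      exact Lp.coeFn_zero _ _ _
    have hac : volume.restrict Ω ≪ hypMeasure Ω :=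
      (Measure.absolutelyContinuous_of_le hΩ.volume_restrict_le).trans
        Measure.smul_absolutelyContinuous
    have h2 := Measure.eqOn_open_of_ae_eq (hac h1) hΩ.isOpen (hc P).continuousOn continuousOn_const
    refine Polynomial.eq_zero_of_infinite_isRoot P ?_
    have ho : IsOpen ((fun x : Fin n → ℝ => x 0) '' Ω) := isOpenMap_eval 0 _ hΩ.isOpen
    obtain ⟨x, hx⟩ := hΩ.nonempty
    refine (infinite_of_mem_nhds (x 0) (ho.mem_nhds ⟨x, hx, rfl⟩)).mono ?_
    rintro _ ⟨y, hy, rfl⟩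
    exact h2 hy
  exact Polynomial.not_finite (R := ℝ) (Module.Finite.of_injective L hinj)

/-- Existence of the Neumann spectrum, with an upper bound for the first eigenvalues in terms of
functions with disjoint supports. -/
theorem exists_neumannSpectrum (hΩ : IsStripDomain Ω K) {N : ℕ} {M : ℝ}
    (u : Fin N → (Fin n → ℝ) → ℝ) (hu : ∀ j, ContDiffOn ℝ ∞ (u j) (halfSpace n))
    (hdisj : ∀ i j, i ≠ j → ∀ x ∈ Ω, ∀ a, jetOf (u i) a x * jetOf (u j) a x = 0)
    (hne : ∀ j, ∫ x, u j x * u j x ∂(hypMeasure Ω) ≠ 0)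
    (hq : ∀ j, ∫ x, (∑ ij, jetOf (u j) (.inr (.inr ij)) x * jetOf (u j) (.inr (.inr ij)) x -
      ((n : ℝ) - 1) * ∑ i, jetOf (u j) (.inr (.inl i)) x * jetOf (u j) (.inr (.inl i)) x +
        M * (u j x * u j x)) ∂(hypMeasure Ω) ≤ 0) :
    ∃ mu, IsNeumannSpectrum (hyperbolicMetric n) Ω mu ∧ ∀ j < N, mu j ≤ -M := by
  obtain ⟨lam, hlam⟩ := exists_coercive hΩ
  have : CompleteSpace (sobolevH2 hΩ) := (isClosed_sobolevH2 hΩ).completeSpace_coe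
  obtain ⟨mu, b, hmono, hlim, heig, hmm⟩ := exists_spectrum_of_form (not_finiteDimensional_L2 hΩ)
    (jetProj hΩ (.inl ())) (isCompactOperator_jetProj_zero hΩ) (denseRange_jetProj_zero hΩ)
    (neumannForm hΩ) (neumannForm_symm hΩ) lam (1 / 2) (by norm_num) hlam
  refine ⟨mu, ⟨hmono, hlim, b, fun j => ?_⟩, ?_⟩
  · obtain ⟨v, hv, hvw⟩ := heig j
    obtain ⟨p, h, hmem, hcomp⟩ := memH2_of_mem_sobolevH2 hΩ v.2 (u := b j) (by
      rw [← hv]; rfl)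
    refine ⟨p, h, hmem, fun φ q k hφ => ?_⟩
    obtain ⟨w, hw, hwc⟩ := exists_mem_sobolevH2_of_memH2 hΩ hφ
    have h1 := hvw ⟨w, hw⟩
    have h2 : inner ℝ (b j) (jetProj hΩ (.inl ()) ⟨w, hw⟩) = _ :=
      inner_eq_integral_of_ae_eq (ae_eq_refl _) (hwc (.inl ()))
    rw [neumannForm_eq_integral hΩ hcomp hwc, h2] at h1
    exact h1
  · choose v hv using fun j => exists_smoothJet hΩ (hu j)
    have hin : ∀ i j a, inner ℝ (jetProj hΩ a (v i)) (jetProj hΩ a (v j)) =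
        ∫ x, jetOf (u i) a x * jetOf (u j) a x ∂(hypMeasure Ω) := fun i j a =>
      inner_eq_integral_of_ae_eq (hv i a) (hv j a)
    -- As the jets have disjoint supports, both the form and the `L²` product are diagonal on the
    -- span of the trial functions, so the hypothesis on single functions extends to combinations.
    have horth : ∀ i j, i ≠ j → ∀ a, inner ℝ (jetProj hΩ a (v i)) (jetProj hΩ a (v j)) = 0 := by
      intro i j hij a
      rw [hin, setIntegral_congr_fun (g := fun _ => (0 : ℝ)) hΩ.isOpen.measurableSet
        fun x hx => hdisj i j hij x hx a]
      simp
    have hform : ∀ i j, i ≠ j → neumannForm hΩ (v i) (v j) = 0 := fun i j hij => by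
      rw [neumannForm_apply]
      simp [horth i j hij]
    have hdiag : ∀ j, neumannForm hΩ (v j) (v j) ≤ -M * ‖jetProj hΩ (.inl ()) (v j)‖ ^ 2 := by
      intro j
      have hint : ∀ a, Integrable (fun x => jetOf (u j) a x * jetOf (u j) a x) (hypMeasure Ω) :=
        fun a => integrable_mul_of_ae_eq (hv j a) (hv j a)
      have h1 := hq j
      rw [integral_add, integral_sub, integral_const_mul, integral_const_mul,
        integral_finsetSum _ fun a _ => hint _, integral_finsetSum _ fun a _ => hint _] at h1
      · simp_rw [← hin j j] at h1
        have h2 := hin j j (.inl ())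
        rw [real_inner_self_eq_norm_sq] at h2
        have h3 : ∫ x, u j x * u j x ∂(hypMeasure Ω) = ‖jetProj hΩ (.inl ()) (v j)‖ ^ 2 := h2.symm
        rw [h3] at h1
        rw [neumannForm_apply]
        linarith
      · exact integrable_finsetSum _ fun a _ => hint _
      · exact (integrable_finsetSum _ fun a _ => hint _).const_mul _
      · exact (integrable_finsetSum _ fun a _ => hint _).sub
          ((integrable_finsetSum _ fun a _ => hint _).const_mul _)
      · exact (hint (.inl ())).const_mul M
    refine eigenvalue_le_of_testSpace (jetProj hΩ (.inl ())) (neumannForm hΩ) lam (1 / 2)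
      (by norm_num) hlam hmm v ?_ ?_
    · refine LinearIndependent.of_comp (jetProj hΩ (.inl ())).toLinearMap ?_
      refine linearIndependent_of_ne_zero_of_inner_eq_zero (𝕜 := ℝ) (fun j => ?_)
        fun i j hij => horth i j hij _
      intro h0
      apply hne j
      have h2 := hin j j (.inl ())
      have h3 : jetProj hΩ (.inl ()) (v j) = 0 := h0
      rw [h3, inner_zero_left] at h2
      exact h2.symm
    · intro s
      have e1 : neumannForm hΩ (∑ i, s i • v i) (∑ i, s i • v i) =
          ∑ i, s i ^ 2 * neumannForm hΩ (v i) (v i) := by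
        simp only [map_sum, map_smul, _root_.sum_apply, _root_.smul_apply, smul_eq_mul]
        refine Finset.sum_congr rfl fun i _ => ?_
        rw [Finset.mul_sum]
        rw [Finset.sum_eq_single i]
        · ring
        · intro j _ hji
          rw [hform _ _ hji]; ring
        · simp
      have e2 : ‖jetProj hΩ (.inl ()) (∑ i, s i • v i)‖ ^ 2 =
          ∑ i, s i ^ 2 * ‖jetProj hΩ (.inl ()) (v i)‖ ^ 2 := by
        rw [← real_inner_self_eq_norm_sq, map_sum, sum_inner]
        refine Finset.sum_congr rfl fun i _ => ?_
        rw [inner_sum, Finset.sum_eq_single i]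
        · rw [map_smul, real_inner_smul_left, real_inner_smul_right, real_inner_self_eq_norm_sq]
          ring
        · intro j _ hji
          rw [map_smul, map_smul, real_inner_smul_left, real_inner_smul_right,
            horth _ _ hji.symm]
          ring
        · simp
      rw [e1, e2, Finset.mul_sum]
      refine Finset.sum_le_sum fun i _ => ?_
      have := mul_le_mul_of_nonneg_left (hdiag i) (sq_nonneg (s i))
      linarith

end Existence

/-! ### A slim convex domain around a geodesic -/

section Domain

variable {n : ℕ} [NeZero n]

/-- The squared Euclidean distance to the vertical axis. -/
def axisDistSq (x : Fin n → ℝ) : ℝ := ∑ i ∈ Finset.univ.erase 0, x i ^ 2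

/-- A slim domain around the geodesic segment joining the points of height `1` and `K` on the
vertical axis. -/
def slimDomain (n : ℕ) [NeZero n] (c K : ℝ) : Set (Fin n → ℝ) :=
  {x | 0 < x 0 ∧ axisDistSq x < c * (x 0 * (x 0 - 1) * (K - x 0))}

theorem axisDistSq_nonneg (x : Fin n → ℝ) : 0 ≤ axisDistSq x :=
  Finset.sum_nonneg fun _ _ => sq_nonneg _

theorem contDiff_axisDistSq : ContDiff ℝ ∞ (axisDistSq (n := n)) := by
  unfold axisDistSq
  fun_prop

theorem sq_le_axisDistSq (x : Fin n → ℝ) {i : Fin n} (hi : i ≠ 0) : x i ^ 2 ≤ axisDistSq x :=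
  Finset.single_le_sum (f := fun i => x i ^ 2) (fun _ _ => sq_nonneg _)
    (Finset.mem_erase.2 ⟨hi, Finset.mem_univ i⟩)

variable {c K : ℝ}

theorem mem_Ioo_of_mem_slimDomain (hc : 0 < c) (hK : 1 < K) {x : Fin n → ℝ}
    (hx : x ∈ slimDomain n c K) : x 0 ∈ Set.Ioo 1 K := by
  obtain ⟨h0, h1⟩ := hx
  have h2 : 0 < c * (x 0 * (x 0 - 1) * (K - x 0)) := (axisDistSq_nonneg x).trans_lt h1
  have h3 : 0 < x 0 * (x 0 - 1) * (K - x 0) := (mul_pos_iff_of_pos_left hc).1 h2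
  rw [mul_assoc] at h3
  have h4 : 0 < (x 0 - 1) * (K - x 0) := (mul_pos_iff_of_pos_left h0).1 h3
  rcases mul_pos_iff.1 h4 with h | h
  · exact ⟨by linarith [h.1], by linarith [h.2]⟩
  · linarith [h.1, h.2]

theorem isOpen_slimDomain : IsOpen (slimDomain n c K) := by
  have h1 : IsOpen {x : Fin n → ℝ | axisDistSq x < c * (x 0 * (x 0 - 1) * (K - x 0))} :=
    isOpen_lt contDiff_axisDistSq.continuous (by fun_prop)
  exact isOpen_halfSpace.inter h1

/-- Dividing by the height, the condition reads `|y|²/x₀ < c (x₀ - 1)(K - x₀)`, with `y` the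
horizontal part. The left side is jointly convex where `x₀ > 0`, the right side concave. -/
theorem convex_slimDomain (hc : 0 < c) : Convex ℝ (slimDomain n c K) := by
  rintro x ⟨hx0, hx⟩ y ⟨hy0, hy⟩ a b ha hb hab
  have e : ∀ i, (a • x + b • y) i = a * x i + b * y i := fun i => rfl
  have hz0 : 0 < a * x 0 + b * y 0 := by
    rcases ha.eq_or_lt with rfl | ha'
    · have : b = 1 := by linarith
      subst this; simpa using hy0
    · positivity
  refine ⟨hz0, ?_⟩
  have hx' : axisDistSq x / x 0 < c * ((x 0 - 1) * (K - x 0)) := by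
    rw [div_lt_iff₀ hx0]; linarith
  have hy' : axisDistSq y / y 0 < c * ((y 0 - 1) * (K - y 0)) := by
    rw [div_lt_iff₀ hy0]; linarith
  have h1 : axisDistSq (a • x + b • y) ≤
      (a * (axisDistSq x / x 0) + b * (axisDistSq y / y 0)) * (a * x 0 + b * y 0) := by
    have e2 : (a * (axisDistSq x / x 0) + b * (axisDistSq y / y 0)) * (a * x 0 + b * y 0) =
        ∑ i ∈ Finset.univ.erase 0, (a * (x i ^ 2 / x 0) + b * (y i ^ 2 / y 0)) *
          (a * x 0 + b * y 0) := by
      rw [axisDistSq, axisDistSq, Finset.sum_div, Finset.sum_div, Finset.mul_sum, Finset.mul_sum,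
        ← Finset.sum_add_distrib, Finset.sum_mul]
    rw [e2]
    refine Finset.sum_le_sum fun i _ => ?_
    rw [e]
    have e3 : (a * (x i ^ 2 / x 0) + b * (y i ^ 2 / y 0)) * (a * x 0 + b * y 0) -
        (a * x i + b * y i) ^ 2 = a * b * (x i * y 0 - y i * x 0) ^ 2 / (x 0 * y 0) := by
      field_simp
      ring
    have e4 : 0 ≤ a * b * (x i * y 0 - y i * x 0) ^ 2 / (x 0 * y 0) := by positivity
    linarith
  have h2 : a * (axisDistSq x / x 0) + b * (axisDistSq y / y 0) <
      a * (c * ((x 0 - 1) * (K - x 0))) + b * (c * ((y 0 - 1) * (K - y 0))) := by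
    rcases ha.eq_or_lt with rfl | ha'
    · have : b = 1 := by linarith
      subst this; simpa using hy'
    · exact add_lt_add_of_lt_of_le (by gcongr) (by gcongr)
  have h3 : a * (c * ((x 0 - 1) * (K - x 0))) + b * (c * ((y 0 - 1) * (K - y 0))) ≤
      c * ((a * x 0 + b * y 0 - 1) * (K - (a * x 0 + b * y 0))) := by
    have hb' : b = 1 - a := by linarith
    subst hb'
    have : 0 ≤ c * (a * (1 - a) * (x 0 - y 0) ^ 2) := by positivity
    nlinarith
  rw [e]
  calc axisDistSq (a • x + b • y) ≤ _ := h1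
    _ < c * ((a * x 0 + b * y 0 - 1) * (K - (a * x 0 + b * y 0))) * (a * x 0 + b * y 0) := by
        gcongr
        exact h2.trans_le h3
    _ = _ := by ring

/-- With `c = d²/K` this says `|x_i| ≤ d x₀` for `i ≠ 0`: the domain has hyperbolic width governed
by `d` along its whole length. -/
theorem axisDistSq_le_of_mem (hc : 0 < c) (hK : 1 < K) {x : Fin n → ℝ}
    (hx : x ∈ slimDomain n c K) : axisDistSq x ≤ c * K * x 0 ^ 2 := by
  obtain ⟨h1, h2⟩ := mem_Ioo_of_mem_slimDomain hc hK hx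
  refine hx.2.le.trans ?_
  rw [mul_assoc c K]
  refine mul_le_mul_of_nonneg_left ?_ hc.le
  have : (x 0 - 1) * (K - x 0) ≤ x 0 * K := by
    apply mul_le_mul <;> linarith
  nlinarith

theorem norm_le_of_mem_slimDomain (hc : 0 < c) (hK : 1 < K) {x : Fin n → ℝ}
    (hx : x ∈ slimDomain n c K) : ‖x‖ ≤ K + c * K ^ 3 := by
  obtain ⟨h1, h2⟩ := mem_Ioo_of_mem_slimDomain hc hK hx
  have hR : 0 < c * K ^ 3 := by positivity
  rw [pi_norm_le_iff_of_nonneg (by positivity)]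
  intro i
  rw [Real.norm_eq_abs]
  by_cases hi : i = 0
  · subst hi
    rw [abs_of_pos (by linarith)]
    linarith
  · have h3 := (sq_le_axisDistSq x hi).trans (axisDistSq_le_of_mem hc hK hx)
    have h4 : c * K * x 0 ^ 2 ≤ c * K ^ 3 := by
      have : x 0 ^ 2 ≤ K ^ 2 := by gcongr
      calc c * K * x 0 ^ 2 ≤ c * K * K ^ 2 := by gcongr
        _ = _ := by ring
    refine abs_le_of_sq_le_sq (h3.trans (h4.trans ?_)) (by positivity)
    nlinarith

/-- Besides nonemptiness, a point off the hyperplane `x_k = 0` at prescribed height shows that a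
trial function `x_k ψ(x₀)` does not vanish identically. -/
theorem slimDomain_nonempty (hc : 0 < c) {t : ℝ} (ht1 : 1 < t) (htK : t < K) {k : Fin n}
    (hk : k ≠ 0) : ∃ x ∈ slimDomain n c K, x 0 = t ∧ x k ≠ 0 := by
  have hpos : 0 < c * (t * (t - 1) * (K - t)) := by
    have h1 : 0 < t - 1 := by linarith
    have h2 : 0 < K - t := by linarith
    have h3 : 0 < t := by linarith
    positivity
  set s := Real.sqrt (c * (t * (t - 1) * (K - t)) / 2) with hs
  have hs0 : 0 < s := Real.sqrt_pos.2 (by positivity)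
  have hss : s ^ 2 = c * (t * (t - 1) * (K - t)) / 2 := Real.sq_sqrt (by positivity)
  let x : Fin n → ℝ := fun i => if i = 0 then t else if i = k then s else 0
  have hx0 : x 0 = t := by simp [x]
  have hxk : x k = s := by simp [x, hk]
  refine ⟨x, ⟨by rw [hx0]; linarith, ?_⟩, hx0, by rw [hxk]; exact hs0.ne'⟩
  have : axisDistSq x = s ^ 2 := by
    rw [axisDistSq, Finset.sum_eq_single k]
    · rw [hxk]
    · intro i hi hik
      simp [x, hik, (Finset.mem_erase.1 hi).1]
    · simp [hk]
  rw [this, hx0, hss]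
  linarith

theorem isStripDomain_slimDomain (hn : 2 ≤ n) (hc : 0 < c) (hK : 1 < K) :
    IsStripDomain (slimDomain n c K) K where
  isOpen := isOpen_slimDomain
  convex := convex_slimDomain hc
  isBounded := isBounded_iff_forall_norm_le.2
    ⟨_, fun _ hx => norm_le_of_mem_slimDomain hc hK hx⟩
  nonempty := by
    obtain ⟨x, hx, -⟩ := slimDomain_nonempty (n := n) (K := K) (t := (1 + K) / 2) hc (by linarith)
      (by linarith) (k := ⟨1, by omega⟩) (by simp [Fin.ext_iff])
    exact ⟨x, hx⟩
  one_lt := fun _ hx => (mem_Ioo_of_mem_slimDomain hc hK hx).1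
  lt := fun _ hx => (mem_Ioo_of_mem_slimDomain hc hK hx).2

/-- A bounded convex open set in a strip is a bounded domain of hyperbolic space. -/
theorem IsStripDomain.isBoundedDomain {Ω : Set (Fin n → ℝ)} (hΩ : IsStripDomain Ω K) :
    IsBoundedDomain (halfSpace n) (hyperbolicMetric n) Ω where
  isOpen := hΩ.isOpen
  isConnected := ⟨hΩ.nonempty, hΩ.convex.isPreconnected⟩
  subset := hΩ.pos
  bounded := by
    obtain ⟨R, hR⟩ := hΩ.isBounded.exists_norm_le
    set B : ℝ := Real.sqrt (∑ _i : Fin n, (2 * R) ^ 2) with hB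
    refine ⟨⟨B, Real.sqrt_nonneg _⟩, fun x hx y hy => ?_⟩
    -- The Euclidean segment is used as the curve: it stays in `Ω`, where `x₀ > 1` makes hyperbolic
    -- length at most Euclidean length.
    have hseg : ∀ t ∈ Set.Icc (0 : ℝ) 1, x + t • (y - x) ∈ Ω := fun t ht =>
      hΩ.convex.add_smul_sub_mem hx hy ht
    refine (iInf₂_le (fun t : ℝ => x + t • (y - x)) ⟨by fun_prop, by simp, by simp,
      fun t ht => hΩ.pos _ (hseg t ht)⟩).trans ?_
    have hder : ∀ t : ℝ, deriv (fun t : ℝ => x + t • (y - x)) t = y - x := fun t => by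
      have : HasDerivAt (fun t : ℝ => x + t • (y - x)) (y - x) t := by
        simpa using ((hasDerivAt_id t).smul_const (y - x)).const_add x
      exact this.deriv
    calc _ ≤ ∫⁻ t in Set.Icc (0 : ℝ) 1, ENNReal.ofReal B := by
          refine setLIntegral_mono' measurableSet_Icc fun t ht => ?_
          apply ENNReal.ofReal_le_ofReal
          apply Real.sqrt_le_sqrt
          rw [hder]
          have hz := hΩ.one_lt _ (hseg t ht)
          rw [hyperbolicMetric, Matrix.smul_mulVec, Matrix.one_mulVec, dotProduct]
          refine Finset.sum_le_sum fun i _ => ?_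
          have h1 : |(y - x) i| ≤ 2 * R := by
            have h2 := norm_le_pi_norm (y - x) i
            have h3 := norm_sub_le y x
            rw [Real.norm_eq_abs] at h2
            linarith [hR x hx, hR y hy]
          have h2 : (y - x) i ^ 2 ≤ (2 * R) ^ 2 := sq_le_sq' (by linarith [neg_abs_le ((y - x) i)])
            ((le_abs_self _).trans h1)
          rw [Pi.smul_apply, smul_eq_mul]
          have h3 : (((x + t • (y - x)) 0) ^ 2)⁻¹ ≤ 1 :=
            inv_le_one_of_one_le₀ (one_le_pow₀ hz.le)
          calc (y - x) i * ((((x + t • (y - x)) 0) ^ 2)⁻¹ * (y - x) i)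
              = (((x + t • (y - x)) 0) ^ 2)⁻¹ * (y - x) i ^ 2 := by ring
            _ ≤ 1 * (y - x) i ^ 2 := by gcongr
            _ ≤ _ := by linarith
      _ = ENNReal.ofReal B := by simp
      _ = _ := by
          rw [ENNReal.ofReal, Real.toNNReal_of_nonneg (Real.sqrt_nonneg _)]
          rfl

/-- The defining function has no critical point on the boundary. Off the axis, it grows at first
order under horizontal scaling; on the axis, the boundary points have height `1` or `K`, which are
simple roots of the cubic, so the vertical derivative is nonzero. -/
theorem hasC1Boundary_slimDomain (hc : 0 < c) (hK : 1 < K) :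
    HasC1Boundary (slimDomain n c K) := by
  intro p hp
  set F : (Fin n → ℝ) → ℝ := fun x => axisDistSq x - c * (x 0 * (x 0 - 1) * (K - x 0)) with hF
  have hFs : ContDiff ℝ ∞ F := by
    refine contDiff_axisDistSq.sub ?_
    fun_prop
  have hp1 : 1 ≤ p 0 := by
    have h1 : closure (slimDomain n c K) ⊆ {x : Fin n → ℝ | 1 ≤ x 0} :=
      closure_minimal (fun x hx => (mem_Ioo_of_mem_slimDomain hc hK hx).1.le)
        (isClosed_le continuous_const (continuous_apply 0))
    exact h1 hp.1
  have hp0 : 0 < p 0 := by linarith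
  have hFp : F p = 0 := by
    have h1 : closure (slimDomain n c K) ⊆ {x : Fin n → ℝ | F x ≤ 0} :=
      closure_minimal (fun x hx => by
        have := hx.2
        simp only [Set.mem_ofPred_eq, hF]
        linarith) (isClosed_le hFs.continuous continuous_const)
    refine le_antisymm (h1 hp.1) (not_lt.1 fun hlt => hp.2 ?_)
    rw [isOpen_slimDomain.interior_eq]
    refine ⟨hp0, ?_⟩
    simp only [hF] at hlt
    linarith
  refine ⟨halfSpace n, isOpen_halfSpace, hp0, F, (hFs.of_le (by simp)).contDiffOn, ?_, ?_⟩
  · intro hz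
    have hline : ∀ v : Fin n → ℝ, HasDerivAt (fun t : ℝ => F (p + t • v)) 0 0 := by
      intro v
      have h1 : HasFDerivAt F (fderiv ℝ F p) (p + (0 : ℝ) • v) := by
        simpa using ((hFs.differentiable (by simp)) p).hasFDerivAt
      have h2 : HasDerivAt (fun t : ℝ => p + t • v) v 0 := by
        simpa using ((hasDerivAt_id (0 : ℝ)).smul_const v).const_add p
      have h3 := h1.comp_hasDerivAt (0 : ℝ) h2
      rw [hz] at h3
      exact h3
    by_cases hax : axisDistSq p = 0
    · have hzero : c * (p 0 * (p 0 - 1) * (K - p 0)) = 0 := by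
        have := hFp
        simp only [hF, hax] at this
        linarith
      have hv := hline (Pi.single 0 1)
      have hFl : (fun t : ℝ => F (p + t • Pi.single 0 1)) = fun t =>
          - (c * ((p 0 + t) * (p 0 + t - 1) * (K - (p 0 + t)))) := by
        ext t
        have e1 : axisDistSq (p + t • (Pi.single 0 1 : Fin n → ℝ)) = axisDistSq p := by
          refine Finset.sum_congr rfl fun i hi => ?_
          simp [(Finset.mem_erase.1 hi).1]
        simp only [hF, e1, hax]
        simp
      rw [hFl] at hv
      have hd : HasDerivAt (fun t : ℝ => - (c * ((p 0 + t) * (p 0 + t - 1) * (K - (p 0 + t)))))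
          (-(c * ((1 * (p 0 + 0 - 1) + (p 0 + 0) * 1) * (K - (p 0 + 0)) +
            (p 0 + 0) * (p 0 + 0 - 1) * (-1)))) 0 := by
        have d1 : HasDerivAt (fun t : ℝ => p 0 + t) 1 0 := (hasDerivAt_id (0 : ℝ)).const_add _
        exact (((d1.fun_mul (d1.sub_const 1)).fun_mul (d1.const_sub K)).const_mul c).fun_neg
      have huniq := hd.unique hv
      have h4 : (p 0 - 1) * (K - p 0) = 0 := by
        have := hzero
        rcases mul_eq_zero.1 this with h | h
        · exact absurd h hc.ne'
        · rw [mul_assoc] at h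
          exact (mul_eq_zero.1 h).resolve_left hp0.ne'
      have h5 : (p 0 + p 0 - 1) * (K - p 0) - p 0 * (p 0 - 1) = 0 := by
        have h6 : c * ((p 0 + p 0 - 1) * (K - p 0) - p 0 * (p 0 - 1)) = 0 := by linarith
        exact (mul_eq_zero.1 h6).resolve_left hc.ne'
      rcases mul_eq_zero.1 h4 with h | h
      · have : p 0 = 1 := by linarith
        rw [this] at h5
        linarith
      · have : p 0 = K := by linarith
        rw [this] at h5
        nlinarith
    · have hv := hline (fun i => if i = 0 then 0 else p i)
      have hFl : (fun t : ℝ => F (p + t • fun i => if i = 0 then 0 else p i)) = fun t =>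
          (1 + t) ^ 2 * axisDistSq p - c * (p 0 * (p 0 - 1) * (K - p 0)) := by
        ext t
        have e1 : axisDistSq (p + t • (fun i => if i = 0 then 0 else p i)) =
            (1 + t) ^ 2 * axisDistSq p := by
          rw [axisDistSq, axisDistSq, Finset.mul_sum]
          refine Finset.sum_congr rfl fun i hi => ?_
          simp [(Finset.mem_erase.1 hi).1]
          ring
        simp only [hF, e1]
        simp
      rw [hFl] at hv
      have hd : HasDerivAt (fun t : ℝ => (1 + t) ^ 2 * axisDistSq p -
          c * (p 0 * (p 0 - 1) * (K - p 0))) (2 * axisDistSq p) 0 := by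
        have d1 : HasDerivAt (fun t : ℝ => 1 + t) 1 0 := (hasDerivAt_id (0 : ℝ)).const_add _
        have d2 := ((d1.fun_pow 2).mul_const (axisDistSq p)).sub_const
          (c * (p 0 * (p 0 - 1) * (K - p 0)))
        simpa using d2
      have huniq := hd.unique hv
      apply hax
      linarith
  · ext x
    simp only [slimDomain, halfSpace, Set.mem_inter_iff, Set.mem_ofPred_eq, hF]
    constructor
    · rintro ⟨⟨h1, h2⟩, -⟩
      exact ⟨h1, by linarith⟩
    · rintro ⟨h1, h2⟩
      exact ⟨⟨h1, by linarith⟩, h1⟩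

end Domain

/-! ### The volume of the slim domain -/

section Volume

/-- The volume of the Euclidean unit ball of `ℝᵐ`. -/
def unitBallVolume (m : ℕ) : ENNReal := volume {y : Fin m → ℝ | ∑ i, y i ^ 2 < 1}

theorem unitBallVolume_pos (m : ℕ) : 0 < unitBallVolume m := by
  have ho : IsOpen {y : Fin m → ℝ | ∑ i, y i ^ 2 < 1} :=
    isOpen_lt (by fun_prop) continuous_const
  exact ho.measure_pos volume ⟨0, by simp⟩

theorem unitBallVolume_lt_top (m : ℕ) : unitBallVolume m < ⊤ := by
  refine Bornology.IsBounded.measure_lt_top (isBounded_iff_forall_norm_le.2 ⟨1, fun y hy => ?_⟩)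
  rw [pi_norm_le_iff_of_nonneg zero_le_one]
  intro i
  have h1 : y i ^ 2 ≤ ∑ i, y i ^ 2 :=
    Finset.single_le_sum (f := fun i => y i ^ 2) (fun _ _ => sq_nonneg _) (Finset.mem_univ i)
  have h2 : ∑ i, y i ^ 2 < 1 := hy
  rw [Real.norm_eq_abs]
  exact (abs_le_one_iff_mul_self_le_one).2 (by nlinarith)

open scoped Pointwise in
theorem volume_sum_sq_lt (m : ℕ) {s : ℝ} (hs : 0 < s) :
    volume {y : Fin m → ℝ | ∑ i, y i ^ 2 < s} =
      ENNReal.ofReal (Real.sqrt s ^ m) * unitBallVolume m := by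
  have hr : 0 < Real.sqrt s := Real.sqrt_pos.2 hs
  have e : {y : Fin m → ℝ | ∑ i, y i ^ 2 < s} =
      Real.sqrt s • {y : Fin m → ℝ | ∑ i, y i ^ 2 < 1} := by
    ext y
    rw [Set.mem_smul_set_iff_inv_smul_mem₀ hr.ne']
    simp only [Set.mem_ofPred_eq, Pi.smul_apply, smul_eq_mul, mul_pow, ← Finset.mul_sum, inv_pow,
      Real.sq_sqrt hs.le]
    rw [inv_mul_lt_iff₀ hs, mul_one]
  rw [e, Measure.addHaar_smul, abs_of_nonneg (by positivity)]
  simp [unitBallVolume]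

variable {m : ℕ} {c K : ℝ}

theorem axisDistSq_eq_sum (x : Fin (m + 1) → ℝ) : axisDistSq x = ∑ i : Fin m, x i.succ ^ 2 := by
  have h1 := Finset.add_sum_erase Finset.univ (fun i => x i ^ 2) (Finset.mem_univ 0)
  rw [Fin.sum_univ_succ] at h1
  rw [axisDistSq]
  linarith

/-- Fubini in the height: the slice at height `t` is a Euclidean ball of dimension `m`, weighted by
the constant `t⁻⁽ᵐ⁺¹⁾`. -/
theorem riemVolume_slab (hc : 0 < c) {A : Set ℝ} (hA : MeasurableSet A)
    (hAK : A ⊆ Set.Ioo 1 K) :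
    riemVolume (hyperbolicMetric (m + 1)) (slimDomain (m + 1) c K ∩ {x | x 0 ∈ A}) =
      unitBallVolume m * ∫⁻ t in A, ENNReal.ofReal ((t ^ (m + 1))⁻¹ *
        Real.sqrt (c * (t * (t - 1) * (K - t))) ^ m) := by
  have hS : MeasurableSet (slimDomain (m + 1) c K ∩ {x | x 0 ∈ A}) :=
    isOpen_slimDomain.measurableSet.inter ((measurable_pi_apply 0) hA)
  set T : Set (ℝ × (Fin m → ℝ)) :=
    {q | q.1 ∈ A ∧ ∑ i, q.2 i ^ 2 < c * (q.1 * (q.1 - 1) * (K - q.1))} with hT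
  have hTm : MeasurableSet T := by
    have h1 : MeasurableSet {q : ℝ × (Fin m → ℝ) |
        ∑ i, q.2 i ^ 2 < c * (q.1 * (q.1 - 1) * (K - q.1))} :=
      measurableSet_lt (by fun_prop) (by fun_prop)
    exact (measurable_fst hA).inter h1
  set H : ℝ × (Fin m → ℝ) → ENNReal :=
    T.indicator fun q => ENNReal.ofReal ((q.1 ^ (m + 1))⁻¹) with hH
  have hHm : Measurable H := Measurable.indicator (by fun_prop) hTm
  have hmem : ∀ x : Fin (m + 1) → ℝ, x ∈ slimDomain (m + 1) c K ∩ {x | x 0 ∈ A} ↔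
      MeasurableEquiv.piFinSuccAbove (fun _ => ℝ) 0 x ∈ T := by
    intro x
    simp only [hT, slimDomain, Set.mem_inter_iff, Set.mem_ofPred_eq, axisDistSq_eq_sum,
      MeasurableEquiv.piFinSuccAbove_apply, Fin.insertNthEquiv_zero, Fin.consEquiv_symm_apply]
    constructor
    · rintro ⟨⟨h1, h2⟩, h3⟩
      exact ⟨h3, h2⟩
    · rintro ⟨h1, h2⟩
      exact ⟨⟨by linarith [(hAK h1).1], h2⟩, h1⟩
  calc riemVolume (hyperbolicMetric (m + 1)) (slimDomain (m + 1) c K ∩ {x | x 0 ∈ A})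
      = ∫⁻ x in slimDomain (m + 1) c K ∩ {x | x 0 ∈ A},
          ENNReal.ofReal (Real.sqrt (hyperbolicMetric (m + 1) x).det) := by
        rw [riemVolume, withDensity_apply _ hS]
    _ = ∫⁻ x : Fin (m + 1) → ℝ, H (MeasurableEquiv.piFinSuccAbove (fun _ => ℝ) 0 x) := by
        rw [← lintegral_indicator hS]
        refine lintegral_congr fun x => ?_
        by_cases hx : x ∈ slimDomain (m + 1) c K ∩ {x | x 0 ∈ A}
        · rw [Set.indicator_of_mem hx, hH, Set.indicator_of_mem ((hmem x).1 hx),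
            sqrt_det_hyperbolicMetric hx.1.1]
          rfl
        · rw [Set.indicator_of_notMem hx, hH,
            Set.indicator_of_notMem fun h => hx ((hmem x).2 h)]
    _ = ∫⁻ q, H q := (volume_preserving_piFinSuccAbove (fun _ => ℝ) 0).lintegral_comp hHm
    _ = ∫⁻ t, ∫⁻ y, H (t, y) := lintegral_prod _ hHm.aemeasurable
    _ = ∫⁻ t, A.indicator (fun t => unitBallVolume m * ENNReal.ofReal ((t ^ (m + 1))⁻¹ *
          Real.sqrt (c * (t * (t - 1) * (K - t))) ^ m)) t := by
        refine lintegral_congr fun t => ?_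
        by_cases ht : t ∈ A
        · obtain ⟨h1, h2⟩ := hAK ht
          have hpos : 0 < c * (t * (t - 1) * (K - t)) := by
            have h3 : 0 < t - 1 := by linarith
            have h4 : 0 < K - t := by linarith
            have h5 : 0 < t := by linarith
            positivity
          have ht0 : 0 < t := by linarith
          have hy : ∀ y : Fin m → ℝ, H (t, y) =
              {y : Fin m → ℝ | ∑ i, y i ^ 2 < c * (t * (t - 1) * (K - t))}.indicator
                (fun _ => ENNReal.ofReal ((t ^ (m + 1))⁻¹)) y := by
            intro y
            simp only [hH, hT, Set.indicator, Set.mem_ofPred_eq, ht, true_and]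
          simp_rw [hy]
          rw [Set.indicator_of_mem ht, lintegral_indicator_const, volume_sum_sq_lt m hpos,
            ENNReal.ofReal_mul (by positivity)]
          · ring
          · exact measurableSet_lt (by fun_prop) measurable_const
        · have hy : ∀ y : Fin m → ℝ, H (t, y) = 0 := fun y => by
            rw [hH, Set.indicator_of_notMem]
            exact fun h => ht h.1
          simp [hy, Set.indicator_of_notMem ht]
    _ = _ := by
        rw [lintegral_indicator hA, lintegral_const_mul' _ _ (unitBallVolume_lt_top m).ne]

/-- The density in the height variable of the volume of the slim domain, up to its width. -/
def heightDensity (m : ℕ) (K t : ℝ) : ℝ :=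
  (t ^ (m + 1))⁻¹ * Real.sqrt (t * (t - 1) * (K - t) / K) ^ m

theorem heightDensity_le (hK : 1 < K) {t : ℝ} (ht : t ∈ Set.Ioo 1 K) :
    heightDensity m K t ≤ t⁻¹ := by
  obtain ⟨h1, h2⟩ := ht
  have ht0 : 0 < t := by linarith
  have h3 : Real.sqrt (t * (t - 1) * (K - t) / K) ≤ t := by
    rw [Real.sqrt_le_left ht0.le, div_le_iff₀ (by linarith), mul_assoc]
    have : (t - 1) * (K - t) ≤ t * K := by apply mul_le_mul <;> linarith
    nlinarith
  calc heightDensity m K t ≤ (t ^ (m + 1))⁻¹ * t ^ m := by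
        rw [heightDensity]; gcongr
    _ = t⁻¹ := by
        rw [pow_succ]; field_simp

/-- For `2 ≤ t ≤ K/2` both `t - 1 ≥ t/2` and `K - t ≥ K/2`, so the slice has at least half the
maximal hyperbolic radius. -/
theorem le_heightDensity {t : ℝ} (ht : 2 ≤ t) (htK : t ≤ K / 2) :
    (2 ^ m)⁻¹ * t⁻¹ ≤ heightDensity m K t := by
  have ht0 : 0 < t := by linarith
  have hK : 0 < K := by linarith
  have h3 : t / 2 ≤ Real.sqrt (t * (t - 1) * (K - t) / K) := by
    apply Real.le_sqrt_of_sq_le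
    rw [le_div_iff₀ hK, mul_assoc]
    have : t / 2 * (K / 2) ≤ (t - 1) * (K - t) := by apply mul_le_mul <;> linarith
    nlinarith
  calc (2 ^ m)⁻¹ * t⁻¹ = (t ^ (m + 1))⁻¹ * (t / 2) ^ m := by
        rw [pow_succ, div_pow]; field_simp
    _ ≤ _ := by rw [heightDensity]; gcongr

theorem lintegral_Ioo_inv {a b : ℝ} (ha : 0 < a) (hab : a ≤ b) :
    ∫⁻ t in Set.Ioo a b, ENNReal.ofReal t⁻¹ = ENNReal.ofReal (Real.log (b / a)) := by
  have hb : 0 < b := ha.trans_le hab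
  have hi : IntervalIntegrable (fun t : ℝ => t⁻¹) volume a b := by
    refine ContinuousOn.intervalIntegrable (continuousOn_inv₀.mono ?_)
    intro t ht
    rw [Set.uIcc_of_le hab] at ht
    exact (ha.trans_le ht.1).ne'
  rw [← integral_inv_of_pos ha hb, intervalIntegral.integral_of_le hab, integral_Ioc_eq_integral_Ioo,
    ofReal_integral_eq_lintegral_ofReal]
  · exact ((intervalIntegrable_iff_integrableOn_Ioo_of_le hab).1 hi)
  · filter_upwards [ae_restrict_mem measurableSet_Ioo] with t ht
    exact (inv_pos.2 (ha.trans ht.1)).le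

theorem riemVolume_slab_eq (hK : 1 < K) {d : ℝ} (hd : 0 < d) {A : Set ℝ} (hA : MeasurableSet A)
    (hAK : A ⊆ Set.Ioo 1 K) :
    riemVolume (hyperbolicMetric (m + 1)) (slimDomain (m + 1) (d ^ 2 / K) K ∩ {x | x 0 ∈ A}) =
      unitBallVolume m * ENNReal.ofReal (d ^ m) *
        ∫⁻ t in A, ENNReal.ofReal (heightDensity m K t) := by
  rw [riemVolume_slab (by positivity) hA hAK, mul_assoc,
    ← lintegral_const_mul' _ _ ENNReal.ofReal_ne_top]
  congr 1
  refine lintegral_congr fun t => ?_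
  rw [← ENNReal.ofReal_mul (by positivity)]
  congr 1
  have : Real.sqrt (d ^ 2 / K * (t * (t - 1) * (K - t))) =
      d * Real.sqrt (t * (t - 1) * (K - t) / K) := by
    rw [show d ^ 2 / K * (t * (t - 1) * (K - t)) = d ^ 2 * (t * (t - 1) * (K - t) / K) by ring,
      Real.sqrt_mul (by positivity), Real.sqrt_sq hd.le]
  rw [this, heightDensity, mul_pow]
  ring

/-- For large `L` the width `d` of the slim domain of volume one over a geodesic segment of length
about `L` is small, and the volumes of its slabs are comparable with their heights. -/
theorem exists_width (hm : m ≠ 0) {η : ℝ} (hη : 0 < η) :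
    ∃ L₀ : ℝ, ∀ L, L₀ ≤ L → 0 < L → ∃ d E : ℝ, 0 < d ∧ d ≤ η ∧ 0 < E ∧
      riemVolume (hyperbolicMetric (m + 1))
        (slimDomain (m + 1) (d ^ 2 / (4 * Real.exp L)) (4 * Real.exp L)) = 1 ∧
      ∀ a b, 2 ≤ a → a ≤ b → b ≤ 2 * Real.exp L →
        ENNReal.ofReal (E * (2 ^ m)⁻¹ * Real.log (b / a)) ≤
          riemVolume (hyperbolicMetric (m + 1))
            (slimDomain (m + 1) (d ^ 2 / (4 * Real.exp L)) (4 * Real.exp L) ∩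
              {x | x 0 ∈ Set.Ioo a b}) ∧
        riemVolume (hyperbolicMetric (m + 1))
            (slimDomain (m + 1) (d ^ 2 / (4 * Real.exp L)) (4 * Real.exp L) ∩
              {x | x 0 ∈ Set.Ioo a b}) ≤ ENNReal.ofReal (E * Real.log (b / a)) := by
  set w : ℝ := (unitBallVolume m).toReal with hw
  have hw0 : 0 < w := ENNReal.toReal_pos (unitBallVolume_pos m).ne' (unitBallVolume_lt_top m).ne
  have hwe : unitBallVolume m = ENNReal.ofReal w :=
    (ENNReal.ofReal_toReal (unitBallVolume_lt_top m).ne).symm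
  -- Volume one forces `d ^ m = 1/(w I)` with `I ≥ 2⁻ᵐ L`, and `2 ^ m / (w L) ≤ η ^ m` from this
  -- threshold on.
  refine ⟨2 ^ m / (w * η ^ m), fun L hL hL0 => ?_⟩
  -- Then `K/2 = 2 exp L`, and the heights between `2` and `K/2`, where the slices are thick, have
  -- logarithmic length exactly `L`.
  set K : ℝ := 4 * Real.exp L with hKdef
  have hexp : 1 < Real.exp L := Real.one_lt_exp_iff.2 hL0
  have hK : 1 < K := by rw [hKdef]; linarith
  have hlow : ∀ a b, 2 ≤ a → a ≤ b → b ≤ 2 * Real.exp L →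
      ENNReal.ofReal ((2 ^ m)⁻¹ * Real.log (b / a)) ≤
        ∫⁻ t in Set.Ioo a b, ENNReal.ofReal (heightDensity m K t) := by
    intro a b ha hab hb
    rw [ENNReal.ofReal_mul (by positivity), ← lintegral_Ioo_inv (by linarith) hab,
      ← lintegral_const_mul' _ _ ENNReal.ofReal_ne_top]
    refine setLIntegral_mono' measurableSet_Ioo fun t ht => ?_
    rw [← ENNReal.ofReal_mul (by positivity)]
    exact ENNReal.ofReal_le_ofReal (le_heightDensity (by linarith [ht.1])
      (by rw [hKdef]; linarith [ht.2]))
  have hupp : ∀ a b, 1 ≤ a → a ≤ b → b ≤ K →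
      ∫⁻ t in Set.Ioo a b, ENNReal.ofReal (heightDensity m K t) ≤
        ENNReal.ofReal (Real.log (b / a)) := by
    intro a b ha hab hb
    rw [← lintegral_Ioo_inv (by linarith) hab]
    exact setLIntegral_mono' measurableSet_Ioo fun t ht =>
      ENNReal.ofReal_le_ofReal (heightDensity_le hK ⟨by linarith [ht.1], by linarith [ht.2]⟩)
  set I : ENNReal := ∫⁻ t in Set.Ioo 1 K, ENNReal.ofReal (heightDensity m K t) with hI
  have hIL : ENNReal.ofReal ((2 ^ m)⁻¹ * L) ≤ I := by
    have h1 := hlow 2 (2 * Real.exp L) le_rfl (by linarith) le_rfl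
    rw [mul_div_cancel_left₀ _ (by norm_num : (2 : ℝ) ≠ 0), Real.log_exp] at h1
    refine h1.trans (lintegral_mono_set (Set.Ioo_subset_Ioo (by norm_num) ?_))
    rw [hKdef]; linarith
  have hIfin : I ≠ ⊤ := ne_top_of_le_ne_top ENNReal.ofReal_ne_top (hupp 1 K le_rfl hK.le le_rfl)
  have hIe : I = ENNReal.ofReal I.toReal := (ENNReal.ofReal_toReal hIfin).symm
  have hIL' : (2 ^ m)⁻¹ * L ≤ I.toReal := (ENNReal.ofReal_le_iff_le_toReal hIfin).1 hIL
  have hI0 : 0 < I.toReal := lt_of_lt_of_le (by positivity) hIL'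
  -- The volume is proportional to `d ^ m`, so normalising it takes an `m`-th root; this uses `m ≠
  -- 0`.
  obtain ⟨d, hd0, hd⟩ : ∃ d : ℝ, 0 < d ∧ d ^ m = (w * I.toReal)⁻¹ :=
    ⟨((w * I.toReal)⁻¹) ^ ((m : ℝ)⁻¹), by positivity, Real.rpow_inv_natCast_pow (by positivity) hm⟩
  have hslab : ∀ A : Set ℝ, MeasurableSet A → A ⊆ Set.Ioo 1 K →
      riemVolume (hyperbolicMetric (m + 1)) (slimDomain (m + 1) (d ^ 2 / K) K ∩ {x | x 0 ∈ A}) =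
        ENNReal.ofReal (w * d ^ m) * ∫⁻ t in A, ENNReal.ofReal (heightDensity m K t) := by
    intro A hA hAK
    rw [riemVolume_slab_eq hK hd0 hA hAK, hwe, ENNReal.ofReal_mul hw0.le]
  refine ⟨d, w * d ^ m, hd0, ?_, by positivity, ?_, ?_⟩
  · refine le_of_pow_le_pow_left₀ hm hη.le ?_
    rw [hd, inv_le_comm₀ (by positivity) (by positivity)]
    have h1 : 2 ^ m / (w * η ^ m) ≤ 2 ^ m * I.toReal := by
      refine hL.trans ?_
      rwa [inv_mul_le_iff₀ (by positivity)] at hIL'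
    rw [div_le_iff₀ (by positivity)] at h1
    rw [inv_le_iff_one_le_mul₀ (by positivity)]
    have h2 : (2 : ℝ) ^ m * 1 ≤ 2 ^ m * (w * I.toReal * η ^ m) := by linarith
    exact le_of_mul_le_mul_left h2 (by positivity)
  · have h1 : slimDomain (m + 1) (d ^ 2 / K) K =
        slimDomain (m + 1) (d ^ 2 / K) K ∩ {x | x 0 ∈ Set.Ioo 1 K} := by
      refine (Set.inter_eq_left.2 fun x hx => ?_).symm
      exact mem_Ioo_of_mem_slimDomain (by positivity) hK hx
    rw [h1, hslab _ measurableSet_Ioo le_rfl, ← hI, hIe, ← ENNReal.ofReal_mul (by positivity), hd]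
    rw [show w * (w * I.toReal)⁻¹ * I.toReal = 1 by field_simp]
    simp
  · intro a b ha hab hb
    have hsub : Set.Ioo a b ⊆ Set.Ioo 1 K :=
      Set.Ioo_subset_Ioo (by linarith) (by rw [hKdef]; linarith)
    rw [hslab _ measurableSet_Ioo hsub, mul_assoc, ENNReal.ofReal_mul (by positivity),
      ENNReal.ofReal_mul (p := w * d ^ m) (by positivity)]
    exact ⟨mul_le_mul_right (hlow a b ha hab hb) _,
      mul_le_mul_right (hupp a b (by linarith) hab (by rw [hKdef]; linarith)) _⟩

end Volume

/-! ### Trial functions odd across a totally geodesic hyperplane -/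

section Trial

variable {n : ℕ} [NeZero n]

theorem pd_mul_comp_zero {i k : Fin n} {f : ℝ → ℝ} {f' : ℝ} {x : Fin n → ℝ}
    (h : HasDerivAt f f' (x 0)) :
    pd i (fun y => y k * f (y 0)) x =
      (if i = 0 then x k * f' else 0) + (if i = k then f (x 0) else 0) := by
  have h1 : HasFDerivAt (fun y : Fin n → ℝ => y 0)
    (ContinuousLinearMap.proj (R := ℝ) (φ := fun _ : Fin n => ℝ) 0) x := hasFDerivAt_apply 0 x
  have h2 : HasFDerivAt (fun y : Fin n → ℝ => y k)
    (ContinuousLinearMap.proj (R := ℝ) (φ := fun _ : Fin n => ℝ) k) x := hasFDerivAt_apply k x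
  have h3 := h2.fun_mul (h.comp_hasFDerivAt x h1)
  rw [pd, show (fun y : Fin n → ℝ => y k * f (y 0)) = fun y => y k * (f ∘ fun y => y 0) y from rfl,
    h3.fderiv]
  by_cases hi : i = 0 <;> by_cases hk : i = k <;> simp [hi, hk, Pi.single_apply, eq_comm]

variable {ψ ψ₁ ψ₂ : ℝ → ℝ} {k : Fin n} {x : Fin n → ℝ}

theorem pd_trial (h₁ : ∀ t, 0 < t → HasDerivAt ψ (ψ₁ t) t) (hx : 0 < x 0) (i : Fin n) :
    pd i (fun y => y k * ψ (y 0)) x =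
      (if i = 0 then x k * ψ₁ (x 0) else 0) + (if i = k then ψ (x 0) else 0) :=
  pd_mul_comp_zero (h₁ _ hx)

theorem pd_pd_trial (h₁ : ∀ t, 0 < t → HasDerivAt ψ (ψ₁ t) t)
    (h₂ : ∀ t, 0 < t → HasDerivAt ψ₁ (ψ₂ t) t) (hk : k ≠ 0) (hx : 0 < x 0) (i j : Fin n) :
    pd i (pd j fun y => y k * ψ (y 0)) x =
      (if j = 0 then (if i = 0 then x k * ψ₂ (x 0) else 0) + (if i = k then ψ₁ (x 0) else 0)
        else 0) + (if j = k then if i = 0 then ψ₁ (x 0) else 0 else 0) := by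
  have hev : pd j (fun y : Fin n → ℝ => y k * ψ (y 0)) =ᶠ[𝓝 x] fun y =>
      (if j = 0 then y k * ψ₁ (y 0) else 0) + (if j = k then ψ (y 0) else 0) := by
    filter_upwards [isOpen_halfSpace.mem_nhds hx] with y hy
    exact pd_trial h₁ hy j
  rw [pd_congr hev]
  by_cases hj : j = 0
  · have hjk : j ≠ k := fun h => hk (h ▸ hj)
    simp only [hj, if_true, if_neg (hj ▸ hjk : (0 : Fin n) ≠ k), add_zero]
    exact pd_mul_comp_zero (h₂ _ hx)
  · by_cases hjk : j = k
    · simp only [if_neg hj, if_pos hjk, zero_add]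
      exact pd_comp_zero (h₁ _ hx)
    · simp [hj, hjk, pd]

/-- For `ψ(t) = 1/t` the mixed terms `ψ₁ + ψ/t` vanish and the rest is `(x_k/x₀) g`, that is, `D²f =
f g`. For general `ψ` the mixed terms measure the failure of this identity. -/
theorem hessian_trial (h₁ : ∀ t, 0 < t → HasDerivAt ψ (ψ₁ t) t)
    (h₂ : ∀ t, 0 < t → HasDerivAt ψ₁ (ψ₂ t) t) (hk : k ≠ 0) (hx : 0 < x 0) (i j : Fin n) :
    hessian (hyperbolicMetric n) (fun y => y k * ψ (y 0)) x i j =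
      (if i = 0 then if j = 0 then x k * (ψ₂ (x 0) + (x 0)⁻¹ * ψ₁ (x 0)) else 0 else 0) +
      (if i = 0 then if j = k then ψ₁ (x 0) + (x 0)⁻¹ * ψ (x 0) else 0 else 0) +
      (if i = k then if j = 0 then ψ₁ (x 0) + (x 0)⁻¹ * ψ (x 0) else 0 else 0) +
      (if i = j then if i = 0 then 0 else -(x k * (x 0)⁻¹ * ψ₁ (x 0)) else 0) := by
  rw [hessian_hyperbolicMetric hx.ne', pd_pd_trial h₁ h₂ hk hx]
  simp only [pd_trial h₁ hx]
  by_cases hi : i = 0 <;> by_cases hj : j = 0 <;> by_cases hik : i = k <;> by_cases hjk : j = k <;>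
    by_cases hij : i = j <;> grind

theorem jetOf_trial_eq_zero (h₁ : ∀ t, 0 < t → HasDerivAt ψ (ψ₁ t) t)
    (h₂ : ∀ t, 0 < t → HasDerivAt ψ₁ (ψ₂ t) t) (hk : k ≠ 0) (hx : 0 < x 0)
    (z : ψ (x 0) = 0) (z₁ : ψ₁ (x 0) = 0) (z₂ : ψ₂ (x 0) = 0) (a : JetIndex n) :
    jetOf (fun y => y k * ψ (y 0)) a x = 0 := by
  rcases a with _ | i | ⟨i, j⟩
  · simp [jetOf, jetComp, z]
  · simp [jetOf, jetComp, differential, pd_trial h₁ hx, z, z₁]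
  · simp [jetOf, jetComp, hessian_trial h₁ h₂ hk hx, z, z₁, z₂]

/-- The density of the Neumann form at a trial function. -/
theorem neumannDensity_trial (h₁ : ∀ t, 0 < t → HasDerivAt ψ (ψ₁ t) t)
    (h₂ : ∀ t, 0 < t → HasDerivAt ψ₁ (ψ₂ t) t) (hk : k ≠ 0) (hx : 0 < x 0) :
    ∑ ij : Fin n × Fin n, jetOf (fun y => y k * ψ (y 0)) (.inr (.inr ij)) x *
        jetOf (fun y => y k * ψ (y 0)) (.inr (.inr ij)) x -
      ((n : ℝ) - 1) * ∑ i : Fin n, jetOf (fun y => y k * ψ (y 0)) (.inr (.inl i)) x *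
        jetOf (fun y => y k * ψ (y 0)) (.inr (.inl i)) x =
      x 0 ^ 4 * (x k ^ 2 * (ψ₂ (x 0) + (x 0)⁻¹ * ψ₁ (x 0)) ^ 2 +
        2 * (ψ₁ (x 0) + (x 0)⁻¹ * ψ (x 0)) ^ 2) - ((n : ℝ) - 1) * (x 0 ^ 2 * ψ (x 0) ^ 2) := by
  have hk' : (0 : Fin n) ≠ k := hk.symm
  have e1 : ∑ i : Fin n, jetOf (fun y => y k * ψ (y 0)) (.inr (.inl i)) x *
      jetOf (fun y => y k * ψ (y 0)) (.inr (.inl i)) x =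
      x 0 ^ 2 * ((x k * ψ₁ (x 0)) ^ 2 + ψ (x 0) ^ 2) := by
    have h : ∀ i : Fin n, jetOf (fun y => y k * ψ (y 0)) (.inr (.inl i)) x *
        jetOf (fun y => y k * ψ (y 0)) (.inr (.inl i)) x =
        x 0 ^ 2 * ((if i = 0 then (x k * ψ₁ (x 0)) ^ 2 else 0) +
          (if i = k then ψ (x 0) ^ 2 else 0)) := by
      intro i
      simp only [jetOf, jetComp, differential, pd_trial h₁ hx]
      by_cases hi : i = 0
      · subst hi
        simp [hk']
        ring
      · simp [hi]
        split_ifs <;> ring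
    simp_rw [h]
    rw [← Finset.mul_sum, Finset.sum_add_distrib]
    simp
  set A := x k * (ψ₂ (x 0) + (x 0)⁻¹ * ψ₁ (x 0)) with hA
  set B := ψ₁ (x 0) + (x 0)⁻¹ * ψ (x 0) with hB
  set C := -(x k * (x 0)⁻¹ * ψ₁ (x 0)) with hC
  have e2 : ∑ ij : Fin n × Fin n, jetOf (fun y => y k * ψ (y 0)) (.inr (.inr ij)) x *
      jetOf (fun y => y k * ψ (y 0)) (.inr (.inr ij)) x =
      x 0 ^ 4 * (A ^ 2 + 2 * B ^ 2 + ((n : ℝ) - 1) * C ^ 2) := by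
    have h : ∀ i j : Fin n, jetOf (fun y => y k * ψ (y 0)) (.inr (.inr (i, j))) x *
        jetOf (fun y => y k * ψ (y 0)) (.inr (.inr (i, j))) x =
        x 0 ^ 4 * ((if i = 0 then if j = 0 then A ^ 2 else 0 else 0) +
          (if i = 0 then if j = k then B ^ 2 else 0 else 0) +
          (if i = k then if j = 0 then B ^ 2 else 0 else 0) +
          (if i = j then if i = 0 then 0 else C ^ 2 else 0)) := by
      intro i j
      simp only [jetOf, jetComp, hessian_trial h₁ h₂ hk hx, ← hA, ← hB, ← hC]
      by_cases hi : i = 0 <;> by_cases hj : j = 0 <;> by_cases hik : i = k <;>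
        by_cases hjk : j = k <;> by_cases hij : i = j <;> grind
    rw [Fintype.sum_prod_type]
    simp_rw [h, ← Finset.mul_sum]
    congr 1
    have hcard : ∑ i : Fin n, (if i = 0 then 0 else C ^ 2) = ((n : ℝ) - 1) * C ^ 2 := by
      have : ∀ i : Fin n, (if i = 0 then 0 else C ^ 2) = C ^ 2 - if i = 0 then C ^ 2 else 0 :=
        fun i => by split_ifs <;> ring
      simp_rw [this, Finset.sum_sub_distrib]
      simp
      ring
    simp_rw [Finset.sum_add_distrib]
    simp only [Finset.sum_ite_eq, Finset.mem_univ, if_true, hcard]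
    simp
    ring
  -- The `n - 1` diagonal Hessian entries `C` cancel the vertical part of the gradient term exactly,
  -- leaving only `-(n-1) x₀² ψ²` as negative term.
  rw [e1, e2, hA, hC]
  field_simp
  ring

/-! #### Logarithmic bumps -/

theorem exists_bump : ∃ (χ : ℝ → ℝ) (B : ℝ), ContDiff ℝ ∞ χ ∧ (∀ s, |s| ≤ 1 / 2 → χ s = 1) ∧
    (∀ s, 1 ≤ |s| → χ s = 0 ∧ deriv χ s = 0 ∧ deriv (deriv χ) s = 0) ∧
    ∀ s, |χ s| ≤ B ∧ |deriv χ s| ≤ B ∧ |deriv (deriv χ) s| ≤ B := by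
  let χ : ContDiffBump (0 : ℝ) := ⟨1 / 2, 3 / 4, by norm_num, by norm_num⟩
  have hs : ContDiff ℝ ∞ χ := χ.contDiff
  have hs1 : ContDiff ℝ ∞ (deriv χ) := hs.iterate_deriv 1
  have hs2 : ContDiff ℝ ∞ (deriv (deriv χ)) := hs.iterate_deriv 2
  have hc : HasCompactSupport χ := χ.hasCompactSupport
  obtain ⟨B₀, hB₀⟩ := hs.continuous.bounded_above_of_compact_support hc
  obtain ⟨B₁, hB₁⟩ := hs1.continuous.bounded_above_of_compact_support hc.deriv
  obtain ⟨B₂, hB₂⟩ := hs2.continuous.bounded_above_of_compact_support hc.deriv.deriv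
  refine ⟨χ, max B₀ (max B₁ B₂), hs, fun s h => χ.one_of_mem_closedBall ?_, fun s h => ?_,
    fun s => ⟨(hB₀ s).trans (le_max_left _ _),
      (hB₁ s).trans ((le_max_left _ _).trans (le_max_right _ _)),
      (hB₂ s).trans ((le_max_right _ _).trans (le_max_right _ _))⟩⟩
  · rw [Metric.mem_closedBall, Real.dist_eq, sub_zero]
    exact h
  · have h0 : s ∉ tsupport χ := by
      rw [χ.tsupport_eq, Metric.mem_closedBall, Real.dist_eq, sub_zero]
      change ¬ |s| ≤ 3 / 4
      linarith
    have h1 : s ∉ tsupport (deriv χ) := fun h => h0 (tsupport_deriv_subset h)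
    have h2 : s ∉ tsupport (deriv (deriv χ)) := fun h => h1 (tsupport_deriv_subset h)
    exact ⟨image_eq_zero_of_notMem_tsupport h0, image_eq_zero_of_notMem_tsupport h1,
      image_eq_zero_of_notMem_tsupport h2⟩

/-- If `φ` has derivatives `φ₁`, `φ₂`, these are the derivatives of `φ(log t) / t`. -/
theorem hasDerivAt_log_profile {φ φ₁ φ₂ : ℝ → ℝ} (h₁ : ∀ s, HasDerivAt φ (φ₁ s) s)
    (h₂ : ∀ s, HasDerivAt φ₁ (φ₂ s) s) {t : ℝ} (ht : 0 < t) :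
    HasDerivAt (fun t => φ (Real.log t) / t) ((φ₁ (Real.log t) - φ (Real.log t)) / t ^ 2) t ∧
    HasDerivAt (fun t => (φ₁ (Real.log t) - φ (Real.log t)) / t ^ 2)
      ((φ₂ (Real.log t) - 3 * φ₁ (Real.log t) + 2 * φ (Real.log t)) / t ^ 3) t := by
  have hl := Real.hasDerivAt_log ht.ne'
  have d0 : HasDerivAt (fun t => φ (Real.log t)) (φ₁ (Real.log t) * t⁻¹) t := (h₁ _).comp t hl
  have d1 : HasDerivAt (fun t => φ₁ (Real.log t)) (φ₂ (Real.log t) * t⁻¹) t := (h₂ _).comp t hl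
  have dt : HasDerivAt (fun t : ℝ => t ^ 2) (2 * t) t := by simpa using hasDerivAt_pow 2 t
  constructor
  · refine (d0.fun_div (hasDerivAt_id' t) ht.ne').congr_deriv ?_
    field_simp
  · refine ((d1.fun_sub d0).fun_div dt (by positivity)).congr_deriv ?_
    field_simp
    ring

end Trial

/-! ### Estimate of the trial functions and choice of the parameters -/

section Main

/-- The logarithmic bump of half-length `l` centred at height `exp s₀`. -/
def logBump (χ : ℝ → ℝ) (s₀ l t : ℝ) : ℝ := χ ((Real.log t - s₀) / l) / t

/-- The first derivative of `logBump`. -/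
def logBump₁ (χ : ℝ → ℝ) (s₀ l t : ℝ) : ℝ :=
  (deriv χ ((Real.log t - s₀) / l) / l - χ ((Real.log t - s₀) / l)) / t ^ 2

/-- The second derivative of `logBump`. -/
def logBump₂ (χ : ℝ → ℝ) (s₀ l t : ℝ) : ℝ :=
  (deriv (deriv χ) ((Real.log t - s₀) / l) / l ^ 2 - 3 * (deriv χ ((Real.log t - s₀) / l) / l) +
    2 * χ ((Real.log t - s₀) / l)) / t ^ 3

theorem hasDerivAt_logBump {χ : ℝ → ℝ} (hχ : ContDiff ℝ ∞ χ) (s₀ l : ℝ) {t : ℝ} (ht : 0 < t) :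
    HasDerivAt (logBump χ s₀ l) (logBump₁ χ s₀ l t) t ∧
      HasDerivAt (logBump₁ χ s₀ l) (logBump₂ χ s₀ l t) t := by
  have ha : ∀ s, HasDerivAt (fun s : ℝ => (s - s₀) / l) (1 / l) s := fun s =>
    ((hasDerivAt_id s).sub_const s₀).div_const l
  have hχ1 : ContDiff ℝ ∞ (deriv χ) := hχ.iterate_deriv 1
  have h1 : ∀ s, HasDerivAt (fun s => χ ((s - s₀) / l)) (deriv χ ((s - s₀) / l) / l) s := fun s => by
    have := ((hχ.differentiable (by simp)) ((s - s₀) / l)).hasDerivAt.comp s (ha s)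
    refine this.congr_deriv ?_
    ring
  have h2 : ∀ s, HasDerivAt (fun s => deriv χ ((s - s₀) / l) / l)
      (deriv (deriv χ) ((s - s₀) / l) / l ^ 2) s := fun s => by
    have := (((hχ1.differentiable (by simp)) ((s - s₀) / l)).hasDerivAt.comp s (ha s)).div_const l
    refine this.congr_deriv ?_
    ring
  exact hasDerivAt_log_profile h1 h2 ht

theorem contDiffOn_logBump {n : ℕ} [NeZero n] {χ : ℝ → ℝ} (hχ : ContDiff ℝ ∞ χ) (s₀ l : ℝ)
    (k : Fin n) :
    ContDiffOn ℝ ∞ (fun y : Fin n → ℝ => y k * logBump χ s₀ l (y 0)) (halfSpace n) := by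
  have hne : ∀ y ∈ halfSpace n, y 0 ≠ 0 := fun y hy => ne_of_gt hy
  have h0 : ContDiffOn ℝ ∞ (fun y : Fin n → ℝ => y 0) (halfSpace n) := by fun_prop
  have h1 : ContDiffOn ℝ ∞ (fun y : Fin n → ℝ => χ ((Real.log (y 0) - s₀) / l)) (halfSpace n) :=
    hχ.comp_contDiffOn (((h0.log hne).sub contDiffOn_const).div_const l)
  have h2 : ContDiffOn ℝ ∞ (fun y : Fin n → ℝ => y k) (halfSpace n) := by fun_prop
  exact h2.mul (h1.div h0 hne)

/-- Away from its support, a logarithmic bump vanishes with its derivatives. -/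
theorem logBump_eq_zero {χ : ℝ → ℝ}
    (hχ0 : ∀ s, 1 ≤ |s| → χ s = 0 ∧ deriv χ s = 0 ∧ deriv (deriv χ) s = 0) {s₀ l : ℝ} (hl : 0 < l)
    {t : ℝ} (ht : 0 < t) (hout : t ∉ Set.Ioo (Real.exp (s₀ - l)) (Real.exp (s₀ + l))) :
    logBump χ s₀ l t = 0 ∧ logBump₁ χ s₀ l t = 0 ∧ logBump₂ χ s₀ l t = 0 := by
  have h1 : 1 ≤ |(Real.log t - s₀) / l| := by
    rw [abs_div, abs_of_pos hl, one_le_div hl]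
    by_contra hcon
    rw [not_le, abs_lt] at hcon
    apply hout
    rw [Set.mem_Ioo, ← Real.lt_log_iff_exp_lt ht, ← Real.log_lt_iff_lt_exp ht]
    constructor <;> linarith [hcon.1, hcon.2]
  obtain ⟨z, z₁, z₂⟩ := hχ0 _ h1
  simp [logBump, logBump₁, logBump₂, z, z₁, z₂]

/-- Pointwise bound for the Neumann form density of a trial function on the slim domain. -/
theorem trialDensity_le {χ : ℝ → ℝ} {B : ℝ}
    (hχB : ∀ s, |χ s| ≤ B ∧ |deriv χ s| ≤ B ∧ |deriv (deriv χ) s| ≤ B) {s₀ l : ℝ} (hl : 1 ≤ l)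
    {t y d M q : ℝ} (ht : 0 < t) (hy : y ^ 2 ≤ d ^ 2 * t ^ 2) (hM : 0 ≤ M) (hq : 1 ≤ q) :
    t ^ 4 * (y ^ 2 * (logBump₂ χ s₀ l t + t⁻¹ * logBump₁ χ s₀ l t) ^ 2 +
        2 * (logBump₁ χ s₀ l t + t⁻¹ * logBump χ s₀ l t) ^ 2) - q * (t ^ 2 * logBump χ s₀ l t ^ 2) +
        M * ((y * logBump χ s₀ l t) * (y * logBump χ s₀ l t)) ≤
      d ^ 2 * B ^ 2 * (16 + M) + 2 * B ^ 2 / l ^ 2 - χ ((Real.log t - s₀) / l) ^ 2 := by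
  obtain ⟨b0, b1, b2⟩ := hχB ((Real.log t - s₀) / l)
  set p0 := χ ((Real.log t - s₀) / l) with hp0
  set p1 := deriv χ ((Real.log t - s₀) / l) / l with hp1
  set p2 := deriv (deriv χ) ((Real.log t - s₀) / l) / l ^ 2 with hp2
  have hl0 : 0 < l := by linarith
  have hB : 0 ≤ B := (abs_nonneg _).trans b0
  have c1 : |p1| ≤ B / l := by
    rw [hp1, abs_div, abs_of_pos hl0]; gcongr
  have c1' : |p1| ≤ B := c1.trans (div_le_self hB hl)
  have c2 : |p2| ≤ B := by
    rw [hp2, abs_div, abs_of_pos (by positivity : 0 < l ^ 2)]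
    exact (div_le_div_of_nonneg_right b2 (by positivity)).trans
      (div_le_self hB (one_le_pow₀ hl))
  have hf : (y / t) ^ 2 ≤ d ^ 2 := by
    rw [div_pow, div_le_iff₀ (by positivity)]; exact hy
  -- The profile `χ(log t)/t` makes every power of `t` cancel, apart from the ratio `y/t`, which is
  -- at most `d` in absolute value. The mixed Hessian terms reduce to `p1`, which is of order `1/l`.
  have e : t ^ 4 * (y ^ 2 * (logBump₂ χ s₀ l t + t⁻¹ * logBump₁ χ s₀ l t) ^ 2 +
        2 * (logBump₁ χ s₀ l t + t⁻¹ * logBump χ s₀ l t) ^ 2) - q * (t ^ 2 * logBump χ s₀ l t ^ 2) +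
        M * ((y * logBump χ s₀ l t) * (y * logBump χ s₀ l t)) =
      (y / t) ^ 2 * ((p2 - 2 * p1 + p0) ^ 2 + M * p0 ^ 2) + 2 * p1 ^ 2 - q * p0 ^ 2 := by
    simp only [logBump, logBump₁, logBump₂, ← hp0, ← hp1, ← hp2]
    field_simp
    ring
  rw [e]
  have s0 : p0 ^ 2 ≤ B ^ 2 := sq_le_sq' (by linarith [abs_le.1 b0]) (abs_le.1 b0).2
  have s1 : p1 ^ 2 ≤ B ^ 2 / l ^ 2 := by
    rw [← div_pow]
    exact sq_le_sq' (by linarith [abs_le.1 c1]) (abs_le.1 c1).2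
  -- Since `l ≥ 1`, each of `p0`, `p1`, `p2` is at most `B` in absolute value, whence `4B` for the
  -- combination.
  have s2 : (p2 - 2 * p1 + p0) ^ 2 ≤ 16 * B ^ 2 := by
    have a0 := abs_le.1 b0
    have a1 := abs_le.1 c1'
    have a2 := abs_le.1 c2
    have : (p2 - 2 * p1 + p0) ^ 2 ≤ (4 * B) ^ 2 :=
      sq_le_sq' (by linarith [a0.1, a1.2, a2.1]) (by linarith [a0.2, a1.1, a2.2])
    linarith
  have s3 : (y / t) ^ 2 * ((p2 - 2 * p1 + p0) ^ 2 + M * p0 ^ 2) ≤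
      d ^ 2 * (16 * B ^ 2 + M * B ^ 2) := by
    gcongr
  have s4 : p0 ^ 2 ≤ q * p0 ^ 2 := le_mul_of_one_le_left (sq_nonneg _) hq
  have s5 : 2 * B ^ 2 / l ^ 2 = 2 * (B ^ 2 / l ^ 2) := by ring
  rw [s5]
  linarith

theorem exists_domain_spectrum_le (m : ℕ) (hm : m ≠ 0) (N : ℕ) (M : ℝ) (hM : 0 < M) :
    ∃ Ω : Set (Fin (m + 1) → ℝ),
      IsBoundedDomain (halfSpace (m + 1)) (hyperbolicMetric (m + 1)) Ω ∧ HasC1Boundary Ω ∧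
      riemVolume (hyperbolicMetric (m + 1)) Ω = 1 ∧
      ∃ mu : ℕ → ℝ, IsNeumannSpectrum (hyperbolicMetric (m + 1)) Ω mu ∧
        ∀ j : ℕ, j < N → mu j ≤ -M := by
  obtain ⟨χ, B, hχ, hχ1, hχ0, hχB⟩ := exists_bump
  have hB1 : 1 ≤ B := by
    have h1 := (hχB 0).1
    rw [hχ1 0 (by simp)] at h1
    simpa using h1
  -- Each of the two error terms, from the width and from the cutoff, is to be at most `τ`, so that
  -- together they stay below half of the volume ratio constant `2⁻ᵐ`.
  set τ : ℝ := (2 ^ m)⁻¹ / 4 with hτ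
  have hτ0 : 0 < τ := by positivity
  set η : ℝ := Real.sqrt (τ / (B ^ 2 * (16 + M))) with hη
  have hη0 : 0 < η := Real.sqrt_pos.2 (by positivity)
  obtain ⟨L₀, hL₀⟩ := exists_width hm hη0
  -- The summands serve in turn to give `l ≥ 1`, to make `L ≥ L₀`, and to bring the cutoff error
  -- `2B²/l²` below `τ`.
  set l : ℝ := 1 + |L₀| + 2 * B ^ 2 / τ with hl
  have hBτ : 0 < 2 * B ^ 2 / τ := by positivity
  have hl1 : 1 ≤ l := by rw [hl]; linarith [abs_nonneg L₀]
  have hl0 : 0 < l := by linarith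
  -- Room for `N + 1` disjoint bumps of length `2l`. One more than required keeps `L ≥ l > 0` when
  -- `N = 0`.
  set L : ℝ := 2 * (N + 1) * l with hL
  have hlL : l ≤ L := by
    rw [hL]
    have : (0 : ℝ) ≤ N := Nat.cast_nonneg N
    nlinarith
  obtain ⟨d, E, hd0, hdη, hE, hvol, hslab⟩ := hL₀ L
    (by linarith [le_abs_self L₀]) (by linarith)
  set K : ℝ := 4 * Real.exp L with hK
  have hexp : 1 < Real.exp L := Real.one_lt_exp_iff.2 (by linarith)
  have hK1 : 1 < K := by linarith
  have hc : 0 < d ^ 2 / K := by positivity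
  set Ω := slimDomain (m + 1) (d ^ 2 / K) K with hΩdef
  have hΩ : IsStripDomain Ω K := isStripDomain_slimDomain (by omega) hc hK1
  refine ⟨Ω, hΩ.isBoundedDomain, hasC1Boundary_slimDomain hc hK1, hvol, ?_⟩
  let k : Fin (m + 1) := ⟨1, by omega⟩
  have hk : k ≠ 0 := by simp [k, Fin.ext_iff]
  have hkd : ∀ x ∈ Ω, x k ^ 2 ≤ d ^ 2 * x 0 ^ 2 := fun x hx => by
    have h1 := (sq_le_axisDistSq x hk).trans (axisDistSq_le_of_mem hc hK1 hx)
    rwa [div_mul_cancel₀ _ (by linarith : K ≠ 0)] at h1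
  -- The intervals of half-length `l` about these centres tile `[log 2, log 2 + L]`, the logarithmic
  -- heights at which slab volumes are comparable with their lengths.
  let s₀ : Fin (N + 1) → ℝ := fun j => Real.log 2 + (2 * (j : ℝ) + 1) * l
  let u : Fin (N + 1) → (Fin (m + 1) → ℝ) → ℝ := fun j y => y k * logBump χ (s₀ j) l (y 0)
  have hd1 : ∀ (j : Fin (N + 1)) (t : ℝ), 0 < t →
      HasDerivAt (logBump χ (s₀ j) l) (logBump₁ χ (s₀ j) l t) t := fun j t ht =>
    (hasDerivAt_logBump hχ _ _ ht).1
  have hd2 : ∀ (j : Fin (N + 1)) (t : ℝ), 0 < t →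
      HasDerivAt (logBump₁ χ (s₀ j) l) (logBump₂ χ (s₀ j) l t) t := fun j t ht =>
    (hasDerivAt_logBump hχ _ _ ht).2
  have hlo : ∀ j : Fin (N + 1), 2 ≤ Real.exp (s₀ j - l) := fun j => by
    have h1 : Real.log 2 ≤ s₀ j - l := by
      simp only [s₀]
      have : 0 ≤ (j : ℝ) * l := by positivity
      linarith
    calc (2 : ℝ) = Real.exp (Real.log 2) := (Real.exp_log (by norm_num)).symm
      _ ≤ _ := Real.exp_le_exp.2 h1
  have hhi : ∀ j : Fin (N + 1), Real.exp (s₀ j + l) ≤ 2 * Real.exp L := fun j => by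
    have h1 : s₀ j + l ≤ Real.log 2 + L := by
      simp only [s₀, hL]
      have h2 : ((j : ℕ) : ℝ) ≤ N := by exact_mod_cast Nat.lt_succ_iff.1 j.2
      nlinarith
    calc Real.exp (s₀ j + l) ≤ Real.exp (Real.log 2 + L) := Real.exp_le_exp.2 h1
      _ = _ := by rw [Real.exp_add, Real.exp_log (by norm_num)]
  have hdisj : ∀ i j, i ≠ j → ∀ x ∈ Ω, ∀ a, jetOf (u i) a x * jetOf (u j) a x = 0 := by
    intro i j hij x hx a
    have hx0 := hΩ.pos x hx
    by_cases hi : x 0 ∈ Set.Ioo (Real.exp (s₀ i - l)) (Real.exp (s₀ i + l))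
    · have hj : x 0 ∉ Set.Ioo (Real.exp (s₀ j - l)) (Real.exp (s₀ j + l)) := by
        intro hj
        have h1 := Real.exp_lt_exp.1 (hi.1.trans hj.2)
        have h2 := Real.exp_lt_exp.1 (hj.1.trans hi.2)
        simp only [s₀] at h1 h2
        have h3 : ((i : ℕ) : ℝ) < (j : ℕ) + 1 := by
          by_contra hcon
          push Not at hcon
          nlinarith
        have h4 : ((j : ℕ) : ℝ) < (i : ℕ) + 1 := by
          by_contra hcon
          push Not at hcon
          nlinarith
        norm_cast at h3 h4
        exact hij (Fin.ext (by omega))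
      obtain ⟨z, z₁, z₂⟩ := logBump_eq_zero hχ0 hl0 hx0 hj
      rw [jetOf_trial_eq_zero (hd1 j) (hd2 j) hk hx0 z z₁ z₂ a, mul_zero]
    · obtain ⟨z, z₁, z₂⟩ := logBump_eq_zero hχ0 hl0 hx0 hi
      rw [jetOf_trial_eq_zero (hd1 i) (hd2 i) hk hx0 z z₁ z₂ a, zero_mul]
  have hne : ∀ j, ∫ x, u j x * u j x ∂(hypMeasure Ω) ≠ 0 := by
    intro j hz
    have huc : ContinuousOn (u j) (halfSpace (m + 1)) := (contDiffOn_logBump hχ _ _ k).continuousOn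
    have hint : Integrable (fun x => u j x * u j x) (hypMeasure Ω) :=
      (hΩ.memLp huc).integrable_mul (hΩ.memLp huc)
    have h1 := (integral_eq_zero_iff_of_nonneg (fun x => mul_self_nonneg (u j x)) hint).1 hz
    have hac : volume.restrict Ω ≪ hypMeasure Ω :=
      (Measure.absolutelyContinuous_of_le hΩ.volume_restrict_le).trans
        Measure.smul_absolutelyContinuous
    have huΩ : ContinuousOn (u j) Ω := huc.mono hΩ.pos
    have h2 := Measure.eqOn_open_of_ae_eq (hac h1) hΩ.isOpen (huΩ.mul huΩ) continuousOn_const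
    have ht1 : 1 < Real.exp (s₀ j) := by
      have := hlo j
      have h3 := Real.exp_le_exp.2 (by linarith : s₀ j - l ≤ s₀ j)
      linarith
    have htK : Real.exp (s₀ j) < K := by
      have := hhi j
      have h3 := Real.exp_le_exp.2 (by linarith : s₀ j ≤ s₀ j + l)
      linarith
    obtain ⟨x, hx, hx0, hxk⟩ := slimDomain_nonempty (n := m + 1) hc ht1 htK hk
    have h3 : u j x * u j x = 0 := h2 hx
    have h4 : u j x = 0 := mul_self_eq_zero.1 h3
    simp only [u, logBump, hx0, Real.log_exp, sub_self, zero_div] at h4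
    rw [hχ1 0 (by simp)] at h4
    have h5 : x k * (1 / Real.exp (s₀ j)) ≠ 0 := mul_ne_zero hxk (by positivity)
    exact h5 h4
  have hq : ∀ j, ∫ x, (∑ ij : Fin (m + 1) × Fin (m + 1), jetOf (u j) (.inr (.inr ij)) x *
      jetOf (u j) (.inr (.inr ij)) x - (((m + 1 : ℕ) : ℝ) - 1) *
      ∑ i : Fin (m + 1), jetOf (u j) (.inr (.inl i)) x * jetOf (u j) (.inr (.inl i)) x +
      M * (u j x * u j x)) ∂(hypMeasure Ω) ≤ 0 := by
    intro j
    have := hΩ.isFiniteMeasure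
    set κ : ℝ := d ^ 2 * B ^ 2 * (16 + M) + 2 * B ^ 2 / l ^ 2 with hκ
    have hκ0 : 0 ≤ κ := by positivity
    -- On the support `O`, of volume at most `2lE`, the density is at most `κ`; on the plateau `P`,
    -- of volume at least `2⁻ᵐ l E`, it is at most `κ - 1`. So `κ ≤ 2⁻ᵐ/2` makes the integral
    -- nonpositive.
    have hκτ : κ ≤ (2 ^ m)⁻¹ / 2 := by
      have k1 : d ^ 2 * B ^ 2 * (16 + M) ≤ τ := by
        have k2 : d ^ 2 ≤ τ / (B ^ 2 * (16 + M)) := by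
          have k3 : d ^ 2 ≤ η ^ 2 := by gcongr
          rwa [hη, Real.sq_sqrt (by positivity)] at k3
        rw [le_div_iff₀ (by positivity)] at k2
        linarith
      have k4 : 2 * B ^ 2 / l ^ 2 ≤ τ := by
        rw [div_le_iff₀ (by positivity)]
        have k5 : 2 * B ^ 2 / τ ≤ l ^ 2 := by
          have k6 : 2 * B ^ 2 / τ ≤ l := by rw [hl]; linarith [abs_nonneg L₀]
          nlinarith
        rw [div_le_iff₀ hτ0] at k5
        linarith
      rw [hκ]
      linarith
    set O : Set (Fin (m + 1) → ℝ) :=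
      {x | x 0 ∈ Set.Ioo (Real.exp (s₀ j - l)) (Real.exp (s₀ j + l))} with hO
    set P : Set (Fin (m + 1) → ℝ) :=
      {x | x 0 ∈ Set.Ioo (Real.exp (s₀ j - l / 2)) (Real.exp (s₀ j + l / 2))} with hP
    have hOm : MeasurableSet O := (measurable_pi_apply 0) measurableSet_Ioo
    have hPm : MeasurableSet P := (measurable_pi_apply 0) measurableSet_Ioo
    have hPO : P ⊆ O := fun x hx => Set.Ioo_subset_Ioo
      (Real.exp_le_exp.2 (by linarith)) (Real.exp_le_exp.2 (by linarith)) hx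
    have hOv : (hypMeasure Ω).real O ≤ E * (2 * l) := by
      have h1 := (hslab (Real.exp (s₀ j - l)) (Real.exp (s₀ j + l)) (hlo j)
        (Real.exp_le_exp.2 (by linarith)) (hhi j)).2
      rw [← Real.exp_sub, Real.log_exp, show s₀ j + l - (s₀ j - l) = 2 * l by ring] at h1
      rw [measureReal_def, Measure.restrict_apply hOm, Set.inter_comm]
      exact ENNReal.toReal_le_of_le_ofReal (by positivity) h1
    have hPv : E * (2 ^ m)⁻¹ * l ≤ (hypMeasure Ω).real P := by
      have h1 := (hslab (Real.exp (s₀ j - l / 2)) (Real.exp (s₀ j + l / 2))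
        ((hlo j).trans (Real.exp_le_exp.2 (by linarith)))
        (Real.exp_le_exp.2 (by linarith))
        ((Real.exp_le_exp.2 (by linarith)).trans (hhi j))).1
      rw [← Real.exp_sub, Real.log_exp, show s₀ j + l / 2 - (s₀ j - l / 2) = l by ring] at h1
      rw [measureReal_def]
      refine (ENNReal.ofReal_le_iff_le_toReal (measure_ne_top _ _)).1 ?_
      rw [Measure.restrict_apply hPm, Set.inter_comm]
      exact h1
    have hpt : ∀ x ∈ Ω, ∑ ij : Fin (m + 1) × Fin (m + 1), jetOf (u j) (.inr (.inr ij)) x *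
        jetOf (u j) (.inr (.inr ij)) x - (((m + 1 : ℕ) : ℝ) - 1) *
        ∑ i : Fin (m + 1), jetOf (u j) (.inr (.inl i)) x * jetOf (u j) (.inr (.inl i)) x +
        M * (u j x * u j x) ≤ O.indicator (fun _ => κ) x - P.indicator (fun _ => 1) x := by
      intro x hx
      have hx0 := hΩ.pos x hx
      rw [neumannDensity_trial (hd1 j) (hd2 j) hk hx0]
      by_cases hxO : x ∈ O
      -- Here the dimension is at least two; in dimension one the Ricci term would vanish.
      · have hq : (1 : ℝ) ≤ ((m + 1 : ℕ) : ℝ) - 1 := by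
          have : (1 : ℝ) ≤ m := by exact_mod_cast Nat.one_le_iff_ne_zero.2 hm
          push_cast
          linarith
        refine (trialDensity_le hχB hl1 hx0 (hkd x hx) hM.le hq).trans ?_
        rw [Set.indicator_of_mem hxO]
        have hPle : P.indicator (fun _ => (1 : ℝ)) x ≤ χ ((Real.log (x 0) - s₀ j) / l) ^ 2 := by
          by_cases hxP : x ∈ P
          · rw [Set.indicator_of_mem hxP, hχ1]
            · norm_num
            · obtain ⟨h1, h2⟩ := hxP
              rw [← Real.lt_log_iff_exp_lt hx0] at h1
              rw [← Real.log_lt_iff_lt_exp hx0] at h2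
              rw [abs_div, abs_of_pos hl0, div_le_iff₀ hl0, abs_le]
              constructor <;> linarith
          · rw [Set.indicator_of_notMem hxP]
            positivity
        linarith
      · obtain ⟨z, z₁, z₂⟩ := logBump_eq_zero hχ0 hl0 hx0 hxO
        rw [Set.indicator_of_notMem hxO, Set.indicator_of_notMem fun h => hxO (hPO h)]
        simp [u, z, z₁, z₂]
    have hint : Integrable (fun x => ∑ ij : Fin (m + 1) × Fin (m + 1),
        jetOf (u j) (.inr (.inr ij)) x * jetOf (u j) (.inr (.inr ij)) x -
        (((m + 1 : ℕ) : ℝ) - 1) *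
        ∑ i : Fin (m + 1), jetOf (u j) (.inr (.inl i)) x * jetOf (u j) (.inr (.inl i)) x +
        M * (u j x * u j x)) (hypMeasure Ω) := by
      have hjet : ∀ a, MemLp (jetOf (u j) a) 2 (hypMeasure Ω) := fun a =>
        hΩ.memLp (continuousOn_jetOf isOpen_halfSpace (fun x hx => hx)
          (contDiffOn_logBump hχ _ _ k) a)
      have huj : MemLp (u j) 2 (hypMeasure Ω) :=
        hΩ.memLp (contDiffOn_logBump hχ _ _ k).continuousOn
      exact ((integrable_finsetSum _ fun ij _ => (hjet _).integrable_mul (hjet _)).sub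
        ((integrable_finsetSum _ fun i _ => (hjet _).integrable_mul (hjet _)).const_mul _)).add
        ((huj.integrable_mul huj).const_mul _)
    have hi1 : Integrable (O.indicator fun _ => κ) (hypMeasure Ω) :=
      (integrable_const κ).indicator hOm
    have hi2 : Integrable (P.indicator fun _ => (1 : ℝ)) (hypMeasure Ω) :=
      (integrable_const 1).indicator hPm
    refine (integral_mono_ae hint (hi1.sub hi2) ?_).trans ?_
    · filter_upwards [hΩ.ae_mem] with x hx using hpt x hx
    · simp only [Pi.sub_apply]
      rw [integral_sub hi1 hi2, integral_indicator_const _ hOm, integral_indicator_const _ hPm]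
      simp only [smul_eq_mul, mul_one]
      have h1 : (hypMeasure Ω).real O * κ ≤ E * (2 * l) * ((2 ^ m)⁻¹ / 2) := by gcongr
      have h2 : E * (2 * l) * ((2 ^ m)⁻¹ / 2) = E * (2 ^ m)⁻¹ * l := by ring
      linarith
  obtain ⟨mu, hmu, hle⟩ := exists_neumannSpectrum hΩ (N := N + 1) (M := M) u
    (fun j => contDiffOn_logBump hχ _ _ k) hdisj hne hq
  exact ⟨mu, hmu, fun j hj => hle j (by omega)⟩

end Main

end BiharmonicNeumann

end

theorem mainTheorem6 (n : ℕ) [NeZero n] (hn : 2 ≤ n) (N : ℕ) (M : ℝ) (hM : 0 < M) :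
    ∃ Ω : Set (Fin n → ℝ),
      BiharmonicNeumann.IsBoundedDomain (BiharmonicNeumann.halfSpace n)
        (BiharmonicNeumann.hyperbolicMetric n) Ω ∧
      BiharmonicNeumann.HasC1Boundary Ω ∧
      BiharmonicNeumann.riemVolume (BiharmonicNeumann.hyperbolicMetric n) Ω = 1 ∧
      ∃ mu : ℕ → ℝ,
        BiharmonicNeumann.IsNeumannSpectrum (BiharmonicNeumann.hyperbolicMetric n) Ω mu ∧
        ∀ j : ℕ, j < N → mu j ≤ -M := by
  obtain ⟨m, rfl⟩ : ∃ m, n = m + 1 := ⟨n - 1, by omega⟩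
  exact BiharmonicNeumann.exists_domain_spectrum_le m (by omega) N M hM
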